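/- Let $k\ge 1$. Let $\mathcal P_2(\mathbb R^k)$ be the set of Borel probability measures on $\mathbb R^k$ with finite second moment, equipped with the 2-Wasserstein distance normalized by $W_2(\mu,\nu)^2=\inf_{\pi\in\Pi(\mu,\nu)}\int \frac12|x-y|^2\,\pi(dx,dy)$ (also used for measures on $\mathbb R$), where $\Pi(\mu,\nu)$ is the set of couplings of $\mu$ and $\nu$. For $\theta$ in the unit sphere $\mathcal S^{k-1}$ let $\mu_\theta$ be the pushforward of $\mu$ under $x\mapsto x^\top\theta$, and let $$SW_2(\mu,\nu)^2=\int_{\mathcal S^{k-1}}W_2(\mu_\theta,\nu_\theta)^2\,d\theta,$$ where $d\theta$ is the uniform probability measure on $\mathcal S^{k-1}$. For $\sigma>0$ let $\mu^\sigma=\mu*\mathcal N_\sigma$, where $\mathcal N_\sigma$ is the normal distribution on $\mathbb R^k$ with mean $0$ and covariance $\sigma^2 I_k$, let $SW_2^\sigma(\mu,\nu)=SW_2(\mu^\sigma,\nu^\sigma)$, and let $$\rho_\sigma((s,\mu),(t,\nu))=|t-s|^2+SW_2^\sigma(\mu,\nu)^2 .$$ A function $u:\mathcal P_2(\mathbb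 R^k)\to\mathbb R$ is called $L$-differentiable with derivative $D_\mu u$ if $D_\mu u:\mathcal P_2(\mathbb R^k)\times\mathbb R^k\to\mathbb R^k$ is jointly continuous and, on every atomless probability space $(\Omega,\mathbb P)$, the lifting $U(X)=u(\mathbb P_X)$, where $\mathbb P_X$ is the law of $X$, is Fréchet differentiable at every $X\in L^2(\Omega,\mathbb P;\mathbb R^k)$ with gradient $D_\mu u(\mathbb P_X)(X)$. When $x\mapsto D_\mu u(\mu)(x)$ is differentiable, $D^2_{x\mu}u(\mu)(x)$ denotes its derivative, and $|D^2_{x\mu}u(\mu)(x)|$ its operator norm. For every $\lambda>0$ there is a constant $C$, depending only on $k$ and $\lambda$, such that the following holds. Let $T>0$ and $\delta>0$, let $G:[0,T]\times\mathcal P_2(\mathbb R^k)\to\mathbb R$ be upper semicontinuous and bounded from above, and let $(t_0,\mu_0)\in[0,T]\times\mathcal P_2(\mathbb R^k)$ satisfy $$\sup_{[0,T]\times\mathcal P_2(\mathbb R^k)}G-\lambda\le G(t_0,\mu_0).$$ Then there exist $(\tilde t,\tilde\mu)\in[0,T]\times\mathcal P_2(\mathbb R^k)$ and a sequence $\{(t_n,\mu_n)\}_{n\ge1}\subset[0,T]\times\mathcal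 P_2(\mathbb R^k)$ such that: (i) $\rho_{1/\delta}((\tilde t,\tilde\mu),(t_n,\mu_n))\le\frac{\lambda}{2^n\delta^2}$ for every $n\ge0$; (ii) the series $\phi_\delta(t,\mu)=\sum_{n=0}^{\infty}\frac1{2^n}\rho_{1/\delta}((t,\mu),(t_n,\mu_n))$ converges for every $(t,\mu)\in[0,T]\times\mathcal P_2(\mathbb R^k)$, and $G(t_0,\mu_0)\le G(\tilde t,\tilde\mu)-\delta^2\phi_\delta(\tilde t,\tilde\mu)$; (iii) $G(t,\mu)-\delta^2\phi_\delta(t,\mu)<G(\tilde t,\tilde\mu)-\delta^2\phi_\delta(\tilde t,\tilde\mu)$ for every $(t,\mu)\in([0,T]\times\mathcal P_2(\mathbb R^k))\setminus\{(\tilde t,\tilde\mu)\}$. Furthermore, for all $(t,\mu)\in[0,T]\times\mathcal P_2(\mathbb R^k)$: (1) $s\mapsto\phi_\delta(s,\mu)$ is differentiable on $[0,T]$ (one-sided at the endpoints), $\phi_\delta(t,\cdot)$ is $L$-differentiable, and $x\mapsto D_\mu\phi_\delta(t,\mu)(x)$ is differentiable on $\mathbb R^k$; (2) $|\partial_t\phi_\delta(t,\mu)|\le4T$;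 (3) $\int|D_\mu\phi_\delta(t,\mu)(x)|^2\,\mu(dx)\le C\left(\int|x|^2\,\mu(dx)+\int|x|^2\,\tilde\mu(dx)+\frac1{\delta^2}\right)$; (4) $\int|D^2_{x\mu}\phi_\delta(t,\mu)(x)|\,\mu(dx)\le C\left(1+\delta\sqrt{\int|x|^2\,\tilde\mu(dx)}\right)$. -/

import Mathlib

open Set Filter Topology MeasureTheory
open scoped ENNReal

universe u

/-- The Euclidean space `ℝᵏ`. -/
abbrev RSpace (k : ℕ) : Type := EuclideanSpace ℝ (Fin k)

/-- `𝒫₂(ℝᵏ)`: Borel probability measures on `ℝᵏ` with finite second moment. -/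
def P2 (k : ℕ) : Type :=
  {μ : Measure (RSpace k) // IsProbabilityMeasure μ ∧ Integrable (fun x => ‖x‖ ^ 2) μ}

/-- The underlying measure of an element of `𝒫₂(ℝᵏ)`. -/
def P2.toMeasure {k : ℕ} (μ : P2 k) : Measure (RSpace k) := μ.1

/-- The second moment `∫ |x|² μ(dx)`. -/
noncomputable def P2.secondMoment {k : ℕ} (μ : P2 k) : ℝ := ∫ x, ‖x‖ ^ 2 ∂μ.toMeasure

/-- `Π(μ, ν)`: the measures on the product with first marginal `μ` and second marginal `ν`. -/
def couplings {F : Type*} [MeasurableSpace F] (μ ν : Measure F) : Set (Measure (F × F)) :=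
  {π | π.map Prod.fst = μ ∧ π.map Prod.snd = ν}

/-- `W₂(μ, ν)² = inf_{π ∈ Π(μ, ν)} ∫ ½ |x - y|² π(dx, dy)`, as an extended nonnegative real
(it is finite for measures with finite second moment). -/
noncomputable def wassersteinSq {F : Type*} [NormedAddCommGroup F] [MeasurableSpace F]
    (μ ν : Measure F) : ℝ≥0∞ :=
  ⨅ π ∈ couplings μ ν, ∫⁻ z, ENNReal.ofReal (‖z.1 - z.2‖ ^ 2 / 2) ∂π

/-- The 2-Wasserstein distance on `𝒫₂(ℝᵏ)`. -/
noncomputable def P2.W2 {k : ℕ} (μ ν : P2 k) : ℝ :=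
  √ (wassersteinSq μ.toMeasure ν.toMeasure).toReal

/-- The neighbourhood filter of `μ` in the metric space `(𝒫₂(ℝᵏ), W₂)`: it is generated by the
balls `{ν | W₂(μ, ν) < ε}`, `ε > 0`. -/
noncomputable def P2.nhdsW2 {k : ℕ} (μ : P2 k) : Filter (P2 k) := comap (fun ν => μ.W2 ν) (𝓝 0)

/-- The uniform probability measure on the unit sphere `𝕊ᵏ⁻¹` (normalized surface measure). -/
noncomputable def sphereMeasure (k : ℕ) : Measure (Metric.sphere (0 : RSpace k) 1) :=
  ((volume : Measure (RSpace k)).toSphere univ)⁻¹ • (volume : Measure (RSpace k)).toSphere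

/-- The one-dimensional projection `μ_θ`, the pushforward of `μ` under `x ↦ xᵀθ`. -/
noncomputable def proj {k : ℕ} (μ : Measure (RSpace k)) (θ : Metric.sphere (0 : RSpace k) 1) :
    Measure ℝ :=
  μ.map (fun x => inner ℝ x (θ : RSpace k))

/-- The sliced Wasserstein distance, `SW₂(μ, ν)² = ∫ W₂(μ_θ, ν_θ)² dθ`. -/
noncomputable def SW2 {k : ℕ} (μ ν : Measure (RSpace k)) : ℝ :=
  √ (∫⁻ θ, wassersteinSq (proj μ θ) (proj ν θ) ∂(sphereMeasure k)).toReal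

/-- The normal distribution `𝒩_σ` on `ℝᵏ` with mean `0` and covariance matrix `σ² I_k`: the law
of `σ Z` with `Z` standard normal. -/
noncomputable def normalMeasure (k : ℕ) (σ : ℝ) : Measure (RSpace k) :=
  (ProbabilityTheory.stdGaussian (RSpace k)).map (fun x => σ • x)

/-- The Gaussian regularization `μ^σ = μ ∗ 𝒩_σ`. -/
noncomputable def P2.reg {k : ℕ} (σ : ℝ) (μ : P2 k) : Measure (RSpace k) :=
  Measure.conv μ.toMeasure (normalMeasure k σ)

/-- The Gaussian regularized sliced Wasserstein distance `SW₂^σ(μ, ν) = SW₂(μ^σ, ν^σ)`. -/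
noncomputable def SW2reg {k : ℕ} (σ : ℝ) (μ ν : P2 k) : ℝ := SW2 (μ.reg σ) (ν.reg σ)

/-- `ρ_σ((s, μ), (t, ν)) = |t - s|² + SW₂^σ(μ, ν)²`. -/
noncomputable def rho {k : ℕ} (σ : ℝ) (p q : ℝ × P2 k) : ℝ :=
  |q.1 - p.1| ^ 2 + SW2reg σ p.2 q.2 ^ 2

/-- `φ_δ(p) = ∑_{n ≥ 0} 2⁻ⁿ ρ_{1/δ}(p, p_n)`. -/
noncomputable def phi {k : ℕ} (δ : ℝ) (p : ℕ → ℝ × P2 k) (q : ℝ × P2 k) : ℝ :=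
  ∑' n, 1 / 2 ^ n * rho (1 / δ) q (p n)

/-- The set `[0, T] × 𝒫₂(ℝᵏ)`. -/
def strip (k : ℕ) (T : ℝ) : Set (ℝ × P2 k) := Icc 0 T ×ˢ univ

/-- Upper semicontinuity of `G : [0, T] × 𝒫₂(ℝᵏ) → ℝ`, where `𝒫₂(ℝᵏ)` carries the metric `W₂`
(the values of `G` outside `[0, T] × 𝒫₂(ℝᵏ)` play no role). -/
def UpperSemicontinuousOnStrip {k : ℕ} (T : ℝ) (G : ℝ × P2 k → ℝ) : Prop :=
  ∀ q ∈ strip k T, ∀ y, G q < y → ∀ᶠ q' in 𝓝[Icc 0 T] q.1 ×ˢ q.2.nhdsW2, G q' < y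

/-- An atomless measure: every measurable set of positive measure has a measurable subset of
strictly smaller positive measure. -/
def IsAtomless {Ω : Type*} [MeasurableSpace Ω] (ℙ : Measure Ω) : Prop :=
  ∀ A, MeasurableSet A → 0 < ℙ A → ∃ B ⊆ A, MeasurableSet B ∧ 0 < ℙ B ∧ ℙ B < ℙ A

/-- The law `ℙ_X ∈ 𝒫₂(ℝᵏ)` of `X ∈ L²(Ω, ℙ; ℝᵏ)`. -/
noncomputable def law {k : ℕ} {Ω : Type*} [MeasurableSpace Ω] (ℙ : Measure Ω)
    [IsProbabilityMeasure ℙ] (X : Lp (RSpace k) 2 ℙ) : P2 k :=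
  ⟨ℙ.map X, Measure.isProbabilityMeasure_map (Lp.aestronglyMeasurable X).aemeasurable, by
    rw [integrable_map_measure (by fun_prop) (Lp.aestronglyMeasurable X).aemeasurable]
    exact (Lp.memLp X).integrable_norm_pow (by norm_num)⟩

/-- `D = D_μ f` is the `L`-derivative of `f : 𝒫₂(ℝᵏ) → ℝ`: it is jointly continuous on
`(𝒫₂(ℝᵏ), W₂) × ℝᵏ`, and for each atomless probability space `(Ω, ℙ)` the lifting
`U(X) = f(ℙ_X)` is Fréchet differentiable at every `X ∈ L²(Ω, ℙ; ℝᵏ)`, with gradient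
`DU(X) = D_μ f(ℙ_X, X)`. -/
def IsLDerivative {k : ℕ} (f : P2 k → ℝ) (D : P2 k → RSpace k → RSpace k) : Prop :=
  (∀ μ x, Tendsto (fun p : P2 k × RSpace k => D p.1 p.2) (μ.nhdsW2 ×ˢ 𝓝 x) (𝓝 (D μ x))) ∧
  ∀ (Ω : Type u) [MeasurableSpace Ω] (ℙ : Measure Ω) [IsProbabilityMeasure ℙ], IsAtomless ℙ →
    ∀ X : Lp (RSpace k) 2 ℙ, ∃ Z : Lp (RSpace k) 2 ℙ,
      (∀ᵐ ω ∂ℙ, Z ω = D (law ℙ X) (X ω)) ∧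
      HasGradientAt (fun Y : Lp (RSpace k) 2 ℙ => f (law ℙ Y)) Z X

/-! The proof combines a smooth variational principle for the gauge `rho` with a study of how the
squared regularized sliced distance depends on the measure.

Geometry. A slice of μ^σ is the law of x·θ + z with z an independent centered normal variable of
variance σ², so its distribution function is continuous and strictly increasing. Between two such
laws the monotone rearrangement is an optimal map (`wassersteinSq_eq_lintegral_transport`), and
rearrangements compose. Rearranging one fixed normal law into every slice therefore embeds 𝒫₂ into
an L² space with 2 SW² equal to the squared norm of the difference (`SW2reg_sq_eq_norm`). The
squared norm of the image of μ is ∫ `meanSq` dμ + σ², which controls the second moment.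

Variational principle. The Borwein–Preiss construction (`exists_perturbed_maximizer`) needs cluster
points for gauge-Cauchy sequences. Such sequences have bounded second moments, hence a weakly
convergent subsequence; its images converge pointwise, and Fatou's lemma identifies the L² limit.
Convergence of the norms is convergence of a quadratic moment, which upgrades weak convergence to W₂
convergence (`exists_tendsto_of_cauchy`). This matters because `G` is only upper semicontinuous for
W₂.

Differentiability in the measure. On L²(Ω) the spatial part of the perturbation is U(X) = ½‖A(X) −
R(X)‖², where A(X) is the projected variable plus noise and R(X) its image under the optimal maps.
Since R(X) remains an admissible target for any other Y, U(Y) ≤ ½‖A(Y) − R(X)‖². Using this in both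
directions, the motion of R contributes only ‖A(Y) − A(X)‖‖R(Y) − R(X)‖ to the expansion
(`abs_sub_sub_inner_le`). The map R is continuous in L², because the optimal maps converge almost
everywhere while their energy stays constant. The gradient is thus A(X) − R(X) times θ, integrated
over index, direction and noise: `gradField`.

Differentiability in space. No derivative of the optimal map is needed. A change of Gaussian density
(`integral_gauss_add`) moves x out of the map into a smooth weight. Differentiation under the
integral is justified by the growth bound exp((|y| + c)²/(4σ²)) for the maps
(`exists_abs_rearr_le`): Markov's inequality bounds the square of the map by an inverse Gaussian
tail. Undoing the change of density leaves the mean of |z| times the size of the map, which is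
controlled by the L² norms of both factors; with σ = 1/δ this gives the last estimate. -/

open ProbabilityTheory
open scoped NNReal

/-! ### Monotone rearrangement on the line -/

/-- Probability measures on the line with a continuous, strictly increasing distribution
function. -/
structure HasRegularCdf (α : Measure ℝ) : Prop where
  prob : IsProbabilityMeasure α
  cont : Continuous (cdf α)
  mono : StrictMono (cdf α)

namespace HasRegularCdf

variable {α β γ : Measure ℝ}

lemma cdf_pos (hα : HasRegularCdf α) (y : ℝ) : 0 < cdf α y :=
  (cdf_nonneg α (y - 1)).trans_lt (hα.mono (by linarith))

lemma cdf_lt_one (hα : HasRegularCdf α) (y : ℝ) : cdf α y < 1 :=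
  (hα.mono (by linarith : y < y + 1)).trans_le (cdf_le_one α (y + 1))

lemma exists_cdf_eq (hα : HasRegularCdf α) {u : ℝ} (h0 : 0 < u) (h1 : u < 1) :
    ∃ y, cdf α y = u := by
  have hb := ((tendsto_cdf_atBot α).eventually (eventually_le_nhds h0)).exists
  have ht := ((tendsto_cdf_atTop α).eventually (eventually_ge_nhds h1)).exists
  exact mem_range_of_exists_le_of_exists_ge hα.cont hb ht

end HasRegularCdf

/-- The monotone rearrangement between two measures on the line. -/
noncomputable def transport (α β : Measure ℝ) (y : ℝ) : ℝ :=
  Function.invFun (cdf β) (cdf α y)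

section Transport

variable {α β γ : Measure ℝ}

/-- The chosen inverse is a true right inverse at `cdf α y`: regular distribution functions take
values strictly between 0 and 1 and attain all of them. -/
lemma cdf_transport (hα : HasRegularCdf α) (hβ : HasRegularCdf β) (y : ℝ) :
    cdf β (transport α β y) = cdf α y :=
  Function.invFun_eq (hβ.exists_cdf_eq (hα.cdf_pos y) (hα.cdf_lt_one y))

lemma transport_lt_iff (hα : HasRegularCdf α) (hβ : HasRegularCdf β) {y c : ℝ} :
    transport α β y < c ↔ cdf α y < cdf β c := by
  rw [← cdf_transport hα hβ y, hβ.mono.lt_iff_lt]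

lemma lt_transport_iff (hα : HasRegularCdf α) (hβ : HasRegularCdf β) {y c : ℝ} :
    c < transport α β y ↔ cdf β c < cdf α y := by
  rw [← cdf_transport hα hβ y, hβ.mono.lt_iff_lt]

lemma transport_le_iff (hα : HasRegularCdf α) (hβ : HasRegularCdf β) {y c : ℝ} :
    transport α β y ≤ c ↔ cdf α y ≤ cdf β c := by
  rw [← cdf_transport hα hβ y, hβ.mono.le_iff_le]

lemma transport_strictMono (hα : HasRegularCdf α) (hβ : HasRegularCdf β) :
    StrictMono (transport α β) := fun x y h => by
  rw [transport_lt_iff hα hβ, cdf_transport hα hβ]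
  exact hα.mono h

/-- This one-dimensional functoriality lets optimal maps between arbitrary slices be compared
through a single reference law. -/
lemma transport_transport (hα : HasRegularCdf α) (hβ : HasRegularCdf β) (hγ : HasRegularCdf γ)
    (y : ℝ) : transport β γ (transport α β y) = transport α γ y := by
  apply hγ.mono.injective
  rw [cdf_transport hβ hγ, cdf_transport hα hβ, cdf_transport hα hγ]

lemma transport_self (hα : HasRegularCdf α) (y : ℝ) : transport α α y = y := by
  apply hα.mono.injective
  rw [cdf_transport hα hα]

/-- Pointwise convergence of distribution functions to a continuous one is locally uniform. -/
lemma tendsto_cdf_apply {ι : Type*} {l : Filter ι} {a : ι → Measure ℝ} {y : ι → ℝ} {y₀ : ℝ}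
    (hα : HasRegularCdf α) (h : ∀ c, Tendsto (fun i => cdf (a i) c) l (𝓝 (cdf α c)))
    (hy : Tendsto y l (𝓝 y₀)) : Tendsto (fun i => cdf (a i) (y i)) l (𝓝 (cdf α y₀)) := by
  rw [tendsto_order]
  constructor
  · intro c hc
    obtain ⟨d, hd, hd'⟩ : ∃ d < y₀, c < cdf α d :=
      ((eventually_mem_nhdsWithin (s := Iio y₀)).and
        ((hα.cont.tendsto y₀).mono_left nhdsWithin_le_nhds |>.eventually (lt_mem_nhds hc))).exists
    filter_upwards [(h d).eventually (lt_mem_nhds hd'), hy.eventually (lt_mem_nhds hd)] with i h1 h2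
    exact h1.trans_le ((monotone_cdf _) h2.le)
  · intro c hc
    obtain ⟨d, hd, hd'⟩ : ∃ d > y₀, cdf α d < c :=
      ((eventually_mem_nhdsWithin (s := Ioi y₀)).and
        ((hα.cont.tendsto y₀).mono_left nhdsWithin_le_nhds |>.eventually (gt_mem_nhds hc))).exists
    filter_upwards [(h d).eventually (gt_mem_nhds hd'), hy.eventually (gt_mem_nhds hd)] with i h1 h2
    exact ((monotone_cdf _) (le_of_lt h2)).trans_lt h1

/-- A strict inequality between the map and a level c is a strict inequality between two
distribution functions. It is stable when both converge, so source, target and point may all vary.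
All continuity of optimal maps below comes from here. -/
lemma tendsto_transport {ι : Type*} {l : Filter ι} {a b : ι → Measure ℝ} {y : ι → ℝ} {y₀ : ℝ}
    (hα : HasRegularCdf α) (hβ : HasRegularCdf β) (ha : ∀ i, HasRegularCdf (a i))
    (hb : ∀ i, HasRegularCdf (b i))
    (h : ∀ c, Tendsto (fun i => cdf (a i) c) l (𝓝 (cdf α c)))
    (h' : ∀ c, Tendsto (fun i => cdf (b i) c) l (𝓝 (cdf β c)))
    (hy : Tendsto y l (𝓝 y₀)) :
    Tendsto (fun i => transport (a i) (b i) (y i)) l (𝓝 (transport α β y₀)) := by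
  have key := tendsto_cdf_apply hα h hy
  rw [tendsto_order]
  constructor
  · intro c hc
    rw [lt_transport_iff hα hβ] at hc
    filter_upwards [(h' c).eventually_lt key hc] with i hi
    rwa [lt_transport_iff (ha i) (hb i)]
  · intro c hc
    rw [gt_iff_lt, transport_lt_iff hα hβ] at hc
    filter_upwards [key.eventually_lt (h' c) hc] with i hi
    rwa [transport_lt_iff (ha i) (hb i)]

lemma continuous_transport (hα : HasRegularCdf α) (hβ : HasRegularCdf β) :
    Continuous (transport α β) :=
  continuous_iff_continuousAt.2 fun _ =>
    tendsto_transport (a := fun _ => α) (b := fun _ => β) hα hβ (fun _ => hα) (fun _ => hβ)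
      (fun _ => tendsto_const_nhds) (fun _ => tendsto_const_nhds) tendsto_id

lemma map_transport (hα : HasRegularCdf α) (hβ : HasRegularCdf β) :
    α.map (transport α β) = β := by
  have := hα.prob
  have := hβ.prob
  have hm := (continuous_transport hα hβ).measurable
  have : IsProbabilityMeasure (α.map (transport α β)) :=
    Measure.isProbabilityMeasure_map hm.aemeasurable
  refine Measure.eq_of_cdf _ _ ?_
  ext c
  have hset : transport α β ⁻¹' Iic c = Iic (transport β α c) := by
    ext y
    simp only [mem_preimage, mem_Iic]
    rw [transport_le_iff hα hβ, ← cdf_transport hβ hα c, hα.mono.le_iff_le]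
  rw [cdf_eq_real, map_measureReal_apply hm measurableSet_Iic, hset, ← cdf_eq_real,
    cdf_transport hβ hα]

/-- Markov's inequality for the monotone rearrangement. -/
lemma sq_transport_mul_le (hα : HasRegularCdf α) (hβ : HasRegularCdf β)
    (h2 : Integrable (fun y => y ^ 2) β) {r : ℝ} (y : ℝ) (h0 : r ≤ cdf α y)
    (h1 : r ≤ 1 - cdf α y) : transport α β y ^ 2 * r ≤ ∫ s, s ^ 2 ∂β := by
  have := hβ.prob
  set t := transport α β y with ht
  have hcdf : cdf β t = cdf α y := cdf_transport hα hβ y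
  have key : ∀ S : Set ℝ, MeasurableSet S → (∀ s ∈ S, t ^ 2 ≤ s ^ 2) → r ≤ β.real S →
      t ^ 2 * r ≤ ∫ s, s ^ 2 ∂β := by
    intro S hS hst hr
    calc t ^ 2 * r ≤ t ^ 2 * β.real S := by gcongr
      _ ≤ ∫ s in S, s ^ 2 ∂β := by
        have := setIntegral_ge_of_const_le_real (μ := β) hS (by finiteness) hst h2.integrableOn
        linarith
      _ ≤ ∫ s, s ^ 2 ∂β := setIntegral_le_integral h2 (ae_of_all _ fun s => sq_nonneg s)
  -- The tail used is the one beyond `t` on the side away from the origin, where s² ≥ t².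
  rcases le_total 0 t with h | h
  · refine key (Ioi t) measurableSet_Ioi (fun s hs => ?_) ?_
    · have : t < s := hs
      gcongr
    · rw [← compl_Iic, probReal_compl_eq_one_sub measurableSet_Iic, ← cdf_eq_real, hcdf]
      exact h1
  · refine key (Iic t) measurableSet_Iic (fun s hs => ?_) ?_
    · have : s ≤ t := hs
      nlinarith
    · rw [← cdf_eq_real, hcdf]
      exact h0

end Transport

/-! ### Optimality of the rearrangement by Kantorovich duality -/

section Optimality

variable {α β : Measure ℝ}

/-- The first marginal and the second marginal of a coupling are integrated as expected. -/
lemma integrable_fst_of_mem_couplings {F : Type*} [MeasurableSpace F] {μ ν : Measure F}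
    {π : Measure (F × F)} (hπ : π ∈ couplings μ ν) {f : F → ℝ} (hf : Integrable f μ) :
    Integrable (fun z => f z.1) π := by
  rw [← hπ.1] at hf
  exact hf.comp_measurable measurable_fst

lemma integrable_snd_of_mem_couplings {F : Type*} [MeasurableSpace F] {μ ν : Measure F}
    {π : Measure (F × F)} (hπ : π ∈ couplings μ ν) {f : F → ℝ} (hf : Integrable f ν) :
    Integrable (fun z => f z.2) π := by
  rw [← hπ.2] at hf
  exact hf.comp_measurable measurable_snd

lemma integral_fst_of_mem_couplings {F : Type*} [MeasurableSpace F] {μ ν : Measure F}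
    {π : Measure (F × F)} (hπ : π ∈ couplings μ ν) {f : F → ℝ} (hf : Integrable f μ) :
    ∫ z, f z.1 ∂π = ∫ x, f x ∂μ := by
  have hf' := hf
  rw [← hπ.1] at hf' ⊢
  rw [integral_map measurable_fst.aemeasurable hf'.aestronglyMeasurable]

lemma integral_snd_of_mem_couplings {F : Type*} [MeasurableSpace F] {μ ν : Measure F}
    {π : Measure (F × F)} (hπ : π ∈ couplings μ ν) {f : F → ℝ} (hf : Integrable f ν) :
    ∫ z, f z.2 ∂π = ∫ x, f x ∂ν := by
  have hf' := hf
  rw [← hπ.2] at hf' ⊢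
  rw [integral_map measurable_snd.aemeasurable hf'.aestronglyMeasurable]

/-- A primitive of an increasing function lies above its tangents. -/
lemma integral_le_mul_sub_of_monotone {T : ℝ → ℝ} (hT : Monotone T) (x s : ℝ) :
    ∫ t in x..s, T t ≤ T s * (s - x) := by
  have hi : ∀ a b, IntervalIntegrable T volume a b := fun a b => hT.intervalIntegrable
  rcases le_total x s with h | h
  · calc ∫ t in x..s, T t ≤ ∫ _ in x..s, T s :=
          intervalIntegral.integral_mono_on h (hi _ _) (by simp) fun t ht => hT ht.2
      _ = T s * (s - x) := by simp [mul_comm]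
  · have : ∫ _ in s..x, T s ≤ ∫ t in s..x, T t :=
      intervalIntegral.integral_mono_on h (by simp) (hi _ _) fun t ht => hT ht.1
    rw [intervalIntegral.integral_symm]
    simp only [intervalIntegral.integral_const, smul_eq_mul] at this
    linarith

lemma integrable_comp_transport (hα : HasRegularCdf α) (hβ : HasRegularCdf β) {f : ℝ → ℝ}
    (hf : Integrable f β) : Integrable (fun y => f (transport α β y)) α := by
  rw [← map_transport hα hβ] at hf
  exact hf.comp_measurable (continuous_transport hα hβ).measurable

lemma integral_comp_transport (hα : HasRegularCdf α) (hβ : HasRegularCdf β) {f : ℝ → ℝ}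
    (hf : AEStronglyMeasurable f β) : ∫ y, f (transport α β y) ∂α = ∫ s, f s ∂β := by
  rw [← map_transport hα hβ] at hf
  conv_rhs => rw [← map_transport hα hβ]
  rw [integral_map (continuous_transport hα hβ).measurable.aemeasurable hf]

lemma lintegral_comp_transport (hα : HasRegularCdf α) (hβ : HasRegularCdf β) {f : ℝ → ℝ≥0∞}
    (hf : Measurable f) : ∫⁻ y, f (transport α β y) ∂α = ∫⁻ s, f s ∂β := by
  conv_rhs => rw [← map_transport hα hβ]
  rw [lintegral_map hf (continuous_transport hα hβ).measurable]

lemma wassersteinSq_map_le {F : Type*} [NormedAddCommGroup F] [MeasurableSpace F] [BorelSpace F]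
    [SecondCountableTopology F] {Ω : Type*} [MeasurableSpace Ω] {P : Measure Ω} {f g : Ω → F}
    (hf : Measurable f) (hg : Measurable g) :
    wassersteinSq (P.map f) (P.map g) ≤ ∫⁻ ω, ENNReal.ofReal (‖f ω - g ω‖ ^ 2 / 2) ∂P := by
  have hmem : P.map (fun ω => (f ω, g ω)) ∈ couplings (P.map f) (P.map g) := by
    constructor
    · rw [Measure.map_map measurable_fst (hf.prodMk hg)]; rfl
    · rw [Measure.map_map measurable_snd (hf.prodMk hg)]; rfl
  refine (iInf₂_le _ hmem).trans_eq ?_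
  rw [lintegral_map (by fun_prop) (hf.prodMk hg)]

/-- The monotone rearrangement is optimal for the quadratic cost. -/
theorem wassersteinSq_eq_lintegral_transport (hα : HasRegularCdf α) (hβ : HasRegularCdf β)
    (hα2 : Integrable (fun y => y ^ 2) α) (hβ2 : Integrable (fun y => y ^ 2) β) :
    wassersteinSq α β = ∫⁻ y, ENNReal.ofReal ((y - transport α β y) ^ 2 / 2) ∂α := by
  have := hα.prob
  have := hβ.prob
  set T := transport α β with hTdef
  have hTc : Continuous T := continuous_transport hα hβ
  have hTm : Monotone T := (transport_strictMono hα hβ).monotone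
  have hTS : ∀ y, T (transport β α y) = y := fun y => by
    rw [hTdef, transport_transport hβ hα hβ, transport_self hβ]
  have hST : ∀ y, transport β α (T y) = y := fun y => by
    rw [hTdef, transport_transport hα hβ hα, transport_self hα]
  have hT2 : Integrable (fun y => T y ^ 2) α := integrable_comp_transport hα hβ hβ2
  have hidL : MemLp (fun y : ℝ => y) 2 α := (memLp_two_iff_integrable_sq (by fun_prop)).2 hα2
  have hTL : MemLp T 2 α :=
    (memLp_two_iff_integrable_sq hTc.aestronglyMeasurable).2 hT2
  have hxT : Integrable (fun y => y * T y) α := hidL.integrable_mul hTL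
  apply le_antisymm
  · have := wassersteinSq_map_le (P := α) measurable_id hTc.measurable
    rw [Measure.map_id, map_transport hα hβ] at this
    simpa [Real.norm_eq_abs, sq_abs] using this
  · refine le_iInf₂ fun π hπ => ?_
    -- The primitive ψ of the increasing map is convex. The dual potentials `a` and `b` are x²/2 −
    -- ψ(x) and y²/2 − ψ*(y), the conjugate ψ*(y) being attained at x = T⁻¹(y). Between 0 and x the
    -- map lies between T 0 and T x, so integrability of x·T(x) yields that of ψ.
    set ψ : ℝ → ℝ := fun x => ∫ t in (0 : ℝ)..x, T t with hψ
    have hψc : Continuous ψ :=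
      intervalIntegral.continuous_primitive (fun a b => hTm.intervalIntegrable) 0
    have hψi : Integrable ψ α := by
      have hdom : Integrable (fun y => |y * T y| + |T 0| * |y|) α :=
        hxT.abs.add ((hidL.integrable (by norm_num)).abs.const_mul _)
      refine hdom.mono' hψc.aestronglyMeasurable (ae_of_all _ fun x => ?_)
      have : ‖∫ t in (0 : ℝ)..x, T t‖ ≤ (|T x| + |T 0|) * |x - 0| := by
        refine intervalIntegral.norm_integral_le_of_norm_le_const fun t ht => ?_
        rw [Real.norm_eq_abs, abs_le]
        rcases le_total 0 x with h | h
        · rw [uIoc_of_le h] at ht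
          have h1 := hTm ht.1.le
          have h2 := hTm ht.2
          constructor
          · linarith [neg_abs_le (T 0), abs_nonneg (T x)]
          · linarith [le_abs_self (T x), abs_nonneg (T 0)]
        · rw [uIoc_of_ge h] at ht
          have h1 := hTm ht.1.le
          have h2 := hTm ht.2
          constructor
          · linarith [neg_abs_le (T x), abs_nonneg (T 0)]
          · linarith [le_abs_self (T 0), abs_nonneg (T x)]
      rw [sub_zero] at this
      refine this.trans_eq ?_
      rw [abs_mul]; ring
    set a : ℝ → ℝ := fun x => x ^ 2 / 2 - ψ x with ha
    set b : ℝ → ℝ := fun y => y ^ 2 / 2 - (y * transport β α y - ψ (transport β α y)) with hb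
    have hSc := continuous_transport hβ hα
    have hai : Integrable a α := (hα2.div_const 2).sub hψi
    have hbT : ∀ y, b (T y) = T y ^ 2 / 2 - (T y * y - ψ y) := fun y => by
      simp only [hb, hST]
    have hbi : Integrable b β := by
      rw [← map_transport hα hβ, integrable_map_measure
        (Continuous.aestronglyMeasurable (by fun_prop)) hTc.measurable.aemeasurable]
      have : b ∘ transport α β = fun y => T y ^ 2 / 2 - (y * T y - ψ y) := by
        funext y
        rw [Function.comp_apply, ← hTdef, hbT, mul_comm y]
      rw [this]
      exact (hT2.div_const 2).sub (hxT.sub hψi)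
    -- Young's inequality xy ≤ ψ(x) + ψ*(y): the tangent of ψ at T⁻¹(y) has slope y.
    have hpt : ∀ x y, a x + b y ≤ (x - y) ^ 2 / 2 := fun x y => by
      have h1 := integral_le_mul_sub_of_monotone hTm x (transport β α y)
      rw [hTS, ← intervalIntegral.integral_interval_sub_left (a := 0)
        hTm.intervalIntegrable hTm.intervalIntegrable] at h1
      change ψ _ - ψ _ ≤ _ at h1
      simp only [ha, hb]
      nlinarith
    have hci : Integrable (fun z : ℝ × ℝ => (z.1 - z.2) ^ 2 / 2) π := by
      have h1 : Integrable (fun z : ℝ × ℝ => z.1 ^ 2) π := integrable_fst_of_mem_couplings hπ hα2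
      have h2 : Integrable (fun z : ℝ × ℝ => z.2 ^ 2) π := integrable_snd_of_mem_couplings hπ hβ2
      refine (h1.add h2).mono' (Continuous.aestronglyMeasurable (by fun_prop))
        (ae_of_all _ fun z => ?_)
      rw [Real.norm_eq_abs, abs_of_nonneg (by positivity), Pi.add_apply]
      nlinarith [sq_nonneg (z.1 + z.2)]
    have hdi : Integrable (fun y => (y - T y) ^ 2 / 2) α :=
      ((hidL.sub hTL).integrable_sq).div_const 2
    simp only [Real.norm_eq_abs, sq_abs]
    rw [← ofReal_integral_eq_lintegral_ofReal hdi (ae_of_all _ fun _ => by positivity),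
      ← ofReal_integral_eq_lintegral_ofReal hci (ae_of_all _ fun _ => by positivity)]
    refine ENNReal.ofReal_le_ofReal ?_
    -- On the graph of T the dual inequality is an equality, and integrals of the potentials depend
    -- only on the marginals.
    calc ∫ y, (y - T y) ^ 2 / 2 ∂α = ∫ y, (a y + b (T y)) ∂α := by
          congr 1; funext y; rw [hbT]; simp only [ha]; ring
      _ = ∫ y, a y ∂α + ∫ y, b y ∂β := by
          rw [integral_add hai (integrable_comp_transport hα hβ hbi),
            integral_comp_transport hα hβ hbi.aestronglyMeasurable]
      _ = ∫ z, (a z.1 + b z.2) ∂π := by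
          rw [integral_add (integrable_fst_of_mem_couplings hπ hai)
            (integrable_snd_of_mem_couplings hπ hbi), integral_fst_of_mem_couplings hπ hai,
            integral_snd_of_mem_couplings hπ hbi]
      _ ≤ ∫ z, (z.1 - z.2) ^ 2 / 2 ∂π :=
          integral_mono ((integrable_fst_of_mem_couplings hπ hai).add
            (integrable_snd_of_mem_couplings hπ hbi)) hci fun z => hpt _ _

end Optimality

/-! ### Dominated convergence with varying dominating functions -/

/-- A generalized dominated convergence theorem: the dominating functions may vary as long as their
integrals converge. -/
theorem tendsto_lintegral_zero_of_le_of_tendsto {Ω : Type*} [MeasurableSpace Ω] {m : Measure Ω}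
    {a b : ℕ → Ω → ℝ≥0∞} {a₀ : Ω → ℝ≥0∞} (ha : ∀ n, AEMeasurable (a n) m)
    (hb : ∀ n, AEMeasurable (b n) m)
    (hba : ∀ n, ∀ᵐ x ∂m, b n x ≤ a n x) (hb0 : ∀ᵐ x ∂m, Tendsto (fun n => b n x) atTop (𝓝 0))
    (ha0 : ∀ᵐ x ∂m, Tendsto (fun n => a n x) atTop (𝓝 (a₀ x)))
    (hint : Tendsto (fun n => ∫⁻ x, a n x ∂m) atTop (𝓝 (∫⁻ x, a₀ x ∂m)))
    (hfin : ∫⁻ x, a₀ x ∂m ≠ ∞) :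
    Tendsto (fun n => ∫⁻ x, b n x ∂m) atTop (𝓝 0) := by
  have hev : ∀ᶠ n in atTop, ∫⁻ x, a n x ∂m ≠ ∞ :=
    (hint.eventually (gt_mem_nhds hfin.lt_top)).mono fun n hn => hn.ne
  have hbA : ∀ n, ∫⁻ x, b n x ∂m ≤ ∫⁻ x, a n x ∂m := fun n => lintegral_mono_ae (hba n)
  -- Fatou's lemma is applied to the nonnegative differences a n − b n. As the integrals of a n
  -- converge to that of a₀, those of b n are forced to 0.
  have h1 : ∫⁻ x, a₀ x ∂m ≤ liminf (fun n => ∫⁻ x, a n x ∂m - ∫⁻ x, b n x ∂m) atTop := by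
    calc ∫⁻ x, a₀ x ∂m = ∫⁻ x, liminf (fun n => a n x - b n x) atTop ∂m := by
          refine lintegral_congr_ae ?_
          filter_upwards [hb0, ha0] with x h1 h2
          have := ENNReal.Tendsto.sub h2 h1 (Or.inr ENNReal.zero_ne_top)
          rw [tsub_zero] at this
          exact this.liminf_eq.symm
      _ ≤ liminf (fun n => ∫⁻ x, (a n x - b n x) ∂m) atTop :=
          lintegral_liminf_le' fun n => (ha n).sub (hb n)
      _ = _ := by
          refine liminf_congr ?_
          filter_upwards [hev] with n hn
          exact lintegral_sub' (hb n) (ne_top_of_le_ne_top hn (hbA n)) (hba n)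
  rw [ENNReal.tendsto_nhds_zero]
  intro ε hε
  rcases eq_or_ne (∫⁻ x, a₀ x ∂m) 0 with h0 | h0
  · rw [h0] at hint
    filter_upwards [ENNReal.tendsto_nhds_zero.1 hint ε hε] with n hn
    exact (hbA n).trans hn
  rcases eq_or_ne ε ∞ with rfl | hε'
  · exact Eventually.of_forall fun n => le_top
  have hhalf : ε / 2 ≠ 0 := (ENNReal.half_pos hε.ne').ne'
  have hlt : ∫⁻ x, a₀ x ∂m - ε / 2 < ∫⁻ x, a₀ x ∂m := ENNReal.sub_lt_self hfin h0 hhalf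
  have h2 := eventually_lt_of_lt_liminf (hlt.trans_le h1)
  have h3 := hint.eventually (gt_mem_nhds (ENNReal.lt_add_right hfin hhalf))
  filter_upwards [h2, h3, hev] with n h2 h3 h4
  have hbfin := ne_top_of_le_ne_top h4 (hbA n)
  have h5 : ∫⁻ x, a₀ x ∂m ≤ (∫⁻ x, a n x ∂m - ∫⁻ x, b n x ∂m) + ε / 2 :=
    tsub_le_iff_right.1 h2.le
  have h6 : ∫⁻ x, a₀ x ∂m + ∫⁻ x, b n x ∂m ≤ ∫⁻ x, a n x ∂m + ε / 2 := by
    calc _ ≤ (∫⁻ x, a n x ∂m - ∫⁻ x, b n x ∂m) + ε / 2 + ∫⁻ x, b n x ∂m := by gcongr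
      _ = (∫⁻ x, a n x ∂m - ∫⁻ x, b n x ∂m) + ∫⁻ x, b n x ∂m + ε / 2 := by ring
      _ = _ := by rw [tsub_add_cancel_of_le (hbA n)]
  have h7 : ∫⁻ x, a₀ x ∂m + ∫⁻ x, b n x ∂m ≤ ∫⁻ x, a₀ x ∂m + ε := by
    calc _ ≤ _ := h6
      _ ≤ ∫⁻ x, a₀ x ∂m + ε / 2 + ε / 2 := by gcongr
      _ = _ := by rw [add_assoc, ENNReal.add_halves]
  exact (ENNReal.add_le_add_iff_left hfin).1 h7

/-! ### Variational principle -/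

/-- The variational principle of Borwein and Preiss, for a gauge `ρ` for which almost-maximizing
sequences have cluster points. -/
theorem exists_perturbed_maximizer {X : Type*} (G : X → ℝ) (ρ : X → X → ℝ) {δ lam : ℝ} (hδ : 0 < δ)
    (hlam : 0 < lam) (hρ0 : ∀ x, ρ x x = 0) (hρ : ∀ x y, 0 ≤ ρ x y) (hG : BddAbove (range G))
    (hcluster : ∀ x : ℕ → X, (∀ n m, n ≤ m → ρ (x m) (x n) ≤ lam / (2 ^ n * δ ^ 2)) →
      ∃ x₀, ∃ ψ : ℕ → ℕ, StrictMono ψ ∧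
        (∀ y, Tendsto (fun j => ρ (x (ψ j)) y) atTop (𝓝 (ρ x₀ y))) ∧
        ∀ c, G x₀ < c → ∀ᶠ j in atTop, G (x (ψ j)) < c)
    (hsep : ∀ (x : ℕ → X) (y z : X), Tendsto (fun n => ρ y (x n)) atTop (𝓝 0) →
      Tendsto (fun n => ρ z (x n)) atTop (𝓝 0) → y = z)
    (hbdd : ∀ (x : ℕ → X) (y z : X), (∀ n, ρ y (x n) ≤ lam / (2 ^ n * δ ^ 2)) →
      Summable fun n => 1 / 2 ^ n * ρ z (x n))
    (x₀ : X) (hx₀ : ∀ x, G x - lam ≤ G x₀) :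
    ∃ q, ∃ x : ℕ → X, x 0 = x₀ ∧ (∀ n, ρ q (x n) ≤ lam / (2 ^ n * δ ^ 2)) ∧
      G x₀ ≤ G q - δ ^ 2 * ∑' n, 1 / 2 ^ n * ρ q (x n) ∧
      ∀ y, y ≠ q → G y - δ ^ 2 * ∑' n, 1 / 2 ^ n * ρ y (x n)
        < G q - δ ^ 2 * ∑' n, 1 / 2 ^ n * ρ q (x n) := by
  obtain ⟨M, hM⟩ := hG
  have hM' : ∀ x, G x ≤ M := fun x => hM ⟨x, rfl⟩
  -- one step of the construction
  have hstep : ∀ (H : X → ℝ) (p : X) (ε : ℝ), 0 < ε → ∃ p', (∀ x, H x ≤ M) →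
      H p ≤ H p' ∧ ∀ x, H x - ε ≤ H p' := by
    intro H p ε hε
    by_cases hH : ∀ x, H x ≤ M
    · have hne : (range H).Nonempty := ⟨_, p, rfl⟩
      have hb : BddAbove (range H) := ⟨M, by rintro _ ⟨x, rfl⟩; exact hH x⟩
      obtain ⟨_, ⟨p', rfl⟩, hp'⟩ := exists_lt_of_lt_csSup hne (sub_lt_self (sSup (range H)) hε)
      by_cases hpp : H p ≤ H p'
      · refine ⟨p', fun _ => ⟨hpp, fun x => ?_⟩⟩
        have := le_csSup hb ⟨x, rfl⟩
        linarith
      · refine ⟨p, fun _ => ⟨le_rfl, fun x => ?_⟩⟩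
        have := le_csSup hb ⟨x, rfl⟩
        linarith
    · exact ⟨p, fun h => absurd h hH⟩
  choose! next hnext using hstep
  -- Stage n + 1 subtracts the n-th penalty and moves to a point that is no worse and maximal up to
  -- λ/4ⁿ⁺¹. The tolerance λ/4ⁿ against the penalty weight δ²/2ⁿ produces the radius λ/(2ⁿδ²).
  let S : ℕ → (X → ℝ) × X := fun n => Nat.rec (G, x₀) (fun n s =>
    (fun x => s.1 x - δ ^ 2 * (1 / 2 ^ n * ρ x s.2),
      next (fun x => s.1 x - δ ^ 2 * (1 / 2 ^ n * ρ x s.2)) s.2 (lam / 4 ^ (n + 1)))) n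
  let H : ℕ → X → ℝ := fun n => (S n).1
  let x : ℕ → X := fun n => (S n).2
  have hH0 : H 0 = G := rfl
  have hx0 : x 0 = x₀ := rfl
  have hHs : ∀ n y, H (n + 1) y = H n y - δ ^ 2 * (1 / 2 ^ n * ρ y (x n)) := fun n y => rfl
  have hxs : ∀ n, x (n + 1) = next (H (n + 1)) (x n) (lam / 4 ^ (n + 1)) := fun n => rfl
  have hterm : ∀ n y z, 0 ≤ δ ^ 2 * (1 / 2 ^ n * ρ y z) := fun n y z =>
    mul_nonneg (by positivity) (mul_nonneg (by positivity) (hρ y z))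
  have hHanti : ∀ y, Antitone fun n => H n y := fun y =>
    antitone_nat_of_succ_le fun n => by rw [hHs]; linarith [hterm n y (x n)]
  have hHM : ∀ n y, H n y ≤ M := fun n y => (hHanti y (Nat.zero_le n)).trans (hM' y)
  have hself : ∀ n, H (n + 1) (x n) = H n (x n) := fun n => by rw [hHs, hρ0]; ring
  have hincr : ∀ n, H n (x n) ≤ H (n + 1) (x (n + 1)) := fun n => by
    rw [← hself n, hxs]
    exact (hnext (H (n + 1)) (x n) (lam / 4 ^ (n + 1)) (by positivity) (hHM (n + 1))).1
  have hmono : Monotone fun n => H n (x n) := monotone_nat_of_le_succ hincr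
  have hsup : ∀ n y, H n y - lam / 4 ^ n ≤ H n (x n) := by
    intro n y
    cases n with
    | zero => simpa [hH0, hx0] using hx₀ y
    | succ n =>
      rw [hxs]
      exact (hnext (H (n + 1)) (x n) (lam / 4 ^ (n + 1)) (by positivity) (hHM (n + 1))).2 y
  have hdist : ∀ n y, H n (x n) ≤ H (n + 1) y → ρ y (x n) ≤ lam / (2 ^ n * δ ^ 2) := by
    intro n y hy
    have h1 := hsup n y
    rw [hHs] at hy
    have h2 : δ ^ 2 * (1 / 2 ^ n * ρ y (x n)) ≤ lam / 4 ^ n := by linarith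
    have h4 : (4 : ℝ) ^ n = 2 ^ n * 2 ^ n := by rw [← mul_pow]; norm_num
    rw [h4] at h2
    rw [le_div_iff₀ (by positivity)]
    have h3 : (2 : ℝ) ^ n * 2 ^ n * (δ ^ 2 * (1 / 2 ^ n * ρ y (x n))) ≤ lam := by
      calc _ ≤ (2 : ℝ) ^ n * 2 ^ n * (lam / (2 ^ n * 2 ^ n)) := by gcongr
        _ = lam := by field_simp
    calc ρ y (x n) * (2 ^ n * δ ^ 2) = (2 : ℝ) ^ n * 2 ^ n * (δ ^ 2 * (1 / 2 ^ n * ρ y (x n))) := by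
          field_simp
      _ ≤ lam := h3
  have hlater : ∀ n m, n ≤ m → H n (x n) ≤ H (n + 1) (x m) := by
    intro n m hnm
    rcases hnm.eq_or_lt with rfl | h
    · exact (hself n).ge
    · calc H n (x n) ≤ H m (x m) := hmono hnm
        _ ≤ H (n + 1) (x m) := hHanti (x m) (Nat.succ_le_of_lt h)
  obtain ⟨q, ψ, hψ, hψρ, hψG⟩ := hcluster x fun n m hnm => hdist n (x m) (hlater n m hnm)
  -- Each `H n` differs from `G` by finitely many penalties that converge along the subsequence, so
  -- it inherits the semicontinuity of `G` there.
  have hHq : ∀ n c, H n q < c → ∀ᶠ j in atTop, H n (x (ψ j)) < c := by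
    intro n
    induction n with
    | zero => exact hψG
    | succ n ih =>
      intro c hc
      rw [hHs] at hc
      set d := c - (H n q - δ ^ 2 * (1 / 2 ^ n * ρ q (x n))) with hd
      have hd0 : 0 < d := by rw [hd]; linarith
      have h1 := ih (H n q + d / 2) (by linarith)
      have h2 : Tendsto (fun j => δ ^ 2 * (1 / 2 ^ n * ρ (x (ψ j)) (x n))) atTop
          (𝓝 (δ ^ 2 * (1 / 2 ^ n * ρ q (x n)))) := ((hψρ (x n)).const_mul _).const_mul _
      filter_upwards [h1, h2.eventually (lt_mem_nhds
        (by linarith : δ ^ 2 * (1 / 2 ^ n * ρ q (x n)) - d / 2 < _))] with j h1 h2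
      rw [hHs]
      linarith
  -- The superlevel set where `H (n + 1)` is at least `H n (x n)` contains every later iterate,
  -- hence the cluster point.
  have hqmem : ∀ n, H n (x n) ≤ H (n + 1) q := by
    intro n
    by_contra! hlt
    obtain ⟨j, hj, hj'⟩ := ((hHq (n + 1) _ hlt).and (eventually_ge_atTop n)).exists
    exact absurd (hlater n (ψ j) (hj'.trans (hψ.id_le j))) (not_le.2 hj)
  have hqρ : ∀ n, ρ q (x n) ≤ lam / (2 ^ n * δ ^ 2) := fun n => hdist n q (hqmem n)
  have hsum : ∀ y, Summable fun n => 1 / 2 ^ n * ρ y (x n) := fun y => hbdd x q y hqρ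
  have hHlim : ∀ y, Tendsto (fun n => H n y) atTop
      (𝓝 (G y - δ ^ 2 * ∑' n, 1 / 2 ^ n * ρ y (x n))) := by
    intro y
    have hform : ∀ n, H n y = G y - δ ^ 2 * ∑ i ∈ Finset.range n, 1 / 2 ^ i * ρ y (x i) := by
      intro n
      induction n with
      | zero => simp [hH0]
      | succ n ih => rw [hHs, ih, Finset.sum_range_succ]; ring
    simp_rw [hform]
    exact tendsto_const_nhds.sub (((hsum y).hasSum.tendsto_sum_nat).const_mul _)
  have hHle : ∀ n y, G y - δ ^ 2 * ∑' n, 1 / 2 ^ n * ρ y (x n) ≤ H n y := fun n y =>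
    (hHanti y).le_of_tendsto (hHlim y) n
  have hqge : ∀ n, H n (x n) ≤ G q - δ ^ 2 * ∑' n, 1 / 2 ^ n * ρ q (x n) := by
    intro n
    refine ge_of_tendsto (hHlim q) ?_
    filter_upwards [eventually_ge_atTop (n + 1)] with m hm
    obtain ⟨m, rfl⟩ : ∃ m', m = m' + 1 := ⟨m - 1, by omega⟩
    exact (hmono (by omega : n ≤ m)).trans (hqmem m)
  refine ⟨q, x, hx0, hqρ, by simpa [hH0, hx0] using hqge 0, fun y hy => ?_⟩
  -- A point in all the superlevel sets has vanishing gauge to `x n`, as `q` has, and so equals `q`.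
  -- Any other point leaves some set, and the strict loss at that stage persists because `H n y`
  -- decreases in n.
  by_cases hall : ∀ n, H n (x n) ≤ H (n + 1) y
  · refine absurd (hsep x y q ?_ ?_) hy
    all_goals
      refine squeeze_zero (fun n => hρ _ _)
        (fun n => hdist n _ (by first | exact hall n | exact hqmem n)) ?_
      have : Tendsto (fun n : ℕ => lam / δ ^ 2 * (1 / 2) ^ n) atTop (𝓝 (lam / δ ^ 2 * 0)) :=
        (tendsto_pow_atTop_nhds_zero_of_lt_one (by norm_num) (by norm_num)).const_mul _
      rw [mul_zero] at this
      refine this.congr fun n => ?_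
      rw [one_div, inv_pow]
      field_simp
  · push Not at hall
    obtain ⟨n, hn⟩ := hall
    exact ((hHle (n + 1) y).trans_lt hn).trans_le (hqge n)

/-! ### Elements of 𝒫₂ and centered normal laws on the line -/

namespace P2

variable {k : ℕ}

instance (μ : P2 k) : IsProbabilityMeasure μ.toMeasure := μ.2.1

lemma integrable_sq (μ : P2 k) : Integrable (fun x => ‖x‖ ^ 2) μ.toMeasure := μ.2.2

lemma secondMoment_nonneg (μ : P2 k) : 0 ≤ μ.secondMoment := integral_nonneg fun _ => by positivity

end P2

/-- The centered normal distribution with variance `σ²` on the line. -/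
noncomputable def gauss (σ : ℝ) : Measure ℝ := gaussianReal 0 (σ ^ 2).toNNReal

section Gauss

instance (σ : ℝ) : IsProbabilityMeasure (gauss σ) := by unfold gauss; infer_instance

lemma gauss_var_ne_zero {σ : ℝ} (hσ : 0 < σ) : (σ ^ 2).toNNReal ≠ 0 := by
  have : 0 < σ ^ 2 := by positivity
  exact (Real.toNNReal_pos.2 this).ne'

/-- The density of `gauss σ`. -/
noncomputable def gaussDensity (σ y : ℝ) : ℝ := gaussianPDFReal 0 (σ ^ 2).toNNReal y

lemma gaussDensity_eq (σ y : ℝ) :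
    gaussDensity σ y = (√(2 * Real.pi * σ ^ 2))⁻¹ * Real.exp (-y ^ 2 / (2 * σ ^ 2)) := by
  simp [gaussDensity, gaussianPDFReal, Real.coe_toNNReal _ (sq_nonneg σ)]

lemma gaussDensity_le (σ y : ℝ) : gaussDensity σ y ≤ (√(2 * Real.pi * σ ^ 2))⁻¹ := by
  rw [gaussDensity_eq]
  refine mul_le_of_le_one_right (by positivity) (Real.exp_le_one_iff.2 ?_)
  rw [neg_div]
  exact neg_nonpos.2 (by positivity)

lemma gauss_real_eq_integral {σ : ℝ} (hσ : 0 < σ) (S : Set ℝ) :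
    (gauss σ).real S = ∫ y in S, gaussDensity σ y := by
  rw [measureReal_def, gauss, gaussianReal_apply_eq_integral _ (gauss_var_ne_zero hσ),
    ENNReal.toReal_ofReal (integral_nonneg fun _ => gaussianPDFReal_nonneg _ _ _)]
  rfl

lemma integrable_gaussDensity (σ : ℝ) : Integrable (gaussDensity σ) :=
  integrable_gaussianPDFReal _ _

lemma cdf_sub_cdf_eq {α : Measure ℝ} [IsProbabilityMeasure α] {x y : ℝ} (h : x ≤ y) :
    cdf α y - cdf α x = α.real (Ioc x y) := by
  have : Ioc x y = Iic y \ Iic x := by ext; simp [and_comm]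
  rw [cdf_eq_real, cdf_eq_real, this, measureReal_sdiff (Iic_subset_Iic.2 h) measurableSet_Iic]

lemma cdf_gauss_sub_le {σ : ℝ} (hσ : 0 < σ) {x y : ℝ} (h : x ≤ y) :
    cdf (gauss σ) y - cdf (gauss σ) x ≤ (√(2 * Real.pi * σ ^ 2))⁻¹ * (y - x) := by
  rw [cdf_sub_cdf_eq h, gauss_real_eq_integral hσ]
  calc ∫ t in Ioc x y, gaussDensity σ t ≤ ∫ _ in Ioc x y, (√(2 * Real.pi * σ ^ 2))⁻¹ :=
        setIntegral_mono (integrable_gaussDensity σ).integrableOn (by simp)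
          fun t => gaussDensity_le σ t
    _ = _ := by simp [h, mul_comm]

lemma abs_cdf_gauss_sub_le {σ : ℝ} (hσ : 0 < σ) (x y : ℝ) :
    |cdf (gauss σ) y - cdf (gauss σ) x| ≤ (√(2 * Real.pi * σ ^ 2))⁻¹ * |y - x| := by
  rcases le_total x y with h | h
  · rw [abs_of_nonneg (sub_nonneg.2 (monotone_cdf _ h)), abs_of_nonneg (sub_nonneg.2 h)]
    exact cdf_gauss_sub_le hσ h
  · rw [abs_of_nonpos (sub_nonpos.2 (monotone_cdf _ h)), abs_of_nonpos (sub_nonpos.2 h), neg_sub,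
      neg_sub]
    exact cdf_gauss_sub_le hσ h

lemma hasRegularCdf_gauss {σ : ℝ} (hσ : 0 < σ) : HasRegularCdf (gauss σ) where
  prob := inferInstance
  cont := by
    have : LipschitzWith (Real.toNNReal (√(2 * Real.pi * σ ^ 2))⁻¹) (cdf (gauss σ)) :=
      LipschitzWith.of_dist_le_mul fun x y => by
        rw [Real.dist_eq, Real.dist_eq, Real.coe_toNNReal _ (by positivity)]
        exact abs_cdf_gauss_sub_le hσ y x
    exact this.continuous
  mono := fun x y h => by
    have hpos : 0 < gauss σ (Ioc x y) := by
      have : gauss σ (Ioc x y) ≠ 0 := fun h0 => by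
        have := gaussianReal_absolutelyContinuous' 0 (gauss_var_ne_zero hσ) h0
        simp [Real.volume_Ioc] at this
        exact absurd h (not_lt.2 this)
      exact pos_iff_ne_zero.2 this
    have := cdf_sub_cdf_eq (α := gauss σ) h.le
    have h2 : 0 < (gauss σ).real (Ioc x y) := ENNReal.toReal_pos hpos.ne' (by finiteness)
    linarith

lemma memLp_gauss (σ : ℝ) : MemLp (fun z : ℝ => z) 2 (gauss σ) :=
  memLp_id_gaussianReal' 2 (by simp)

lemma integral_gauss (σ : ℝ) : ∫ z, z ∂(gauss σ) = 0 := integral_id_gaussianReal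

lemma integral_sq_gauss (σ : ℝ) : ∫ z, z ^ 2 ∂(gauss σ) = σ ^ 2 := by
  have h := variance_of_integral_eq_zero (X := fun z : ℝ => z) (μ := gauss σ) (by fun_prop)
    (integral_gauss σ)
  rw [← h, gauss, variance_fun_id_gaussianReal, Real.coe_toNNReal _ (sq_nonneg σ)]

lemma one_sub_cdf_gauss {σ : ℝ} (hσ : 0 < σ) (y : ℝ) :
    1 - cdf (gauss σ) y = cdf (gauss σ) (-y) := by
  have : NullSingletonClass (gauss σ) := nullSingletonClass_gaussianReal (gauss_var_ne_zero hσ)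
  have h1 : (gauss σ).map (fun x => -x) = gauss σ := by
    rw [gauss, gaussianReal_map_neg, neg_zero]
  rw [cdf_eq_real (gauss σ) (-y), ← h1, map_measureReal_apply (by fun_prop) measurableSet_Iic, h1]
  have : (fun x : ℝ => -x) ⁻¹' Iic (-y) = Ici y := by ext; simp
  rw [this, measureReal_congr Ioi_ae_eq_Ici.symm, ← compl_Iic,
    probReal_compl_eq_one_sub measurableSet_Iic, cdf_eq_real]

/-- A lower bound for the tail of the normal distribution. -/
lemma le_cdf_gauss {σ : ℝ} (hσ : 0 < σ) {a : ℝ} (ha : 0 ≤ a) :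
    gaussDensity σ (a + 1) ≤ cdf (gauss σ) (-a) := by
  have h1 : ∫ _ in Ioc (-a - 1) (-a), gaussDensity σ (a + 1)
      ≤ ∫ t in Ioc (-a - 1) (-a), gaussDensity σ t := by
    refine setIntegral_mono_on (by simp) (integrable_gaussDensity σ).integrableOn
      measurableSet_Ioc fun t ht => ?_
    rw [gaussDensity_eq, gaussDensity_eq]
    have : t ^ 2 ≤ (a + 1) ^ 2 := by nlinarith [ht.1, ht.2]
    gcongr
  have h2 : ∫ _ in Ioc (-a - 1) (-a), gaussDensity σ (a + 1) = gaussDensity σ (a + 1) := by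
    simp
  rw [← h2]
  refine h1.trans ?_
  rw [← gauss_real_eq_integral hσ, cdf_eq_real]
  exact measureReal_mono Ioc_subset_Iic_self

lemma integral_gauss_eq {E : Type*} [NormedAddCommGroup E] [NormedSpace ℝ E] {σ : ℝ} (hσ : 0 < σ)
    (f : ℝ → E) : ∫ z, f z ∂(gauss σ) = ∫ z, gaussDensity σ z • f z :=
  integral_gaussianReal_eq_integral_smul (gauss_var_ne_zero hσ)

end Gauss

/-! ### Slices of the Gaussian regularization -/

section Slice

variable {k : ℕ}

/-- The unit sphere. -/
abbrev USphere (k : ℕ) : Type := Metric.sphere (0 : RSpace k) 1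

/-- One-dimensional projections of the Gaussian regularization. -/
noncomputable def slice (σ : ℝ) (μ : P2 k) (θ : USphere k) : Measure ℝ := proj (μ.reg σ) θ

lemma norm_usphere (θ : USphere k) : ‖(θ : RSpace k)‖ = 1 := by simp

/-- The characteristic function of the standard normal law at tσθ depends only on the norm |tσ|, not
on the direction. -/
lemma proj_normalMeasure (σ : ℝ) (θ : USphere k) : proj (normalMeasure k σ) θ = gauss σ := by
  have h1 : proj (normalMeasure k σ) θ
      = (stdGaussian (RSpace k)).map (fun x => inner ℝ (σ • x) (θ : RSpace k)) := by
    rw [proj, normalMeasure, Measure.map_map (by fun_prop) (by fun_prop)]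
    rfl
  rw [h1]
  have : IsProbabilityMeasure
      ((stdGaussian (RSpace k)).map (fun x => inner ℝ (σ • x) (θ : RSpace k))) :=
    Measure.isProbabilityMeasure_map (by fun_prop)
  refine Measure.ext_of_charFun ?_
  ext t
  rw [charFun_apply, integral_map (by fun_prop) (by fun_prop), gauss, charFun_gaussianReal]
  have h2 := charFun_stdGaussian (E := RSpace k) ((t * σ) • (θ : RSpace k))
  rw [charFun_apply] at h2
  have h3 : ∀ x : RSpace k, inner ℝ x ((t * σ) • (θ : RSpace k))
      = inner ℝ (inner ℝ (σ • x) (θ : RSpace k)) t := fun x => by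
    rw [inner_smul_right, inner_smul_left]
    simp
    ring
  simp_rw [h3] at h2
  rw [h2, norm_smul, norm_usphere, mul_one, Real.norm_eq_abs, ← Complex.ofReal_pow, sq_abs]
  rw [Real.coe_toNNReal _ (sq_nonneg σ)]
  push_cast
  ring_nf

/-- A slice is the convolution of a projection with a normal distribution. -/
lemma slice_eq_conv (σ : ℝ) (μ : P2 k) (θ : USphere k) :
    slice σ μ θ = (proj μ.toMeasure θ).conv (gauss σ) := by
  have hn : IsProbabilityMeasure (normalMeasure k σ) :=
    Measure.isProbabilityMeasure_map (by fun_prop)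
  have h1 : ∀ ρ : Measure (RSpace k), proj ρ θ = ρ.map (innerSL ℝ (θ : RSpace k)) := fun ρ => by
    rw [proj]
    congr 1
    funext x
    rw [innerSL_apply_apply, real_inner_comm]
  rw [slice, P2.reg, h1, Measure.map_conv_continuousLinearMap, ← h1, ← h1, proj_normalMeasure]

lemma slice_eq_map {Ω : Type*} [MeasurableSpace Ω] {P : Measure Ω} [IsProbabilityMeasure P]
    {X : Ω → RSpace k} (hX : Measurable X) {μ : P2 k} (hμ : P.map X = μ.toMeasure) (σ : ℝ)
    (θ : USphere k) :
    slice σ μ θ = (P.prod (gauss σ)).map (fun p => inner ℝ (X p.1) (θ : RSpace k) + p.2) := by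
  have h3 : proj μ.toMeasure θ = P.map (fun ω => inner ℝ (X ω) (θ : RSpace k)) := by
    rw [proj, ← hμ, Measure.map_map (by fun_prop) hX]
    rfl
  have hm : Measurable fun ω => inner ℝ (X ω) (θ : RSpace k) := by fun_prop
  conv_lhs => rw [slice_eq_conv, h3, Measure.conv, ← Measure.map_id (μ := gauss σ)]
  rw [Measure.map_prod_map _ _ hm measurable_id, Measure.map_map (by fun_prop) (by fun_prop)]
  rfl

lemma slice_eq_map_id (σ : ℝ) (μ : P2 k) (θ : USphere k) :
    slice σ μ θ
      = (μ.toMeasure.prod (gauss σ)).map (fun p => inner ℝ p.1 (θ : RSpace k) + p.2) :=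
  slice_eq_map (X := id) measurable_id (Measure.map_id) σ θ

instance (σ : ℝ) (μ : P2 k) (θ : USphere k) : IsProbabilityMeasure (slice σ μ θ) := by
  rw [slice_eq_map_id]
  exact Measure.isProbabilityMeasure_map (by fun_prop)

lemma lintegral_slice {Ω : Type*} [MeasurableSpace Ω] {P : Measure Ω} [IsProbabilityMeasure P]
    {X : Ω → RSpace k} (hX : Measurable X) {μ : P2 k} (hμ : P.map X = μ.toMeasure) (σ : ℝ)
    (θ : USphere k) {f : ℝ → ℝ≥0∞} (hf : Measurable f) :
    ∫⁻ y, f y ∂(slice σ μ θ)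
      = ∫⁻ p, f (inner ℝ (X p.1) (θ : RSpace k) + p.2) ∂(P.prod (gauss σ)) := by
  rw [slice_eq_map hX hμ, lintegral_map hf (by fun_prop)]

/-- Conditioning on X writes the distribution function as an average of translated Gaussian ones.
Every regularity and continuity property of slices is derived from this formula. -/
lemma cdf_slice {Ω : Type*} [MeasurableSpace Ω] {P : Measure Ω} [IsProbabilityMeasure P]
    {X : Ω → RSpace k} (hX : Measurable X) {μ : P2 k} (hμ : P.map X = μ.toMeasure) (σ : ℝ)
    (θ : USphere k) (y : ℝ) :
    cdf (slice σ μ θ) y = ∫ ω, cdf (gauss σ) (y - inner ℝ (X ω) (θ : RSpace k)) ∂P := by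
  have hm : Measurable fun p : Ω × ℝ => inner ℝ (X p.1) (θ : RSpace k) + p.2 := by fun_prop
  have hmeas : Measurable (cdf (gauss σ)) := (monotone_cdf _).measurable
  rw [cdf_eq_real, slice_eq_map hX hμ, map_measureReal_apply hm measurableSet_Iic, measureReal_def,
    Measure.prod_apply (hm measurableSet_Iic),
    ← integral_toReal (measurable_measure_prodMk_left (hm measurableSet_Iic)).aemeasurable
      (ae_of_all _ fun _ => measure_lt_top _ _)]
  refine integral_congr_ae (ae_of_all _ fun ω => ?_)
  simp only
  rw [cdf_eq_real, measureReal_def]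
  congr 2
  ext z
  simp only [mem_preimage, mem_Iic]
  constructor <;> intro h <;> linarith

lemma cdf_slice_id (σ : ℝ) (μ : P2 k) (θ : USphere k) (y : ℝ) :
    cdf (slice σ μ θ) y
      = ∫ x, cdf (gauss σ) (y - inner ℝ x (θ : RSpace k)) ∂μ.toMeasure :=
  cdf_slice (X := id) measurable_id Measure.map_id σ θ y

lemma norm_cdf_le_one (α : Measure ℝ) (y : ℝ) : ‖cdf α y‖ ≤ 1 := by
  rw [Real.norm_eq_abs, abs_of_nonneg (cdf_nonneg _ _)]
  exact cdf_le_one _ _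

lemma integrable_cdf_comp {Ω : Type*} [MeasurableSpace Ω] {P : Measure Ω} [IsFiniteMeasure P]
    {f : Ω → ℝ} (hf : Measurable f) (α : Measure ℝ) : Integrable (fun ω => cdf α (f ω)) P :=
  (integrable_const (1 : ℝ)).mono' ((monotone_cdf α).measurable.comp hf).aestronglyMeasurable
    (ae_of_all _ fun _ => norm_cdf_le_one _ _)

/-- This is the role of the regularization: averages of Gaussian distribution functions stay
continuous and strictly increasing even when μ has atoms. -/
lemma hasRegularCdf_slice {σ : ℝ} (hσ : 0 < σ) (μ : P2 k) (θ : USphere k) :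
    HasRegularCdf (slice σ μ θ) where
  prob := inferInstance
  cont := by
    rw [funext (cdf_slice_id σ μ θ)]
    have hc := (hasRegularCdf_gauss hσ).cont
    exact continuous_of_dominated (bound := fun _ => 1)
      (fun y => Continuous.aestronglyMeasurable (by fun_prop))
      (fun y => ae_of_all _ fun x => norm_cdf_le_one _ _) (integrable_const _)
      (ae_of_all _ fun x => by fun_prop)
  mono := fun y y' h => by
    rw [cdf_slice_id, cdf_slice_id, ← sub_pos, ← integral_sub (integrable_cdf_comp (by fun_prop) _)
      (integrable_cdf_comp (by fun_prop) _)]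
    have hpos : ∀ x : RSpace k, 0 < cdf (gauss σ) (y' - inner ℝ x (θ : RSpace k))
        - cdf (gauss σ) (y - inner ℝ x (θ : RSpace k)) := fun x =>
      sub_pos.2 ((hasRegularCdf_gauss hσ).mono (by linarith))
    rw [integral_pos_iff_support_of_nonneg (fun x => (hpos x).le)
      ((integrable_cdf_comp (by fun_prop) _).sub (integrable_cdf_comp (by fun_prop) _))]
    have : Function.support (fun x : RSpace k => cdf (gauss σ) (y' - inner ℝ x (θ : RSpace k))
        - cdf (gauss σ) (y - inner ℝ x (θ : RSpace k))) = univ :=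
      eq_univ_of_forall fun x => (hpos x).ne'
    rw [this]
    simp

/-- The distribution functions of the slices depend continuously on the direction. -/
lemma continuous_cdf_slice {σ : ℝ} (hσ : 0 < σ) (μ : P2 k) (y : ℝ) :
    Continuous fun θ : USphere k => cdf (slice σ μ θ) y := by
  simp_rw [cdf_slice_id]
  have hc := (hasRegularCdf_gauss hσ).cont
  exact continuous_of_dominated (bound := fun _ => 1)
    (fun θ => Continuous.aestronglyMeasurable (by fun_prop))
    (fun θ => ae_of_all _ fun x => norm_cdf_le_one _ _) (integrable_const _)
    (ae_of_all _ fun x => by fun_prop)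

lemma memLp_inner (μ : P2 k) (θ : USphere k) :
    MemLp (fun x : RSpace k => inner ℝ x (θ : RSpace k)) 2 μ.toMeasure := by
  rw [memLp_two_iff_integrable_sq (Continuous.aestronglyMeasurable (by fun_prop))]
  refine μ.integrable_sq.mono' (Continuous.aestronglyMeasurable (by fun_prop))
    (ae_of_all _ fun x => ?_)
  have h := abs_real_inner_le_norm x (θ : RSpace k)
  rw [norm_usphere, mul_one] at h
  rw [Real.norm_eq_abs, abs_pow]
  gcongr

lemma integrable_sq_slice (σ : ℝ) (μ : P2 k) (θ : USphere k) :
    Integrable (fun y => y ^ 2) (slice σ μ θ) := by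
  rw [slice_eq_map_id, integrable_map_measure (by fun_prop) (by fun_prop)]
  have h1 : MemLp (fun p : RSpace k × ℝ => inner ℝ p.1 (θ : RSpace k)) 2
      (μ.toMeasure.prod (gauss σ)) := (memLp_inner μ θ).comp_fst _
  have h2 : MemLp (fun p : RSpace k × ℝ => p.2) 2
      (μ.toMeasure.prod (gauss σ)) := (memLp_gauss σ).comp_snd _
  exact (h1.add h2).integrable_sq

/-- The second moment of a slice. -/
lemma integral_sq_slice (σ : ℝ) (μ : P2 k) (θ : USphere k) :
    ∫ y, y ^ 2 ∂(slice σ μ θ)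
      = ∫ x, (inner ℝ x (θ : RSpace k)) ^ 2 ∂μ.toMeasure + σ ^ 2 := by
  have h1 := memLp_inner μ θ
  have h2 := memLp_gauss σ
  have i1 := h1.integrable (by norm_num)
  have i2 := h2.integrable (by norm_num)
  rw [slice_eq_map_id, integral_map (by fun_prop) (by fun_prop)]
  have e : ∀ p : RSpace k × ℝ, (inner ℝ p.1 (θ : RSpace k) + p.2) ^ 2
      = inner ℝ p.1 (θ : RSpace k) ^ 2 + 2 * (inner ℝ p.1 (θ : RSpace k) * p.2) + p.2 ^ 2 :=
    fun p => by ring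
  simp_rw [e]
  have a1 : Integrable (fun p : RSpace k × ℝ => inner ℝ p.1 (θ : RSpace k) ^ 2)
    (μ.toMeasure.prod (gauss σ)) := h1.integrable_sq.comp_fst _
  have a2 : Integrable (fun p : RSpace k × ℝ => p.2 ^ 2)
    (μ.toMeasure.prod (gauss σ)) := h2.integrable_sq.comp_snd _
  have a3 : Integrable (fun p : RSpace k × ℝ => 2 * (inner ℝ p.1 (θ : RSpace k) * p.2))
    (μ.toMeasure.prod (gauss σ)) := (i1.mul_prod i2).const_mul 2
  have a13 : Integrable (fun p : RSpace k × ℝ => inner ℝ p.1 (θ : RSpace k) ^ 2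
    + 2 * (inner ℝ p.1 (θ : RSpace k) * p.2)) (μ.toMeasure.prod (gauss σ)) := a1.add a3
  -- The cross term vanishes because the noise is centered and independent of x.
  rw [integral_add a13 a2, integral_add a1 a3, integral_const_mul,
    integral_prod_mul (fun x : RSpace k => inner ℝ x (θ : RSpace k)) (fun z : ℝ => z),
    integral_gauss]
  have e1 := integral_fun_fst (μ := μ.toMeasure) (ν := gauss σ)
    (fun x : RSpace k => inner ℝ x (θ : RSpace k) ^ 2)
  have e2 := integral_fun_snd (μ := μ.toMeasure) (ν := gauss σ) (fun z : ℝ => z ^ 2)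
  rw [e1, e2, integral_sq_gauss]
  simp

end Slice

/-! ### Convergence in the Wasserstein distance -/

section WassersteinTopology

variable {k : ℕ}

lemma isProbabilityMeasure_of_mem_couplings {F : Type*} [MeasurableSpace F] {μ ν : Measure F}
    [IsProbabilityMeasure μ] {π : Measure (F × F)} (hπ : π ∈ couplings μ ν) :
    IsProbabilityMeasure π := by
  constructor
  have : π.map Prod.fst univ = 1 := by rw [hπ.1]; simp
  rwa [Measure.map_apply measurable_fst MeasurableSet.univ] at this

/-- The quadratic cost is integrable for every coupling of measures with finite second moment. -/
lemma integrable_norm_sub_sq (μ ν : P2 k) {π : Measure (RSpace k × RSpace k)}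
    (hπ : π ∈ couplings μ.toMeasure ν.toMeasure) :
    Integrable (fun z : RSpace k × RSpace k => ‖z.1 - z.2‖ ^ 2) π := by
  have h1 : Integrable (fun z : RSpace k × RSpace k => ‖z.1‖ ^ 2) π :=
    integrable_fst_of_mem_couplings hπ μ.integrable_sq
  have h2 : Integrable (fun z : RSpace k × RSpace k => ‖z.2‖ ^ 2) π :=
    integrable_snd_of_mem_couplings hπ ν.integrable_sq
  refine ((h1.add h2).const_mul 2).mono' (Continuous.aestronglyMeasurable (by fun_prop))
    (ae_of_all _ fun z => ?_)
  rw [Real.norm_eq_abs, abs_of_nonneg (by positivity), Pi.add_apply]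
  have := norm_sub_le z.1 z.2
  nlinarith [norm_nonneg (z.1 - z.2), sq_nonneg (‖z.1‖ - ‖z.2‖)]

lemma prod_mem_couplings {F : Type*} [MeasurableSpace F] (μ ν : Measure F)
    [IsProbabilityMeasure μ] [IsProbabilityMeasure ν] : μ.prod ν ∈ couplings μ ν :=
  ⟨by simp, by simp⟩

lemma lintegral_cost_eq (μ ν : P2 k) {π : Measure (RSpace k × RSpace k)}
    (hπ : π ∈ couplings μ.toMeasure ν.toMeasure) :
    ∫⁻ z, ENNReal.ofReal (‖z.1 - z.2‖ ^ 2 / 2) ∂π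
      = ENNReal.ofReal (∫ z, ‖z.1 - z.2‖ ^ 2 / 2 ∂π) :=
  (ofReal_integral_eq_lintegral_ofReal ((integrable_norm_sub_sq μ ν hπ).div_const 2)
    (ae_of_all _ fun _ => by positivity)).symm

lemma wassersteinSq_ne_top (μ ν : P2 k) : wassersteinSq μ.toMeasure ν.toMeasure ≠ ∞ := by
  have hm := prod_mem_couplings μ.toMeasure ν.toMeasure
  refine ne_top_of_le_ne_top ?_ (iInf₂_le _ hm)
  rw [lintegral_cost_eq μ ν hm]
  exact ENNReal.ofReal_ne_top

lemma exists_coupling_of_W2_lt (μ ν : P2 k) {ε : ℝ} (h : μ.W2 ν < ε) :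
    ∃ π ∈ couplings μ.toMeasure ν.toMeasure, ∫ z, ‖z.1 - z.2‖ ^ 2 ∂π < 2 * ε ^ 2 := by
  have hε : 0 < ε := (Real.sqrt_nonneg _).trans_lt h
  have h1 : wassersteinSq μ.toMeasure ν.toMeasure < ENNReal.ofReal (ε ^ 2) := by
    rw [P2.W2, Real.sqrt_lt' hε] at h
    exact (ENNReal.lt_ofReal_iff_toReal_lt (wassersteinSq_ne_top μ ν)).2 h
  rw [wassersteinSq] at h1
  simp only [iInf_lt_iff] at h1
  obtain ⟨π, hπ, hlt⟩ := h1
  refine ⟨π, hπ, ?_⟩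
  rw [lintegral_cost_eq μ ν hπ, ENNReal.ofReal_lt_ofReal_iff (by positivity),
    integral_div] at hlt
  linarith

lemma eventually_W2_lt (μ : P2 k) {ε : ℝ} (hε : 0 < ε) : ∀ᶠ ν in μ.nhdsW2, μ.W2 ν < ε :=
  tendsto_comap.eventually (gt_mem_nhds hε)

lemma tendsto_nhdsW2_of_wassersteinSq {ι : Type*} {l : Filter ι} {μ : P2 k} {ν : ι → P2 k}
    (h : Tendsto (fun i => wassersteinSq μ.toMeasure (ν i).toMeasure) l (𝓝 0)) :
    Tendsto ν l μ.nhdsW2 := by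
  rw [P2.nhdsW2, tendsto_comap_iff]
  have h1 : Tendsto (fun i => √(wassersteinSq μ.toMeasure (ν i).toMeasure).toReal) l
      (𝓝 (√(0 : ℝ≥0∞).toReal)) :=
    (Real.continuous_sqrt.tendsto _).comp ((ENNReal.tendsto_toReal (by simp)).comp h)
  rw [ENNReal.toReal_zero, Real.sqrt_zero] at h1
  exact h1

lemma secondMoment_le_of_coupling (μ ν : P2 k) {π : Measure (RSpace k × RSpace k)}
    (hπ : π ∈ couplings μ.toMeasure ν.toMeasure) :
    ν.secondMoment ≤ 2 * μ.secondMoment + 2 * ∫ z, ‖z.1 - z.2‖ ^ 2 ∂π := by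
  rw [P2.secondMoment, P2.secondMoment, ← integral_fst_of_mem_couplings hπ μ.integrable_sq,
    ← integral_snd_of_mem_couplings hπ ν.integrable_sq, ← mul_add, ← integral_add
    (integrable_fst_of_mem_couplings hπ μ.integrable_sq) (integrable_norm_sub_sq μ ν hπ),
    ← integral_const_mul]
  refine integral_mono (integrable_snd_of_mem_couplings hπ ν.integrable_sq)
    (((integrable_fst_of_mem_couplings hπ μ.integrable_sq).add
      (integrable_norm_sub_sq μ ν hπ)).const_mul 2) fun z => ?_
  have : ‖z.2‖ ≤ ‖z.1‖ + ‖z.1 - z.2‖ := by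
    have := norm_sub_le z.1 (z.1 - z.2)
    rwa [sub_sub_cancel] at this
  nlinarith [norm_nonneg z.2, sq_nonneg (‖z.1‖ - ‖z.1 - z.2‖)]

lemma eventually_secondMoment_le (μ : P2 k) :
    ∀ᶠ ν in μ.nhdsW2, ν.secondMoment ≤ 2 * μ.secondMoment + 4 := by
  filter_upwards [eventually_W2_lt μ one_pos] with ν hν
  obtain ⟨π, hπ, h⟩ := exists_coupling_of_W2_lt μ ν hν
  linarith [secondMoment_le_of_coupling μ ν hπ]

/-- Integrals of bounded Lipschitz functions are continuous in the Wasserstein distance. -/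
lemma tendsto_integral_nhdsW2 (μ : P2 k) {f : RSpace k → ℝ} {K B : ℝ}
    (hf : ∀ x y, |f x - f y| ≤ K * ‖x - y‖) (hc : Continuous f) (hB : ∀ x, |f x| ≤ B) :
    Tendsto (fun ν : P2 k => ∫ x, f x ∂ν.toMeasure) μ.nhdsW2 (𝓝 (∫ x, f x ∂μ.toMeasure)) := by
  have hi : ∀ ν : P2 k, Integrable f ν.toMeasure := fun ν =>
    (integrable_const B).mono' hc.aestronglyMeasurable (ae_of_all _ hB)
  rw [Metric.tendsto_nhds]
  intro ε hε
  have hη : 0 < ε / (2 * (|K| + 1)) := by positivity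
  filter_upwards [eventually_W2_lt μ hη] with ν hν
  set η := ε / (2 * (|K| + 1)) with hηdef
  obtain ⟨π, hπ, hlt⟩ := exists_coupling_of_W2_lt μ ν hν
  have := isProbabilityMeasure_of_mem_couplings hπ
  have hsq := integrable_norm_sub_sq μ ν hπ
  have hL2 : MemLp (fun z : RSpace k × RSpace k => ‖z.1 - z.2‖) 2 π :=
    (memLp_two_iff_integrable_sq (Continuous.aestronglyMeasurable (by fun_prop))).2 hsq
  have hL1 := hL2.integrable (by norm_num)
  have hnorm : ∫ z, ‖z.1 - z.2‖ ∂π ≤ 3 / 2 * η := by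
    -- The arithmetic–geometric inequality with weight η replaces Cauchy–Schwarz. The factor ½ in
    -- the cost makes the quadratic integral less than 2η², whence 3η/2.
    have h1 : ∀ z : RSpace k × RSpace k, ‖z.1 - z.2‖ ≤ η / 2 + ‖z.1 - z.2‖ ^ 2 / (2 * η) :=
      fun z => by
        rw [← sub_nonneg]
        have : η / 2 + ‖z.1 - z.2‖ ^ 2 / (2 * η) - ‖z.1 - z.2‖
          = (‖z.1 - z.2‖ - η) ^ 2 / (2 * η) := by field_simp; ring
        rw [this]; positivity
    calc ∫ z, ‖z.1 - z.2‖ ∂π ≤ ∫ z, (η / 2 + ‖z.1 - z.2‖ ^ 2 / (2 * η)) ∂π :=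
          integral_mono hL1 ((integrable_const _).add (hsq.div_const _)) h1
      _ = η / 2 + (∫ z, ‖z.1 - z.2‖ ^ 2 ∂π) / (2 * η) := by
          rw [integral_add (integrable_const _) (hsq.div_const _),
            integral_div _ (fun z : RSpace k × RSpace k => ‖z.1 - z.2‖ ^ 2)]
          simp
      _ ≤ η / 2 + (2 * η ^ 2) / (2 * η) := by gcongr
      _ = 3 / 2 * η := by field_simp; ring
  rw [dist_comm, Real.dist_eq, ← integral_fst_of_mem_couplings hπ (hi μ),
    ← integral_snd_of_mem_couplings hπ (hi ν),
    ← integral_sub (integrable_fst_of_mem_couplings hπ (hi μ))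
      (integrable_snd_of_mem_couplings hπ (hi ν))]
  calc |∫ z, (f z.1 - f z.2) ∂π| ≤ ∫ z, |f z.1 - f z.2| ∂π := abs_integral_le_integral_abs
    _ ≤ ∫ z, |K| * ‖z.1 - z.2‖ ∂π := by
        refine integral_mono ((integrable_fst_of_mem_couplings hπ (hi μ)).sub
          (integrable_snd_of_mem_couplings hπ (hi ν))).abs (hL1.const_mul _) fun z => ?_
        exact (hf _ _).trans (by gcongr; exact le_abs_self K)
    _ = |K| * ∫ z, ‖z.1 - z.2‖ ∂π := integral_const_mul _ _
    _ ≤ |K| * (3 / 2 * η) := by gcongr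
    _ < 2 * (|K| + 1) * η := by nlinarith [abs_nonneg K]
    _ = ε := by rw [hηdef]; field_simp

lemma tendsto_cdf_slice_nhdsW2 {σ : ℝ} (hσ : 0 < σ) (μ : P2 k) (θ : USphere k) (y : ℝ) :
    Tendsto (fun ν => cdf (slice σ ν θ) y) μ.nhdsW2 (𝓝 (cdf (slice σ μ θ) y)) := by
  simp_rw [cdf_slice_id]
  have hc := (hasRegularCdf_gauss hσ).cont
  refine tendsto_integral_nhdsW2 μ (K := (√(2 * Real.pi * σ ^ 2))⁻¹) (B := 1) (fun x x' => ?_)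
    (by fun_prop) (fun x => norm_cdf_le_one _ _)
  refine (abs_cdf_gauss_sub_le hσ _ _).trans ?_
  gcongr
  have h := abs_real_inner_le_norm (x - x') (θ : RSpace k)
  rw [norm_usphere, mul_one, inner_sub_left] at h
  rw [sub_sub_sub_cancel_left, abs_sub_comm]
  exact h

end WassersteinTopology

/-! ### Uniform measure on the sphere and mean squared projections -/

section SphereMeasure

variable {k : ℕ}

lemma toSphere_univ_ne_zero (hk : 1 ≤ k) : (volume : Measure (RSpace k)).toSphere univ ≠ 0 := by
  have : Nontrivial (RSpace k) := by
    have : Nonempty (Fin k) := ⟨⟨0, hk⟩⟩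
    infer_instance
  exact Measure.measure_univ_ne_zero.2 (Measure.toSphere_ne_zero _)

lemma isProbabilityMeasure_sphereMeasure (hk : 1 ≤ k) : IsProbabilityMeasure (sphereMeasure k) :=
  ⟨by
    rw [sphereMeasure, Measure.smul_apply, smul_eq_mul]
    exact ENNReal.inv_mul_cancel (toSphere_univ_ne_zero hk) (measure_ne_top _ _)⟩

instance isFiniteMeasure_sphereMeasure : IsFiniteMeasure (sphereMeasure k) := by
  -- In dimension zero the surface measure is 0, and scaling it by the infinite inverse mass still
  -- gives 0.
  rcases Nat.eq_zero_or_pos k with rfl | hk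
  · have : (volume : Measure (RSpace 0)).toSphere = 0 :=
      (Measure.toSphere_eq_zero_iff _).2 inferInstance
    rw [sphereMeasure, this]
    simp only [smul_zero]
    infer_instance
  · have := isProbabilityMeasure_sphereMeasure hk
    infer_instance

lemma isOpenPosMeasure_sphereMeasure : (sphereMeasure k).IsOpenPosMeasure :=
  (Measure.absolutelyContinuous_smul (μ := (volume : Measure (RSpace k)).toSphere)
    (ENNReal.inv_ne_zero.2 (measure_ne_top _ _))).isOpenPosMeasure

/-- The mean square of the projections of `x`. -/
noncomputable def meanSq (x : RSpace k) : ℝ :=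
  ∫ θ, (inner ℝ x (θ : RSpace k)) ^ 2 ∂(sphereMeasure k)

lemma sq_inner_le (x : RSpace k) (θ : USphere k) : inner ℝ x (θ : RSpace k) ^ 2 ≤ ‖x‖ ^ 2 := by
  have h := abs_real_inner_le_norm x (θ : RSpace k)
  rw [norm_usphere, mul_one] at h
  rw [← sq_abs]
  gcongr

lemma meanSq_nonneg (x : RSpace k) : 0 ≤ meanSq x := integral_nonneg fun _ => sq_nonneg _

lemma integrable_sq_inner (x : RSpace k) :
    Integrable (fun θ : USphere k => inner ℝ x (θ : RSpace k) ^ 2) (sphereMeasure k) := by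
  refine (integrable_const (‖x‖ ^ 2)).mono' (Continuous.aestronglyMeasurable (by fun_prop))
    (ae_of_all _ fun θ => ?_)
  rw [Real.norm_eq_abs, abs_of_nonneg (sq_nonneg _)]
  exact sq_inner_le x θ

lemma meanSq_le (hk : 1 ≤ k) (x : RSpace k) : meanSq x ≤ ‖x‖ ^ 2 := by
  have := isProbabilityMeasure_sphereMeasure hk
  calc meanSq x ≤ ∫ _ : USphere k, ‖x‖ ^ 2 ∂(sphereMeasure k) :=
        integral_mono (integrable_sq_inner x) (integrable_const _) fun θ => sq_inner_le x θ
    _ = ‖x‖ ^ 2 := by simp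

lemma continuous_meanSq : Continuous (meanSq (k := k)) := by
  rw [continuous_iff_continuousAt]
  intro x
  refine continuousAt_of_dominated (bound := fun _ => (‖x‖ + 1) ^ 2)
    (Eventually.of_forall fun y => Continuous.aestronglyMeasurable (by fun_prop)) ?_
    (integrable_const _) (ae_of_all _ fun θ => by fun_prop)
  filter_upwards [(continuous_norm.tendsto x).eventually (gt_mem_nhds (lt_add_one ‖x‖))] with y hy
  refine ae_of_all _ fun θ => ?_
  rw [Real.norm_eq_abs, abs_of_nonneg (sq_nonneg _)]
  exact (sq_inner_le y θ).trans (by gcongr)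

lemma meanSq_smul (c : ℝ) (x : RSpace k) : meanSq (c • x) = c ^ 2 * meanSq x := by
  rw [meanSq, meanSq, ← integral_const_mul]
  congr 1
  funext θ
  rw [inner_smul_left]
  simp
  ring

lemma meanSq_pos (θ : USphere k) : 0 < meanSq (θ : RSpace k) := by
  have := isOpenPosMeasure_sphereMeasure (k := k)
  rw [meanSq]
  refine Continuous.integral_pos_of_hasCompactSupport_nonneg_nonzero (x := θ) (by fun_prop)
    (HasCompactSupport.of_compactSpace _) (fun _ => sq_nonneg _) ?_
  rw [real_inner_self_eq_norm_sq, norm_usphere]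
  simp

lemma exists_forall_le_meanSq (hk : 1 ≤ k) :
    ∃ c : ℝ, 0 < c ∧ ∀ θ : USphere k, c ≤ meanSq (θ : RSpace k) := by
  have hne : Nonempty (USphere k) := by
    have : Nontrivial (RSpace k) := by
      have : Nonempty (Fin k) := ⟨⟨0, hk⟩⟩
      infer_instance
    exact (NormedSpace.sphere_nonempty.2 zero_le_one).to_subtype
  have hcont : Continuous fun θ : USphere k => meanSq (θ : RSpace k) :=
    continuous_meanSq.comp continuous_subtype_val
  obtain ⟨θ, -, hθ⟩ := isCompact_univ.exists_isMinOn univ_nonempty hcont.continuousOn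
  exact ⟨meanSq (θ : RSpace k), meanSq_pos θ, fun θ' => hθ (mem_univ θ')⟩

/-- By homogeneity it suffices to bound `meanSq` below on the sphere, where it is continuous and
positive. Rotation invariance would give the constant 1/k, but positivity is enough. -/
lemma exists_mul_le_meanSq (hk : 1 ≤ k) :
    ∃ c : ℝ, 0 < c ∧ ∀ x : RSpace k, c * ‖x‖ ^ 2 ≤ meanSq x := by
  obtain ⟨c, hc, h⟩ := exists_forall_le_meanSq hk
  refine ⟨c, hc, fun x => ?_⟩
  rcases eq_or_ne x 0 with rfl | hx
  · simpa using meanSq_nonneg (0 : RSpace k)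
  have hx' : ‖x‖ ≠ 0 := norm_ne_zero_iff.2 hx
  have hmem : ‖x‖⁻¹ • x ∈ Metric.sphere (0 : RSpace k) 1 := by
    simp [norm_smul, hx']
  have h1 := h ⟨_, hmem⟩
  have h2 : meanSq x = ‖x‖ ^ 2 * meanSq (‖x‖⁻¹ • x) := by
    rw [meanSq_smul]; field_simp
  rw [h2, mul_comm]
  exact mul_le_mul_of_nonneg_left h1 (sq_nonneg _)

lemma integrable_meanSq (hk : 1 ≤ k) (μ : P2 k) : Integrable meanSq μ.toMeasure :=
  μ.integrable_sq.mono' continuous_meanSq.aestronglyMeasurable (ae_of_all _ fun x => by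
    rw [Real.norm_eq_abs, abs_of_nonneg (meanSq_nonneg x)]
    exact meanSq_le hk x)

lemma integrable_sq_inner_prod (μ : P2 k) :
    Integrable (fun p : USphere k × RSpace k => inner ℝ p.2 (p.1 : RSpace k) ^ 2)
      ((sphereMeasure k).prod μ.toMeasure) := by
  have h : Integrable (fun p : USphere k × RSpace k => ‖p.2‖ ^ 2)
      ((sphereMeasure k).prod μ.toMeasure) := μ.integrable_sq.comp_snd _
  refine h.mono' (Continuous.aestronglyMeasurable (by fun_prop)) (ae_of_all _ fun p => ?_)
  rw [Real.norm_eq_abs, abs_of_nonneg (sq_nonneg _)]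
  exact sq_inner_le _ _

lemma integral_integral_sq_inner (μ : P2 k) :
    ∫ θ, ∫ x, inner ℝ x (θ : RSpace k) ^ 2 ∂μ.toMeasure ∂(sphereMeasure k)
      = ∫ x, meanSq x ∂μ.toMeasure :=
  integral_integral_swap (integrable_sq_inner_prod μ)

end SphereMeasure

/-! ### Embedding of the sliced distance into L² -/

section Embedding

variable {k : ℕ}

/-- The isometric embedding of `(𝒫₂(ℝᵏ), √2 SW₂^σ)` into a space of square integrable functions: in
each direction, the rearrangement of a fixed normal distribution into the slice. -/
noncomputable def embed (σ : ℝ) (μ : P2 k) (p : USphere k × ℝ) : ℝ :=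
  transport (gauss σ) (slice σ μ p.1) p.2

/-- The reference measure for `embed`. -/
noncomputable def baseMeasure (k : ℕ) (σ : ℝ) : Measure (USphere k × ℝ) :=
  (sphereMeasure k).prod (gauss σ)

lemma continuous_embed {σ : ℝ} (hσ : 0 < σ) (μ : P2 k) : Continuous (embed σ μ) := by
  rw [continuous_iff_continuousAt]
  intro p
  exact tendsto_transport (a := fun _ => gauss σ) (b := fun q : USphere k × ℝ => slice σ μ q.1)
    (hasRegularCdf_gauss hσ) (hasRegularCdf_slice hσ μ p.1) (fun _ => hasRegularCdf_gauss hσ)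
    (fun q => hasRegularCdf_slice hσ μ q.1) (fun _ => tendsto_const_nhds)
    (fun c => ((continuous_cdf_slice hσ μ c).comp continuous_fst).tendsto p)
    (continuous_snd.tendsto p)

lemma lintegral_sq_embed {σ : ℝ} (hσ : 0 < σ) (μ : P2 k) :
    ∫⁻ p, ENNReal.ofReal (embed σ μ p ^ 2) ∂(baseMeasure k σ)
      = ENNReal.ofReal (∫ θ, ∫ y, y ^ 2 ∂(slice σ μ θ) ∂(sphereMeasure k)) := by
  have hc := continuous_embed hσ μ
  have hc2 : Continuous fun p => ENNReal.ofReal (embed σ μ p ^ 2) :=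
    ENNReal.continuous_ofReal.comp (hc.pow 2)
  have h1 : ∀ θ : USphere k, ∫⁻ z, ENNReal.ofReal (embed σ μ (θ, z) ^ 2) ∂(gauss σ)
      = ENNReal.ofReal (∫ y, y ^ 2 ∂(slice σ μ θ)) := fun θ => by
    rw [ofReal_integral_eq_lintegral_ofReal (integrable_sq_slice σ μ θ)
      (ae_of_all _ fun _ => sq_nonneg _)]
    exact lintegral_comp_transport (hasRegularCdf_gauss hσ) (hasRegularCdf_slice hσ μ θ)
      (f := fun y => ENNReal.ofReal (y ^ 2)) (by fun_prop)
  rw [baseMeasure, lintegral_prod _ hc2.measurable.aemeasurable]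
  simp_rw [h1]
  refine (ofReal_integral_eq_lintegral_ofReal ?_ (ae_of_all _ fun _ =>
    integral_nonneg fun _ => sq_nonneg _)).symm
  simp_rw [integral_sq_slice]
  exact (integrable_sq_inner_prod μ).integral_prod_left.add (integrable_const _)

lemma memLp_embed {σ : ℝ} (hσ : 0 < σ) (μ : P2 k) : MemLp (embed σ μ) 2 (baseMeasure k σ) := by
  have hc := continuous_embed hσ μ
  rw [memLp_two_iff_integrable_sq hc.aestronglyMeasurable]
  refine ⟨(hc.pow 2).aestronglyMeasurable, ?_⟩
  rw [hasFiniteIntegral_iff_ofReal (ae_of_all _ fun _ => sq_nonneg _), lintegral_sq_embed hσ]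
  exact ENNReal.ofReal_lt_top

lemma integral_sq_embed (hk : 1 ≤ k) {σ : ℝ} (hσ : 0 < σ) (μ : P2 k) :
    ∫ p, embed σ μ p ^ 2 ∂(baseMeasure k σ) = ∫ x, meanSq x ∂μ.toMeasure + σ ^ 2 := by
  have := isProbabilityMeasure_sphereMeasure hk
  rw [integral_eq_lintegral_of_nonneg_ae (ae_of_all _ fun _ => sq_nonneg _)
    ((continuous_embed hσ μ).pow 2).aestronglyMeasurable, lintegral_sq_embed hσ,
    ENNReal.toReal_ofReal (integral_nonneg fun _ => integral_nonneg fun _ => sq_nonneg _)]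
  simp_rw [integral_sq_slice]
  rw [integral_add (integrable_sq_inner_prod μ).integral_prod_left (integrable_const _),
    integral_integral_sq_inner]
  simp

/-- Composing the map from the normal law to one slice with the optimal map to the other gives the
map from the normal law to the second slice. A change of variables thus expresses all costs on one
common Gaussian space. -/
lemma wassersteinSq_slice {σ : ℝ} (hσ : 0 < σ) (μ ν : P2 k) (θ : USphere k) :
    wassersteinSq (slice σ μ θ) (slice σ ν θ)
      = ∫⁻ z, ENNReal.ofReal ((embed σ μ (θ, z) - embed σ ν (θ, z)) ^ 2 / 2) ∂(gauss σ) := by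
  have hg := hasRegularCdf_gauss hσ
  have hμ := hasRegularCdf_slice hσ μ θ
  have hν := hasRegularCdf_slice hσ ν θ
  have hc := continuous_transport hμ hν
  rw [wassersteinSq_eq_lintegral_transport hμ hν (integrable_sq_slice σ μ θ)
    (integrable_sq_slice σ ν θ), ← lintegral_comp_transport hg hμ (by fun_prop)]
  simp only [embed, transport_transport hg hμ hν]

lemma lintegral_wassersteinSq_slice {σ : ℝ} (hσ : 0 < σ) (μ ν : P2 k) :
    ∫⁻ θ, wassersteinSq (slice σ μ θ) (slice σ ν θ) ∂(sphereMeasure k)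
      = ENNReal.ofReal ((∫ p, (embed σ μ p - embed σ ν p) ^ 2 ∂(baseMeasure k σ)) / 2) := by
  have h1 := continuous_embed hσ μ
  have h2 := continuous_embed hσ ν
  have hc : Continuous fun p => ENNReal.ofReal ((embed σ μ p - embed σ ν p) ^ 2 / 2) :=
    ENNReal.continuous_ofReal.comp (((h1.sub h2).pow 2).div_const 2)
  have hi : Integrable (fun p => (embed σ μ p - embed σ ν p) ^ 2 / 2) (baseMeasure k σ) :=
    (((memLp_embed hσ μ).sub (memLp_embed hσ ν)).integrable_sq).div_const 2
  simp_rw [wassersteinSq_slice hσ]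
  rw [← integral_div, ofReal_integral_eq_lintegral_ofReal hi
    (ae_of_all _ fun _ => div_nonneg (sq_nonneg _) zero_le_two), baseMeasure,
    lintegral_prod _ hc.measurable.aemeasurable]

lemma SW2reg_sq {σ : ℝ} (hσ : 0 < σ) (μ ν : P2 k) :
    SW2reg σ μ ν ^ 2 = (∫ p, (embed σ μ p - embed σ ν p) ^ 2 ∂(baseMeasure k σ)) / 2 := by
  have h0 : 0 ≤ ∫ p, (embed σ μ p - embed σ ν p) ^ 2 ∂(baseMeasure k σ) :=
    integral_nonneg fun _ => sq_nonneg _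
  have h := lintegral_wassersteinSq_slice hσ μ ν
  unfold slice at h
  rw [SW2reg, SW2, h, ENNReal.toReal_ofReal (by positivity), Real.sq_sqrt (by positivity)]

lemma norm_toLp_sq {Ω : Type*} [MeasurableSpace Ω] {m : Measure Ω} {f : Ω → ℝ} (hf : MemLp f 2 m) :
    ‖hf.toLp f‖ ^ 2 = ∫ x, f x ^ 2 ∂m := by
  rw [← real_inner_self_eq_norm_sq, L2.inner_def]
  refine integral_congr_ae ?_
  filter_upwards [hf.coeFn_toLp] with x hx
  rw [hx]
  simp [sq]

/-- `embed` as an element of `L²`. -/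
noncomputable def embedLp {σ : ℝ} (hσ : 0 < σ) (μ : P2 k) : Lp ℝ 2 (baseMeasure k σ) :=
  (memLp_embed hσ μ).toLp _

lemma SW2reg_sq_eq_norm {σ : ℝ} (hσ : 0 < σ) (μ ν : P2 k) :
    SW2reg σ μ ν ^ 2 = ‖embedLp hσ μ - embedLp hσ ν‖ ^ 2 / 2 := by
  rw [SW2reg_sq hσ, embedLp, embedLp, ← MemLp.toLp_sub, norm_toLp_sq]
  rfl

lemma norm_embedLp_sq (hk : 1 ≤ k) {σ : ℝ} (hσ : 0 < σ) (μ : P2 k) :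
    ‖embedLp hσ μ‖ ^ 2 = ∫ x, meanSq x ∂μ.toMeasure + σ ^ 2 := by
  rw [embedLp, norm_toLp_sq, integral_sq_embed hk hσ]

lemma norm_embedLp_sq_le (hk : 1 ≤ k) {σ : ℝ} (hσ : 0 < σ) (μ : P2 k) :
    ‖embedLp hσ μ‖ ^ 2 ≤ μ.secondMoment + σ ^ 2 := by
  rw [norm_embedLp_sq hk hσ, P2.secondMoment]
  refine add_le_add_left ?_ _
  exact integral_mono (integrable_meanSq hk μ) μ.integrable_sq fun x => meanSq_le hk x

/-- Bounds in the embedding become moment bounds, and thus tightness; the constant is the same for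
all σ because the term σ² is nonnegative and can be dropped. -/
lemma exists_secondMoment_le_norm_embedLp (hk : 1 ≤ k) :
    ∃ K : ℝ, 0 ≤ K ∧ ∀ {σ : ℝ} (hσ : 0 < σ) (μ : P2 k),
      μ.secondMoment ≤ K * ‖embedLp hσ μ‖ ^ 2 := by
  obtain ⟨c, hc, h⟩ := exists_mul_le_meanSq hk
  refine ⟨c⁻¹, by positivity, fun hσ μ => ?_⟩
  rw [norm_embedLp_sq hk hσ, P2.secondMoment, le_inv_mul_iff₀ hc, ← integral_const_mul]
  have := integral_mono (μ.integrable_sq.const_mul c) (integrable_meanSq hk μ) h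
  nlinarith

/-- The regularized sliced Wasserstein distance separates points. -/
lemma eq_of_embedLp_eq {σ : ℝ} (hσ : 0 < σ) {μ ν : P2 k}
    (h : embedLp hσ μ = embedLp hσ ν) : μ = ν := by
  have := isOpenPosMeasure_sphereMeasure (k := k)
  have : (gauss σ).IsOpenPosMeasure :=
    (gaussianReal_absolutelyContinuous' 0 (gauss_var_ne_zero hσ)).isOpenPosMeasure
  have hae : embed σ μ =ᵐ[baseMeasure k σ] embed σ ν := (MemLp.toLp_eq_toLp_iff _ _).1 h
  have : (baseMeasure k σ).IsOpenPosMeasure := by unfold baseMeasure; infer_instance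
  -- Both functions are continuous and the reference measure has full support, so equality almost
  -- everywhere is equality everywhere.
  have heq : embed σ μ = embed σ ν :=
    Continuous.ae_eq_iff_eq _ (continuous_embed hσ μ) (continuous_embed hσ ν) |>.1 hae
  have hslice : ∀ θ : USphere k, slice σ μ θ = slice σ ν θ := fun θ => by
    rw [← map_transport (hasRegularCdf_gauss hσ) (hasRegularCdf_slice hσ μ θ),
      ← map_transport (hasRegularCdf_gauss hσ) (hasRegularCdf_slice hσ ν θ)]
    congr 1
    funext z
    exact congrFun heq (θ, z)
  have hproj : ∀ (θ : USphere k) (t : ℝ),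
      charFun (proj μ.toMeasure θ) t = charFun (proj ν.toMeasure θ) t := fun θ t => by
    have hp : ∀ ρ : P2 k, IsProbabilityMeasure (proj ρ.toMeasure θ) := fun ρ =>
      Measure.isProbabilityMeasure_map (by fun_prop)
    have h1 := hp μ
    have h2 := hp ν
    have h3 := congrArg (fun α => charFun α t) (hslice θ)
    simp only [slice_eq_conv, charFun_conv] at h3
    -- Deconvolution: the Gaussian characteristic function has no zeros and can be cancelled. What
    -- remains is the Cramér–Wold argument.
    refine mul_right_cancel₀ ?_ h3
    rw [gauss, charFun_gaussianReal]
    exact Complex.exp_ne_zero _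
  have hcf : ∀ (ρ : P2 k) (θ : USphere k) (t : ℝ),
      charFun ρ.toMeasure (t • (θ : RSpace k)) = charFun (proj ρ.toMeasure θ) t := fun ρ θ t => by
    rw [charFun_apply, charFun_apply, proj, integral_map (by fun_prop) (by fun_prop)]
    congr 1
    funext x
    congr 3
    rw [inner_smul_right]
    simp
  apply Subtype.ext
  change μ.toMeasure = ν.toMeasure
  refine Measure.ext_of_charFun ?_
  funext ξ
  rcases eq_or_ne ξ 0 with rfl | hξ
  · simp
  have hξ' : ‖ξ‖ ≠ 0 := norm_ne_zero_iff.2 hξ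
  have hmem : ‖ξ‖⁻¹ • ξ ∈ Metric.sphere (0 : RSpace k) 1 := by
    simp [norm_smul, hξ']
  have h1 : ξ = ‖ξ‖ • ((⟨_, hmem⟩ : USphere k) : RSpace k) := by
    rw [smul_smul, mul_inv_cancel₀ hξ', one_smul]
  rw [h1, hcf, hcf, hproj]

end Embedding

/-! ### Bounding the Wasserstein distance by mollified densities -/

section WeakToWasserstein

variable {k : ℕ}

lemma map_fst_withDensity_prod {F : Type*} [MeasurableSpace F] (P Q : Measure F) [SFinite P]
    [SFinite Q] {h : F × F → ℝ≥0∞} (hh : Measurable h) :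
    ((P.prod Q).withDensity h).map Prod.fst = P.withDensity fun x => ∫⁻ y, h (x, y) ∂Q := by
  ext A hA
  have hset : Prod.fst ⁻¹' A = A ×ˢ (univ : Set F) := by ext; simp
  rw [Measure.map_apply measurable_fst hA, withDensity_apply _ (measurable_fst hA),
    withDensity_apply _ hA, hset, ← Measure.prod_restrict, lintegral_prod _ hh.aemeasurable,
    Measure.restrict_univ]

lemma map_snd_withDensity_prod {F : Type*} [MeasurableSpace F] (P Q : Measure F) [SFinite P]
    [SFinite Q] {h : F × F → ℝ≥0∞} (hh : Measurable h) :
    ((P.prod Q).withDensity h).map Prod.snd = Q.withDensity fun y => ∫⁻ x, h (x, y) ∂P := by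
  ext A hA
  have hset : Prod.snd ⁻¹' A = (univ : Set F) ×ˢ A := by ext; simp
  rw [Measure.map_apply measurable_snd hA, withDensity_apply _ (measurable_snd hA),
    withDensity_apply _ hA, hset, ← Measure.prod_restrict, lintegral_prod_symm _ hh.aemeasurable,
    Measure.restrict_univ]

/-- A partial coupling with density `κ` is completed by a product of the remaining marginals. -/
lemma wassersteinSq_le_of_partial_coupling {P Q : Measure (RSpace k)} [IsProbabilityMeasure P]
    [IsProbabilityMeasure Q] {κ : RSpace k × RSpace k → ℝ≥0∞} {r₁ r₂ : RSpace k → ℝ≥0∞}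
    (hκ : Measurable κ) (h₁ : Measurable r₁) (h₂ : Measurable r₂)
    (hfst : ∀ x, ∫⁻ y, κ (x, y) ∂Q + r₁ x = 1) (hsnd : ∀ y, ∫⁻ x, κ (x, y) ∂P + r₂ y = 1)
    {c : ℝ≥0∞} (hc : ∀ z, κ z ≠ 0 → ENNReal.ofReal (‖z.1 - z.2‖ ^ 2 / 2) ≤ c) :
    wassersteinSq P Q ≤ c + (∫⁻ x, ENNReal.ofReal (‖x‖ ^ 2) * r₁ x ∂P
      + ∫⁻ y, ENNReal.ofReal (‖y‖ ^ 2) * r₂ y ∂Q) := by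
  set s := ∫⁻ x, r₁ x ∂P with hs
  set m := ∫⁻ x, ∫⁻ y, κ (x, y) ∂Q ∂P with hm
  have hκx : Measurable fun x => ∫⁻ y, κ (x, y) ∂Q := hκ.lintegral_prod_right'
  have hκy : Measurable fun y => ∫⁻ x, κ (x, y) ∂P := hκ.lintegral_prod_left'
  have hms : m + s = 1 := by
    rw [hm, hs, ← lintegral_add_left hκx]
    simp [hfst]
  have hms' : m + ∫⁻ y, r₂ y ∂Q = 1 := by
    rw [hm, lintegral_lintegral_swap (f := fun x y => κ (x, y)) hκ.aemeasurable,
      ← lintegral_add_left hκy]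
    simp [hsnd]
  have hm1 : m ≤ 1 := hms ▸ le_self_add
  have hs' : ∫⁻ y, r₂ y ∂Q = s :=
    (ENNReal.add_right_inj (ne_top_of_le_ne_top ENNReal.one_ne_top hm1)).1 (hms'.trans hms.symm)
  have hs1 : s ≤ 1 := hms ▸ le_add_self
  have hs_fin : s ≠ ∞ := ne_top_of_le_ne_top ENNReal.one_ne_top hs1
  -- The factor s·s⁻¹ is harmless even when s = 0, since the remainder then vanishes almost
  -- everywhere.
  have hr : ∀ {ρ : Measure (RSpace k)} {r : RSpace k → ℝ≥0∞}, Measurable r → ∫⁻ x, r x ∂ρ = s →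
      ∀ᵐ x ∂ρ, r x * (s * s⁻¹) = r x := by
    intro ρ r hr hrs
    rcases eq_or_ne s 0 with h0 | h0
    · rw [h0, lintegral_eq_zero_iff hr] at hrs
      filter_upwards [hrs] with x hx
      rw [hx]; simp
    · exact ae_of_all _ fun x => by rw [ENNReal.mul_inv_cancel h0 hs_fin, mul_one]
  -- Relative to the product measure, the density of the full coupling is κ plus the normalized
  -- product of the two remainders, which have the same mass s.
  let h : RSpace k × RSpace k → ℝ≥0∞ := fun z => κ z + r₁ z.1 * r₂ z.2 * s⁻¹
  have hh : Measurable h := by fun_prop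
  have hmem : (P.prod Q).withDensity h ∈ couplings P Q := by
    constructor
    · rw [map_fst_withDensity_prod P Q hh]
      conv_rhs => rw [← withDensity_one (μ := P)]
      refine withDensity_congr_ae ?_
      filter_upwards [hr h₁ hs.symm] with x hx
      have e : ∀ y, h (x, y) = κ (x, y) + r₁ x * s⁻¹ * r₂ y := fun y => by simp only [h]; ring
      simp_rw [e]
      rw [lintegral_add_left (by fun_prop), lintegral_const_mul _ h₂, hs', Pi.one_apply,
        ← hfst x, mul_assoc, mul_comm s⁻¹, hx]
    · rw [map_snd_withDensity_prod P Q hh]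
      conv_rhs => rw [← withDensity_one (μ := Q)]
      refine withDensity_congr_ae ?_
      filter_upwards [hr h₂ hs'] with y hy
      have e : ∀ x, h (x, y) = κ (x, y) + r₂ y * s⁻¹ * r₁ x := fun x => by simp only [h]; ring
      simp_rw [e]
      rw [lintegral_add_left (by fun_prop), lintegral_const_mul _ h₁, ← hs, Pi.one_apply,
        ← hsnd y, mul_assoc, mul_comm s⁻¹, hy]
  refine (iInf₂_le _ hmem).trans ?_
  rw [lintegral_withDensity_eq_lintegral_mul _ hh (by fun_prop)]
  set N : RSpace k → ℝ≥0∞ := fun x => ENNReal.ofReal (‖x‖ ^ 2) with hN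
  have hNm : Measurable N := by fun_prop
  have hpt : ∀ z : RSpace k × RSpace k,
      (h * fun z : RSpace k × RSpace k => ENNReal.ofReal (‖z.1 - z.2‖ ^ 2 / 2)) z
      ≤ c * κ z + (N z.1 * r₁ z.1 * (r₂ z.2 * s⁻¹) + r₁ z.1 * s⁻¹ * (N z.2 * r₂ z.2)) := by
    intro z
    have hA : κ z * ENNReal.ofReal (‖z.1 - z.2‖ ^ 2 / 2) ≤ c * κ z := by
      rcases eq_or_ne (κ z) 0 with h0 | h0
      · simp [h0]
      · rw [mul_comm]; gcongr; exact hc z h0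
    have hB : ENNReal.ofReal (‖z.1 - z.2‖ ^ 2 / 2) ≤ N z.1 + N z.2 := by
      rw [hN, ← ENNReal.ofReal_add (by positivity) (by positivity)]
      refine ENNReal.ofReal_le_ofReal ?_
      have := norm_sub_le z.1 z.2
      nlinarith [norm_nonneg (z.1 - z.2), sq_nonneg (‖z.1‖ - ‖z.2‖)]
    calc
      (h * fun z : RSpace k × RSpace k => ENNReal.ofReal (‖z.1 - z.2‖ ^ 2 / 2)) z
        = κ z * ENNReal.ofReal (‖z.1 - z.2‖ ^ 2 / 2)
          + r₁ z.1 * r₂ z.2 * s⁻¹ * ENNReal.ofReal (‖z.1 - z.2‖ ^ 2 / 2) := by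
          simp only [Pi.mul_apply, h]; ring
      _ ≤ c * κ z + r₁ z.1 * r₂ z.2 * s⁻¹ * (N z.1 + N z.2) := by gcongr
      _ = _ := by ring
  have hss : s * s⁻¹ ≤ 1 := ENNReal.mul_inv_le_one s
  calc ∫⁻ z,
      (h * fun z : RSpace k × RSpace k => ENNReal.ofReal (‖z.1 - z.2‖ ^ 2 / 2)) z ∂(P.prod Q)
      ≤ ∫⁻ z, (c * κ z + (N z.1 * r₁ z.1 * (r₂ z.2 * s⁻¹)
          + r₁ z.1 * s⁻¹ * (N z.2 * r₂ z.2))) ∂(P.prod Q) := lintegral_mono hpt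
    _ = c * m + ((∫⁻ x, N x * r₁ x ∂P) * (s * s⁻¹) + (s * s⁻¹) * ∫⁻ y, N y * r₂ y ∂Q) := by
        rw [lintegral_add_left (by fun_prop), lintegral_add_left (by fun_prop),
          lintegral_const_mul _ hκ, lintegral_prod _ hκ.aemeasurable,
          lintegral_prod_mul (f := fun x => N x * r₁ x) (g := fun y => r₂ y * s⁻¹)
            (by fun_prop) (by fun_prop),
          lintegral_prod_mul (f := fun x => r₁ x * s⁻¹) (g := fun y => N y * r₂ y)
            (by fun_prop) (by fun_prop),
          lintegral_mul_const _ h₂, lintegral_mul_const _ h₁, hs']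
    _ ≤ c * 1 + ((∫⁻ x, N x * r₁ x ∂P) * 1 + 1 * ∫⁻ y, N y * r₂ y ∂Q) := by gcongr
    _ = _ := by rw [mul_one, mul_one, one_mul]

/-- A continuous probability density on `ℝᵏ`, supported in the ball of radius `τ`. -/
noncomputable def mollifier (k : ℕ) (τ : ℝ) (hτ : 0 < τ) (x : RSpace k) : ℝ :=
  (⟨τ / 2, τ, by positivity, by linarith⟩ : ContDiffBump (0 : RSpace k)).normed volume x

section Mollifier

variable {τ : ℝ} (hτ : 0 < τ)

lemma continuous_mollifier : Continuous (mollifier k τ hτ) := ContDiffBump.continuous_normed _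

lemma mollifier_nonneg (x : RSpace k) : 0 ≤ mollifier k τ hτ x := ContDiffBump.nonneg_normed _ _

lemma hasCompactSupport_mollifier : HasCompactSupport (mollifier k τ hτ) :=
  ContDiffBump.hasCompactSupport_normed _

lemma norm_lt_of_mollifier_ne_zero {x : RSpace k} (h : mollifier k τ hτ x ≠ 0) : ‖x‖ < τ := by
  have h1 : x ∈ Function.support (mollifier k τ hτ) := h
  have h2 : Function.support (mollifier k τ hτ) = Metric.ball 0 τ :=
    ContDiffBump.support_normed_eq _
  rw [h2] at h1
  simpa using h1

lemma lintegral_mollifier_sub (x : RSpace k) :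
    ∫⁻ z, ENNReal.ofReal (mollifier k τ hτ (z - x)) = 1 := by
  have hi : Integrable (mollifier k τ hτ) := ContDiffBump.integrable_normed _
  rw [lintegral_sub_right_eq_self (fun z => ENNReal.ofReal (mollifier k τ hτ z)),
    ← ofReal_integral_eq_lintegral_ofReal hi
      (ae_of_all _ (mollifier_nonneg hτ))]
  have : ∫ x, mollifier k τ hτ x = 1 := ContDiffBump.integral_normed _
  rw [this, ENNReal.ofReal_one]

attribute [irreducible] mollifier

/-- The part of `a` that is not below `b`, relative to `a`. -/
noncomputable def excess (a b : ℝ≥0∞) : ℝ≥0∞ := 1 - b / max a b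

lemma excess_le_one (a b : ℝ≥0∞) : excess a b ≤ 1 := tsub_le_self

lemma div_max_le_one (a b : ℝ≥0∞) : b / max a b ≤ 1 :=
  ENNReal.div_le_of_le_mul (by rw [one_mul]; exact le_max_right _ _)

/-- Also valid where both arguments are 0: the quotient is then 0 and the excess 1. -/
lemma div_max_add_excess (a b : ℝ≥0∞) : b / max a b + excess a b = 1 :=
  add_tsub_cancel_of_le (div_max_le_one a b)

lemma tendsto_excess {a : ℝ≥0∞} {b c : ℕ → ℝ≥0∞} (ha : a ≠ 0) (ha' : a ≠ ∞)
    (hb : Tendsto b atTop (𝓝 a)) (hc : Tendsto c atTop (𝓝 a)) :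
    Tendsto (fun n => excess (b n) (c n)) atTop (𝓝 0) := by
  have h1 : Tendsto (fun n => max (b n) (c n)) atTop (𝓝 a) := by simpa using hb.max hc
  have h2 : Tendsto (fun n => c n / max (b n) (c n)) atTop (𝓝 1) := by
    have := ENNReal.Tendsto.div hc (Or.inl ha) h1 (Or.inl ha')
    rwa [ENNReal.div_self ha ha'] at this
  have h3 := ENNReal.Tendsto.sub (tendsto_const_nhds (x := (1 : ℝ≥0∞)) (f := atTop)) h2
    (Or.inl ENNReal.one_ne_top)
  simpa [excess] using h3

/-- The smoothed density of a measure, weighted by `f`. -/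
noncomputable def mollified (P : Measure (RSpace k)) (f : RSpace k → ℝ≥0∞) (z : RSpace k) : ℝ≥0∞ :=
  ∫⁻ x, f x * ENNReal.ofReal (mollifier k τ hτ (z - x)) ∂P

lemma measurable_mollifier_sub :
    Measurable fun p : RSpace k × RSpace k => ENNReal.ofReal (mollifier k τ hτ (p.1 - p.2)) :=
  ((continuous_mollifier hτ).measurable.comp (measurable_fst.sub measurable_snd)).ennreal_ofReal

lemma measurable_mollified (P : Measure (RSpace k)) [SFinite P] {f : RSpace k → ℝ≥0∞}
    (hf : Measurable f) : Measurable (mollified hτ P f) := by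
  have h := measurable_mollifier_sub (k := k) hτ
  have : Measurable fun p : RSpace k × RSpace k =>
    f p.2 * ENNReal.ofReal (mollifier k τ hτ (p.1 - p.2)) := (hf.comp measurable_snd).mul h
  exact this.lintegral_prod_right'

lemma lintegral_mollified_mul (P : Measure (RSpace k)) [SFinite P] {f g : RSpace k → ℝ≥0∞}
    (hf : Measurable f) (hg : Measurable g) :
    ∫⁻ z, mollified hτ P f z * g z
      = ∫⁻ x, f x * (∫⁻ z, ENNReal.ofReal (mollifier k τ hτ (z - x)) * g z) ∂P := by
  have h := measurable_mollifier_sub (k := k) hτ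
  have h1 : ∀ z, mollified hτ P f z * g z
      = ∫⁻ x, f x * ENNReal.ofReal (mollifier k τ hτ (z - x)) * g z ∂P := fun z =>
    (lintegral_mul_const (g z) (hf.mul (h.comp measurable_prodMk_left))).symm
  have h2 : ∀ x, f x * (∫⁻ z, ENNReal.ofReal (mollifier k τ hτ (z - x)) * g z)
      = ∫⁻ z, f x * ENNReal.ofReal (mollifier k τ hτ (z - x)) * g z := fun x => by
    have hm : Measurable fun z => ENNReal.ofReal (mollifier k τ hτ (z - x)) * g z :=
      (h.comp measurable_prodMk_right).mul hg
    rw [← lintegral_const_mul (f x) hm]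
    simp_rw [mul_assoc]
  simp_rw [h1, h2]
  refine lintegral_lintegral_swap (Measurable.aemeasurable ?_)
  exact ((hf.comp measurable_snd).mul h).mul (hg.comp measurable_fst)

lemma lintegral_mollified (P : Measure (RSpace k)) [SFinite P] {f : RSpace k → ℝ≥0∞}
    (hf : Measurable f) : ∫⁻ z, mollified hτ P f z = ∫⁻ x, f x ∂P := by
  have := lintegral_mollified_mul hτ P hf (g := fun _ => 1) measurable_const
  simpa [lintegral_mollifier_sub] using this

/-- Two measures are close in the Wasserstein distance if their mollifications are close. -/
lemma wassersteinSq_le_mollified (P Q : Measure (RSpace k)) [IsProbabilityMeasure P]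
    [IsProbabilityMeasure Q] :
    wassersteinSq P Q ≤ ENNReal.ofReal (2 * τ ^ 2)
      + ((∫⁻ z, mollified hτ P (fun x => ENNReal.ofReal (‖x‖ ^ 2)) z
          * excess (mollified hτ P 1 z) (mollified hτ Q 1 z))
        + ∫⁻ z, mollified hτ Q (fun x => ENNReal.ofReal (‖x‖ ^ 2)) z
          * excess (mollified hτ Q 1 z) (mollified hτ P 1 z)) := by
  have hw := measurable_mollifier_sub (k := k) hτ
  set w : RSpace k × RSpace k → ℝ≥0∞ := fun p => ENNReal.ofReal (mollifier k τ hτ (p.1 - p.2))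
  set a := mollified hτ P 1 with ha
  set b := mollified hτ Q 1 with hb
  have hma : Measurable a := measurable_mollified hτ P measurable_const
  have hmb : Measurable b := measurable_mollified hτ Q measurable_const
  have hNm : Measurable fun x : RSpace k => ENNReal.ofReal (‖x‖ ^ 2) := by fun_prop
  have hex : ∀ {f g : RSpace k → ℝ≥0∞}, Measurable f → Measurable g →
      Measurable fun z => excess (f z) (g z) := fun hf hg => by unfold excess; fun_prop
  rw [lintegral_mollified_mul hτ P hNm (hex hma hmb),
    lintegral_mollified_mul hτ Q hNm (hex hmb hma)]
  have hwz : ∀ z, Measurable fun x => w (z, x) := fun z => hw.comp measurable_prodMk_left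
  have hwx : ∀ x, Measurable fun z => w (z, x) := fun x => hw.comp measurable_prodMk_right
  have hκ3 : Measurable fun p : (RSpace k × RSpace k) × RSpace k =>
      w (p.2, p.1.1) * w (p.2, p.1.2) / max (a p.2) (b p.2) := by
    have h1 : Measurable fun p : (RSpace k × RSpace k) × RSpace k => w (p.2, p.1.1) :=
      hw.comp (by fun_prop)
    have h2 : Measurable fun p : (RSpace k × RSpace k) × RSpace k => w (p.2, p.1.2) :=
      hw.comp (by fun_prop)
    fun_prop
  -- integrating out one variable of the partial coupling
  have hmarg : ∀ (ρ : Measure (RSpace k)) [IsProbabilityMeasure ρ] (x : RSpace k),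
      ∫⁻ y, (∫⁻ z, w (z, x) * w (z, y) / max (a z) (b z)) ∂ρ
        = ∫⁻ z, w (z, x) * (mollified hτ ρ 1 z / max (a z) (b z)) := by
    intro ρ _ x
    rw [lintegral_lintegral_swap]
    · refine lintegral_congr fun z => ?_
      have e : ∀ y, w (z, x) * w (z, y) / max (a z) (b z)
          = w (z, x) * (max (a z) (b z))⁻¹ * w (z, y) := fun y => by
        rw [div_eq_mul_inv]; ring
      simp_rw [e]
      rw [lintegral_const_mul _ (hwz z), mollified, div_eq_mul_inv]
      simp only [Pi.one_apply, one_mul]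
      rw [mul_assoc, mul_comm (max (a z) (b z))⁻¹]
    · have h1 : Measurable fun p : RSpace k × RSpace k => w (p.2, x) := hw.comp (by fun_prop)
      have h2 : Measurable fun p : RSpace k × RSpace k => w (p.2, p.1) := hw.comp (by fun_prop)
      exact Measurable.aemeasurable (by fun_prop)
  -- Mass at x and y is paired through a common point z within τ of both. Division by the larger
  -- mollified density keeps both marginals below P and Q, and the deficits are averages of
  -- `excess`. Paired points are less than 2τ apart, so their cost is at most (2τ)²/2.
  refine wassersteinSq_le_of_partial_coupling
    (κ := fun p => ∫⁻ z, w (z, p.1) * w (z, p.2) / max (a z) (b z)) hκ3.lintegral_prod_right'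
    ?_ ?_ ?_ ?_ ?_
  · exact (Measurable.mul hw ((hex hma hmb).comp measurable_fst)).lintegral_prod_left'
  · exact (Measurable.mul hw ((hex hmb hma).comp measurable_fst)).lintegral_prod_left'
  · intro x
    simp only
    have hm : Measurable fun z => w (z, x) * (mollified hτ Q 1 z / max (a z) (b z)) :=
      (hwx x).mul (hmb.div (hma.max hmb))
    rw [hmarg Q x, ← lintegral_add_left hm]
    refine (lintegral_congr fun z => ?_).trans (lintegral_mollifier_sub hτ x)
    change w (z, x) * (b z / max (a z) (b z)) + w (z, x) * excess (a z) (b z) = w (z, x)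
    rw [← mul_add, div_max_add_excess, mul_one]
  · intro y
    simp only
    simp_rw [mul_comm (w (_, _)) (w (_, y))]
    have hm : Measurable fun z => w (z, y) * (mollified hτ P 1 z / max (a z) (b z)) :=
      (hwx y).mul (hma.div (hma.max hmb))
    rw [hmarg P y, ← lintegral_add_left hm]
    refine (lintegral_congr fun z => ?_).trans (lintegral_mollifier_sub hτ y)
    change w (z, y) * (a z / max (a z) (b z)) + w (z, y) * excess (b z) (a z) = w (z, y)
    rw [← mul_add, max_comm, div_max_add_excess, mul_one]
  · rintro ⟨x, y⟩ hne
    have : ∃ z, w (z, x) * w (z, y) / max (a z) (b z) ≠ 0 := by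
      by_contra! h
      exact hne (by simp [h])
    obtain ⟨z, hz⟩ := this
    have h1 : w (z, x) ≠ 0 := fun h => hz (by simp [h])
    have h2 : w (z, y) ≠ 0 := fun h => hz (by simp [h])
    have h1' := norm_lt_of_mollifier_ne_zero hτ (k := k) (x := z - x) (fun h => h1 (by simp [w, h]))
    have h2' := norm_lt_of_mollifier_ne_zero hτ (k := k) (x := z - y) (fun h => h2 (by simp [w, h]))
    refine ENNReal.ofReal_le_ofReal ?_
    have h3 : ‖x - y‖ ≤ ‖z - x‖ + ‖z - y‖ := by
      have := norm_sub_le (z - y) (z - x)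
      rw [sub_sub_sub_cancel_left] at this
      linarith
    simp only at h3 h1' h2' ⊢
    nlinarith [norm_nonneg (x - y)]

end Mollifier

end WeakToWasserstein

/-! ### Compactness and completeness of 𝒫₂ -/

section Compactness

variable {k : ℕ}

/-- Weak convergence of a sequence in `𝒫₂(ℝᵏ)`. -/
def WeakTendsto (ν : ℕ → P2 k) (μ : P2 k) : Prop :=
  ∀ f : RSpace k → ℝ, Continuous f → (∃ B, ∀ x, |f x| ≤ B) →
    Tendsto (fun n => ∫ x, f x ∂(ν n).toMeasure) atTop (𝓝 (∫ x, f x ∂μ.toMeasure))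

variable {τ : ℝ} (hτ : 0 < τ)

lemma continuous_mul_mollifier {q : RSpace k → ℝ} (hq : Continuous q) (z : RSpace k) :
    Continuous fun x => q x * mollifier k τ hτ (z - x) :=
  hq.mul ((continuous_mollifier hτ).comp (continuous_const.sub continuous_id))

lemma exists_bound_mul_mollifier {q : RSpace k → ℝ} (hq : Continuous q) (z : RSpace k) :
    ∃ B, ∀ x, |q x * mollifier k τ hτ (z - x)| ≤ B := by
  have hcs : HasCompactSupport fun x => mollifier k τ hτ (z - x) :=
    (hasCompactSupport_mollifier hτ).comp_homeomorph (Homeomorph.subLeft z)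
  exact (continuous_mul_mollifier hτ hq z).bounded_above_of_compact_support hcs.mul_left

lemma mollified_ofReal_eq {q : RSpace k → ℝ} (hq : Continuous q) (hq0 : ∀ x, 0 ≤ q x)
    (P : Measure (RSpace k)) [IsProbabilityMeasure P] (z : RSpace k) :
    mollified hτ P (fun x => ENNReal.ofReal (q x)) z
      = ENNReal.ofReal (∫ x, q x * mollifier k τ hτ (z - x) ∂P) := by
  obtain ⟨B, hB⟩ := exists_bound_mul_mollifier hτ hq z
  rw [ofReal_integral_eq_lintegral_ofReal ((integrable_const B).mono'
    (continuous_mul_mollifier hτ hq z).aestronglyMeasurable (ae_of_all _ hB))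
    (ae_of_all _ fun x => mul_nonneg (hq0 x) (mollifier_nonneg hτ _))]
  simp_rw [ENNReal.ofReal_mul (hq0 _)]
  rfl

lemma tendsto_mollified {q : RSpace k → ℝ} (hq : Continuous q) (hq0 : ∀ x, 0 ≤ q x)
    {ν : ℕ → P2 k} {μ : P2 k} (h : WeakTendsto ν μ) (z : RSpace k) :
    Tendsto (fun n => mollified hτ (ν n).toMeasure (fun x => ENNReal.ofReal (q x)) z) atTop
      (𝓝 (mollified hτ μ.toMeasure (fun x => ENNReal.ofReal (q x)) z)) := by
  simp_rw [mollified_ofReal_eq hτ hq hq0]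
  exact ENNReal.tendsto_ofReal
    (h _ (continuous_mul_mollifier hτ hq z) (exists_bound_mul_mollifier hτ hq z))

/-- Where the limiting density a is nonzero, the excess tends to 0. Where it is 0, the excess is
merely at most 1, but the weight tends to 0. -/
lemma tendsto_mul_excess {α A b c : ℕ → ℝ≥0∞} {a A₀ : ℝ≥0∞} {K : ℝ≥0∞} (hK : K ≠ ∞)
    (ha : a ≠ ∞) (hA₀ : A₀ ≠ ∞) (hα : ∀ n, α n ≤ K * A n) (hzero : a = 0 → A₀ = 0)
    (hA : Tendsto A atTop (𝓝 A₀)) (hb : Tendsto b atTop (𝓝 a)) (hc : Tendsto c atTop (𝓝 a)) :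
    Tendsto (fun n => α n * excess (b n) (c n)) atTop (𝓝 0) := by
  have hKA : Tendsto (fun n => K * A n) atTop (𝓝 (K * A₀)) :=
    ENNReal.Tendsto.const_mul hA (Or.inr hK)
  rcases eq_or_ne a 0 with h0 | h0
  · rw [hzero h0, mul_zero] at hKA
    exact tendsto_of_tendsto_of_tendsto_of_le_of_le tendsto_const_nhds hKA (fun _ => zero_le)
      fun n => (mul_le_of_le_one_right' (excess_le_one _ _)).trans (hα n)
  · have h1 := ENNReal.Tendsto.mul hKA (Or.inr ENNReal.zero_ne_top) (tendsto_excess h0 ha hb hc)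
      (Or.inr (ENNReal.mul_ne_top hK hA₀))
    rw [mul_zero] at h1
    exact tendsto_of_tendsto_of_tendsto_of_le_of_le tendsto_const_nhds h1 (fun _ => zero_le)
      fun n => mul_le_mul_left (hα n) _

/-- Weak convergence and convergence of a quadratic moment imply convergence in the Wasserstein
distance. -/
theorem tendsto_nhdsW2_of_weakTendsto {q : RSpace k → ℝ} (hq : Continuous q) (hq0 : ∀ x, 0 ≤ q x)
    {K : ℝ} (hK : ∀ x, ‖x‖ ^ 2 ≤ K * q x) (hqi : ∀ ρ : P2 k, Integrable q ρ.toMeasure)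
    {ν : ℕ → P2 k} {μ : P2 k} (h : WeakTendsto ν μ)
    (hint : Tendsto (fun n => ∫ x, q x ∂(ν n).toMeasure) atTop (𝓝 (∫ x, q x ∂μ.toMeasure))) :
    Tendsto ν atTop μ.nhdsW2 := by
  apply tendsto_nhdsW2_of_wassersteinSq
  set N : RSpace k → ℝ≥0∞ := fun x => ENNReal.ofReal (‖x‖ ^ 2) with hN
  set Q : RSpace k → ℝ≥0∞ := fun x => ENNReal.ofReal (q x) with hQ
  have hNm : Measurable N := by fun_prop
  have hQm : Measurable Q := hq.measurable.ennreal_ofReal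
  have hlint : ∀ ρ : P2 k, ∫⁻ x, Q x ∂ρ.toMeasure = ENNReal.ofReal (∫ x, q x ∂ρ.toMeasure) :=
    fun ρ => (ofReal_integral_eq_lintegral_ofReal (hqi ρ) (ae_of_all _ hq0)).symm
  have hone : (1 : RSpace k → ℝ≥0∞) = fun _ => ENNReal.ofReal 1 := by
    funext; simp
  -- For fixed τ, both integrands tend to 0 pointwise and are dominated by K times the mollification
  -- of q. Its integral is K times the quadratic moment, which converges by hypothesis.
  have hmol : ∀ {τ : ℝ} (hτ : 0 < τ), Tendsto (fun n =>
      (∫⁻ z, mollified hτ μ.toMeasure N z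
        * excess (mollified hτ μ.toMeasure 1 z) (mollified hτ (ν n).toMeasure 1 z))
      + ∫⁻ z, mollified hτ (ν n).toMeasure N z
        * excess (mollified hτ (ν n).toMeasure 1 z) (mollified hτ μ.toMeasure 1 z))
      atTop (𝓝 0) := by
    intro τ hτ
    have hm1 : ∀ ρ : P2 k, Measurable (mollified hτ ρ.toMeasure 1) := fun ρ =>
      measurable_mollified hτ _ measurable_const
    have hmQ : ∀ ρ : P2 k, Measurable (mollified hτ ρ.toMeasure Q) := fun ρ =>
      measurable_mollified hτ _ hQm
    have hmN : ∀ ρ : P2 k, Measurable (mollified hτ ρ.toMeasure N) := fun ρ =>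
      measurable_mollified hτ _ hNm
    have hNQ : ∀ (ρ : P2 k) z, mollified hτ ρ.toMeasure N z
        ≤ ENNReal.ofReal K * mollified hτ ρ.toMeasure Q z := fun ρ z => by
      rw [mollified, mollified, ← lintegral_const_mul' _ _ ENNReal.ofReal_ne_top]
      refine lintegral_mono fun x => ?_
      rw [← mul_assoc]
      gcongr
      rw [hN, hQ, ← ENNReal.ofReal_mul' (hq0 x)]
      exact ENNReal.ofReal_le_ofReal (hK x)
    have hconv1 : ∀ z, Tendsto (fun n => mollified hτ (ν n).toMeasure 1 z) atTop
        (𝓝 (mollified hτ μ.toMeasure 1 z)) := fun z => by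
      simp_rw [hone]
      exact tendsto_mollified hτ continuous_const (fun _ => zero_le_one) h z
    have hconvQ := tendsto_mollified hτ hq hq0 h
    have hfin1 : ∀ z, mollified hτ μ.toMeasure 1 z ≠ ∞ := fun z => by
      rw [hone, mollified_ofReal_eq hτ continuous_const fun _ => zero_le_one]
      exact ENNReal.ofReal_ne_top
    have hfinQ : ∀ z, mollified hτ μ.toMeasure Q z ≠ ∞ := fun z => by
      rw [mollified_ofReal_eq hτ hq hq0]
      exact ENNReal.ofReal_ne_top
    have hzero : ∀ z, mollified hτ μ.toMeasure 1 z = 0 → mollified hτ μ.toMeasure Q z = 0 :=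
      fun z hz => by
      have hm : Measurable fun x => ENNReal.ofReal (mollifier k τ hτ (z - x)) :=
        (measurable_mollifier_sub hτ).comp measurable_prodMk_left
      simp only [mollified, Pi.one_apply, one_mul] at hz
      rw [lintegral_eq_zero_iff hm] at hz
      rw [mollified]
      refine lintegral_eq_zero_of_ae_eq_zero ?_
      filter_upwards [hz] with x hx
      rw [hx, Pi.zero_apply, mul_zero]
    have htot : ∀ ρ : P2 k, ∫⁻ z, ENNReal.ofReal K * mollified hτ ρ.toMeasure Q z
        = ENNReal.ofReal K * ENNReal.ofReal (∫ x, q x ∂ρ.toMeasure) := fun ρ => by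
      rw [lintegral_const_mul _ (hmQ ρ), lintegral_mollified hτ _ hQm, hlint]
    have hfin : ∫⁻ z, ENNReal.ofReal K * mollified hτ μ.toMeasure Q z ≠ ∞ := by
      rw [htot]; finiteness
    have hexm : ∀ {f g : RSpace k → ℝ≥0∞}, Measurable f → Measurable g →
        Measurable fun z => excess (f z) (g z) := fun hf hg => by unfold excess; fun_prop
    have t1 := tendsto_lintegral_zero_of_le_of_tendsto (m := (volume : Measure (RSpace k)))
      (a := fun _ z => ENNReal.ofReal K * mollified hτ μ.toMeasure Q z)
      (b := fun n z => mollified hτ μ.toMeasure N z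
        * excess (mollified hτ μ.toMeasure 1 z) (mollified hτ (ν n).toMeasure 1 z))
      (fun n => ((hmQ μ).const_mul _).aemeasurable)
      (fun n => ((hmN μ).mul (hexm (hm1 μ) (hm1 (ν n)))).aemeasurable)
      (fun n => ae_of_all _ fun z =>
        (mul_le_of_le_one_right' (excess_le_one _ _)).trans (hNQ μ z))
      (ae_of_all _ fun z => tendsto_mul_excess (A := fun _ => mollified hτ μ.toMeasure Q z)
        ENNReal.ofReal_ne_top (hfin1 z) (hfinQ z) (fun n => hNQ μ z) (hzero z)
        tendsto_const_nhds tendsto_const_nhds (hconv1 z))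
      (ae_of_all _ fun z => tendsto_const_nhds) tendsto_const_nhds hfin
    have t2 := tendsto_lintegral_zero_of_le_of_tendsto (m := (volume : Measure (RSpace k)))
      (a := fun n z => ENNReal.ofReal K * mollified hτ (ν n).toMeasure Q z)
      (b := fun n z => mollified hτ (ν n).toMeasure N z
        * excess (mollified hτ (ν n).toMeasure 1 z) (mollified hτ μ.toMeasure 1 z))
      (a₀ := fun z => ENNReal.ofReal K * mollified hτ μ.toMeasure Q z)
      (fun n => ((hmQ (ν n)).const_mul _).aemeasurable)
      (fun n => ((hmN (ν n)).mul (hexm (hm1 (ν n)) (hm1 μ))).aemeasurable)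
      (fun n => ae_of_all _ fun z =>
        (mul_le_of_le_one_right' (excess_le_one _ _)).trans (hNQ (ν n) z))
      (ae_of_all _ fun z => tendsto_mul_excess (A := fun n => mollified hτ (ν n).toMeasure Q z)
        ENNReal.ofReal_ne_top (hfin1 z) (hfinQ z) (fun n => hNQ (ν n) z) (hzero z)
        (hconvQ z) (hconv1 z) tendsto_const_nhds)
      (ae_of_all _ fun z => ENNReal.Tendsto.const_mul (hconvQ z) (Or.inr ENNReal.ofReal_ne_top))
      (by
        simp_rw [htot]
        exact ENNReal.Tendsto.const_mul (ENNReal.tendsto_ofReal hint)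
          (Or.inr ENNReal.ofReal_ne_top)) hfin
    simpa using t1.add t2
  rw [ENNReal.tendsto_nhds_zero]
  intro ε hε
  rcases eq_or_ne ε ∞ with rfl | hε'
  · exact Eventually.of_forall fun _ => le_top
  have hε2 : 0 < ε / 2 := ENNReal.half_pos hε.ne'
  have hpos : 0 < (ε / 2).toReal := ENNReal.toReal_pos hε2.ne' (by finiteness)
  -- This radius makes 2τ² equal to ε/2.
  have hτ : 0 < √((ε / 2).toReal / 2) := Real.sqrt_pos.2 (by positivity)
  filter_upwards [ENNReal.tendsto_nhds_zero.1 (hmol hτ) (ε / 2) hε2] with n hn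
  refine (wassersteinSq_le_mollified hτ μ.toMeasure (ν n).toMeasure).trans ?_
  rw [Real.sq_sqrt (by positivity), mul_div_cancel₀ _ (two_ne_zero), ENNReal.ofReal_toReal
    (by finiteness)]
  calc _ ≤ ε / 2 + ε / 2 := by gcongr
    _ = ε := ENNReal.add_halves ε

/-- Sequences with bounded second moments have weakly convergent subsequences. -/
theorem exists_weakTendsto_subseq {ν : ℕ → P2 k} {B : ℝ} (hB : ∀ n, (ν n).secondMoment ≤ B) :
    ∃ (μ : P2 k) (ψ : ℕ → ℕ), StrictMono ψ ∧ WeakTendsto (fun j => ν (ψ j)) μ := by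
  let P : ℕ → ProbabilityMeasure (RSpace k) := fun n => ⟨(ν n).toMeasure, inferInstance⟩
  have hB0 : 0 ≤ B := (ν 0).secondMoment_nonneg.trans (hB 0)
  have hlint : ∀ n, ∫⁻ x, ENNReal.ofReal (‖x‖ ^ 2) ∂(ν n).toMeasure ≤ ENNReal.ofReal B :=
      fun n => by
    rw [← ofReal_integral_eq_lintegral_ofReal (ν n).integrable_sq
      (ae_of_all _ fun _ => by positivity)]
    exact ENNReal.ofReal_le_ofReal (hB n)
  -- Markov's inequality bounds the mass outside radius r by B/r²; Prokhorov's theorem then gives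
  -- the subsequence.
  have htight : IsTightMeasureSet {((ρ : ProbabilityMeasure (RSpace k)) : Measure (RSpace k)) |
      ρ ∈ range P} := by
    apply isTightMeasureSet_of_tendsto_measure_norm_gt
    have hbound : ∀ᶠ r : ℝ in atTop, ⨆ ρ ∈ {((ρ : ProbabilityMeasure (RSpace k)) :
        Measure (RSpace k)) | ρ ∈ range P}, ρ {x | r < ‖x‖} ≤ ENNReal.ofReal (B / r ^ 2) := by
      filter_upwards [eventually_gt_atTop 0] with r hr
      refine iSup₂_le ?_
      rintro _ ⟨_, ⟨n, rfl⟩, rfl⟩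
      have h1 := meas_ge_le_lintegral_div (μ := (ν n).toMeasure)
        (f := fun x => ENNReal.ofReal (‖x‖ ^ 2)) (by fun_prop) (ε := ENNReal.ofReal (r ^ 2))
        (by simpa using hr.ne') ENNReal.ofReal_ne_top
      calc (ν n).toMeasure {x | r < ‖x‖}
          ≤ (ν n).toMeasure {x | ENNReal.ofReal (r ^ 2) ≤ ENNReal.ofReal (‖x‖ ^ 2)} := by
            refine measure_mono fun x hx => ENNReal.ofReal_le_ofReal ?_
            have : r < ‖x‖ := hx
            gcongr
        _ ≤ _ := h1
        _ ≤ ENNReal.ofReal B / ENNReal.ofReal (r ^ 2) := by gcongr; exact hlint n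
        _ = ENNReal.ofReal (B / r ^ 2) := (ENNReal.ofReal_div_of_pos (by positivity)).symm
    have hlim : Tendsto (fun r : ℝ => ENNReal.ofReal (B / r ^ 2)) atTop (𝓝 0) := by
      have : Tendsto (fun r : ℝ => B / r ^ 2) atTop (𝓝 0) :=
        (tendsto_pow_atTop (by norm_num)).const_div_atTop B
      simpa using ENNReal.tendsto_ofReal this
    exact tendsto_of_tendsto_of_tendsto_of_le_of_le' tendsto_const_nhds hlim
      (Eventually.of_forall fun _ => zero_le) hbound
  obtain ⟨ρ, -, ψ, hψ, hlim⟩ := (isCompact_closure_of_isTightMeasureSet htight).tendsto_subseq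
    (x := P) fun n => subset_closure (mem_range_self n)
  -- Lower semicontinuity of the second moment under weak convergence keeps the limit in 𝒫₂.
  have hmom : ∫⁻ x, ENNReal.ofReal (‖x‖ ^ 2) ∂(ρ : Measure (RSpace k)) ≤ ENNReal.ofReal B := by
    refine (lintegral_le_liminf_lintegral_of_forall_isOpen_measure_le_liminf_measure
      (μs := fun j => (P (ψ j) : Measure (RSpace k))) (f := fun x => ‖x‖ ^ 2)
      (by fun_prop) (fun _ => by positivity)
      fun G hG => ProbabilityMeasure.le_liminf_measure_open_of_tendsto hlim hG).trans ?_
    refine (liminf_le_liminf (Eventually.of_forall fun j => hlint (ψ j))).trans ?_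
    simp
  let μ : P2 k := ⟨ρ, inferInstance, by
    refine ⟨Continuous.aestronglyMeasurable (by fun_prop), ?_⟩
    rw [hasFiniteIntegral_iff_ofReal (ae_of_all _ fun _ => by positivity)]
    exact hmom.trans_lt ENNReal.ofReal_lt_top⟩
  refine ⟨μ, ψ, hψ, fun f hf ⟨C, hC⟩ => ?_⟩
  exact ProbabilityMeasure.tendsto_iff_forall_integral_tendsto.1 hlim
    (BoundedContinuousFunction.ofNormedAddCommGroup f hf C hC)

lemma tendsto_cdf_slice_of_weakTendsto {σ : ℝ} (hσ : 0 < σ) {ν : ℕ → P2 k} {μ : P2 k}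
    (h : WeakTendsto ν μ) (θ : USphere k) (y : ℝ) :
    Tendsto (fun n => cdf (slice σ (ν n) θ) y) atTop (𝓝 (cdf (slice σ μ θ) y)) := by
  simp_rw [cdf_slice_id]
  have hc := (hasRegularCdf_gauss hσ).cont
  exact h _ (by fun_prop) ⟨1, fun x => norm_cdf_le_one _ _⟩

/-- Completeness of `𝒫₂(ℝᵏ)` for the regularized sliced Wasserstein distance, together with the
fact that the limit is also a limit in the Wasserstein distance. -/
theorem exists_tendsto_of_cauchy (hk : 1 ≤ k) {σ : ℝ} (hσ : 0 < σ) {ν : ℕ → P2 k} {ε : ℕ → ℝ}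
    (hε : Tendsto ε atTop (𝓝 0)) (h : ∀ n m, n ≤ m → SW2reg σ (ν m) (ν n) ^ 2 ≤ ε n) :
    ∃ (μ : P2 k) (ψ : ℕ → ℕ), StrictMono ψ ∧ Tendsto (fun j => ν (ψ j)) atTop μ.nhdsW2 ∧
      Tendsto (fun n => embedLp hσ (ν n)) atTop (𝓝 (embedLp hσ μ)) := by
  have hdist : ∀ n m, n ≤ m → ‖embedLp hσ (ν m) - embedLp hσ (ν n)‖ ^ 2 ≤ 2 * ε n :=
    fun n m hnm => by
    have := h n m hnm
    rw [SW2reg_sq_eq_norm hσ] at this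
    linarith
  obtain ⟨K, hK0, hK⟩ := exists_secondMoment_le_norm_embedLp hk
  obtain ⟨μ, ψ, hψ, hweak⟩ := exists_weakTendsto_subseq (ν := ν)
    (B := K * (2 * ‖embedLp hσ (ν 0)‖ ^ 2 + 4 * ε 0)) fun n => by
      refine (hK hσ (ν n)).trans ?_
      gcongr
      have h1 := hdist 0 n (Nat.zero_le n)
      have h2 : ‖embedLp hσ (ν n)‖ ≤ ‖embedLp hσ (ν 0)‖ + ‖embedLp hσ (ν n) - embedLp hσ (ν 0)‖ :=
        norm_le_norm_add_norm_sub' _ _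
      nlinarith [norm_nonneg (embedLp hσ (ν n)), sq_nonneg
        (‖embedLp hσ (ν 0)‖ - ‖embedLp hσ (ν n) - embedLp hσ (ν 0)‖)]
  have hpt : ∀ p, Tendsto (fun j => embed σ (ν (ψ j)) p) atTop (𝓝 (embed σ μ p)) := fun p =>
    tendsto_transport (a := fun _ => gauss σ) (hasRegularCdf_gauss hσ)
      (hasRegularCdf_slice hσ μ p.1) (fun _ => hasRegularCdf_gauss hσ)
      (fun j => hasRegularCdf_slice hσ (ν (ψ j)) p.1) (fun _ => tendsto_const_nhds)
      (tendsto_cdf_slice_of_weakTendsto hσ hweak p.1) tendsto_const_nhds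
  have hnorm : ∀ ρ₁ ρ₂ : P2 k, ENNReal.ofReal (‖embedLp hσ ρ₁ - embedLp hσ ρ₂‖ ^ 2)
      = ∫⁻ p, ENNReal.ofReal ((embed σ ρ₁ p - embed σ ρ₂ p) ^ 2) ∂(baseMeasure k σ) :=
    fun ρ₁ ρ₂ => by
    have hi : Integrable (fun p => (embed σ ρ₁ p - embed σ ρ₂ p) ^ 2) (baseMeasure k σ) :=
      ((memLp_embed hσ ρ₁).sub (memLp_embed hσ ρ₂)).integrable_sq
    rw [embedLp, embedLp, ← MemLp.toLp_sub, norm_toLp_sq,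
      ← ofReal_integral_eq_lintegral_ofReal hi (ae_of_all _ fun _ => sq_nonneg _)]
    rfl
  -- Letting the later index go to infinity along the subsequence, Fatou's lemma gives the estimate
  -- for every n, so the full sequence of images converges.
  have hlim : ∀ n, ‖embedLp hσ (ν n) - embedLp hσ μ‖ ^ 2 ≤ 2 * ε n := by
    intro n
    have h0 : 0 ≤ 2 * ε n := (sq_nonneg _).trans (hdist n n le_rfl)
    rw [← ENNReal.ofReal_le_ofReal_iff h0, hnorm]
    have hliminf : ∀ p, ENNReal.ofReal ((embed σ (ν n) p - embed σ μ p) ^ 2)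
        = liminf (fun j => ENNReal.ofReal ((embed σ (ν n) p - embed σ (ν (ψ j)) p) ^ 2)) atTop :=
      fun p => ((ENNReal.tendsto_ofReal ((tendsto_const_nhds.sub (hpt p)).pow 2)).liminf_eq).symm
    simp_rw [hliminf]
    refine (lintegral_liminf_le fun j => ?_).trans ?_
    · exact (((continuous_embed hσ _).sub (continuous_embed hσ _)).pow 2).measurable.ennreal_ofReal
    · simp_rw [← hnorm]
      refine (liminf_le_liminf (v := fun _ => ENNReal.ofReal (2 * ε n)) ?_).trans (by simp)
      filter_upwards [eventually_ge_atTop n] with j hj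
      rw [norm_sub_rev]
      exact ENNReal.ofReal_le_ofReal (hdist n (ψ j) (hj.trans (hψ.id_le j)))
  have hconv : Tendsto (fun n => embedLp hσ (ν n)) atTop (𝓝 (embedLp hσ μ)) := by
    rw [tendsto_iff_norm_sub_tendsto_zero]
    have h1 : Tendsto (fun n => √(2 * ε n)) atTop (𝓝 0) := by
      have := (Real.continuous_sqrt.tendsto _).comp (hε.const_mul 2)
      rw [mul_zero, Real.sqrt_zero] at this
      exact this
    exact squeeze_zero (fun _ => norm_nonneg _) (fun n => Real.le_sqrt_of_sq_le (hlim n)) h1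
  refine ⟨μ, ψ, hψ, ?_, hconv⟩
  obtain ⟨c, hc, hcq⟩ := exists_mul_le_meanSq hk
  refine tendsto_nhdsW2_of_weakTendsto continuous_meanSq meanSq_nonneg (K := c⁻¹)
    (fun x => by rw [le_inv_mul_iff₀ hc]; exact hcq x) (integrable_meanSq hk) hweak ?_
  -- The squared norm minus σ² is ∫ `meanSq`. Norm convergence in L² is therefore the moment
  -- convergence needed beyond weak convergence.
  have h1 := ((hconv.comp hψ.tendsto_atTop).norm.pow 2).sub_const (σ ^ 2)
  simp only [Function.comp_apply, norm_embedLp_sq hk, add_sub_cancel_right] at h1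
  exact h1

end Compactness

/-! ### The dyadic sum and the directional average as one integral -/

section Index

/-- The measure with mass `2⁻ⁿ` at `n`. -/
noncomputable def dyadicMeasure : Measure ℕ :=
  Measure.sum fun n => ENNReal.ofReal (1 / 2 ^ n) • Measure.dirac n

lemma hasSum_dyadic : HasSum (fun n : ℕ => (1 : ℝ) / 2 ^ n) 2 := by
  simpa [one_div, inv_pow] using hasSum_geometric_two

lemma lintegral_dyadicMeasure (f : ℕ → ℝ≥0∞) :
    ∫⁻ n, f n ∂dyadicMeasure = ∑' n, ENNReal.ofReal (1 / 2 ^ n) * f n := by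
  rw [dyadicMeasure, lintegral_sum_measure]
  simp [lintegral_smul_measure]

lemma dyadicMeasure_univ : dyadicMeasure univ = 2 := by
  rw [← lintegral_one, lintegral_dyadicMeasure]
  simp only [mul_one]
  rw [← ENNReal.ofReal_tsum_of_nonneg (fun n => by positivity) hasSum_dyadic.summable,
    hasSum_dyadic.tsum_eq]
  simp

instance : IsFiniteMeasure dyadicMeasure := ⟨by rw [dyadicMeasure_univ]; simp⟩

variable {k : ℕ}

/-- The index set: a summand of the perturbation and a direction. -/
abbrev Idx (k : ℕ) : Type := ℕ × USphere k

/-- The measure on the index set. -/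
noncomputable def idxMeasure (k : ℕ) : Measure (Idx k) := dyadicMeasure.prod (sphereMeasure k)

instance : IsFiniteMeasure (idxMeasure k) := by unfold idxMeasure; infer_instance

lemma idxMeasure_univ (hk : 1 ≤ k) : idxMeasure k univ = 2 := by
  have := isProbabilityMeasure_sphereMeasure hk
  rw [idxMeasure, ← univ_prod_univ, Measure.prod_prod, dyadicMeasure_univ]
  simp

/-- The index measure with an independent normal random variable. -/
noncomputable def noiseMeasure (k : ℕ) (σ : ℝ) : Measure (Idx k × ℝ) :=
  (idxMeasure k).prod (gauss σ)

instance (σ : ℝ) : IsFiniteMeasure (noiseMeasure k σ) := by unfold noiseMeasure; infer_instance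

lemma noiseMeasure_real_univ (hk : 1 ≤ k) (σ : ℝ) : (noiseMeasure k σ).real univ = 2 := by
  rw [measureReal_def, noiseMeasure, ← univ_prod_univ, Measure.prod_prod, idxMeasure_univ hk]
  simp

/-- The optimal maps from the slices of `μ` to those of the measures `ν n`. -/
noncomputable def rearr (σ : ℝ) (ν : ℕ → P2 k) (μ : P2 k) (p : Idx k × ℝ) : ℝ :=
  transport (slice σ μ p.1.2) (slice σ (ν p.1.1) p.1.2) p.2

/-- The noise shifted by the projection of `x`. -/
noncomputable def shift (x : RSpace k) (p : Idx k × ℝ) : Idx k × ℝ :=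
  (p.1, inner ℝ x (p.1.2 : RSpace k) + p.2)

lemma continuous_shift : Continuous fun q : RSpace k × (Idx k × ℝ) => shift q.1 q.2 := by
  unfold shift; fun_prop

lemma continuous_cdf_slice_idx {σ : ℝ} (hσ : 0 < σ) (ν : ℕ → P2 k) (c : ℝ) :
    Continuous fun i : Idx k => cdf (slice σ (ν i.1) i.2) c :=
  continuous_prod_of_discrete_left.2 fun n => continuous_cdf_slice hσ (ν n) c

lemma continuous_rearr {σ : ℝ} (hσ : 0 < σ) (ν : ℕ → P2 k) (μ : P2 k) :
    Continuous (rearr σ ν μ) := by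
  rw [continuous_iff_continuousAt]
  intro p
  exact tendsto_transport (a := fun q : Idx k × ℝ => slice σ μ q.1.2)
    (b := fun q : Idx k × ℝ => slice σ (ν q.1.1) q.1.2)
    (hasRegularCdf_slice hσ μ p.1.2) (hasRegularCdf_slice hσ (ν p.1.1) p.1.2)
    (fun q => hasRegularCdf_slice hσ μ q.1.2) (fun q => hasRegularCdf_slice hσ (ν q.1.1) q.1.2)
    (fun c => ((continuous_cdf_slice hσ μ c).comp (continuous_snd.comp continuous_fst)).tendsto p)
    (fun c => ((continuous_cdf_slice_idx hσ ν c).comp continuous_fst).tendsto p)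
    (continuous_snd.tendsto p)

variable {Ω : Type*} [MeasurableSpace Ω] {P : Measure Ω} [IsProbabilityMeasure P]

lemma lintegral_prod_noiseMeasure (σ : ℝ) {f : Ω × (Idx k × ℝ) → ℝ≥0∞} (hf : Measurable f) :
    ∫⁻ q, f q ∂(P.prod (noiseMeasure k σ))
      = ∫⁻ i, ∫⁻ q, f (q.1, (i, q.2)) ∂(P.prod (gauss σ)) ∂(idxMeasure k) := by
  rw [lintegral_prod _ hf.aemeasurable]
  have h1 : ∀ ω, ∫⁻ p, f (ω, p) ∂(noiseMeasure k σ)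
      = ∫⁻ i, ∫⁻ z, f (ω, (i, z)) ∂(gauss σ) ∂(idxMeasure k) := fun ω =>
    lintegral_prod _ (hf.comp measurable_prodMk_left).aemeasurable
  have hm : Measurable fun q : (Ω × Idx k) × ℝ => f (q.1.1, (q.1.2, q.2)) :=
    hf.comp (by fun_prop)
  simp_rw [h1]
  rw [lintegral_lintegral_swap (f := fun ω i => ∫⁻ z, f (ω, (i, z)) ∂(gauss σ))
    hm.lintegral_prod_right'.aemeasurable]
  refine lintegral_congr fun i => ?_
  have hm2 : Measurable fun q : Ω × ℝ => f (q.1, (i, q.2)) := hf.comp (by fun_prop)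
  exact (lintegral_prod _ hm2.aemeasurable).symm

lemma measurable_shift {X : Ω → RSpace k} (hX : Measurable X) :
    Measurable fun q : Ω × (Idx k × ℝ) => shift (X q.1) q.2 :=
  continuous_shift.measurable.comp (hX.comp measurable_fst |>.prodMk measurable_snd)

lemma lintegral_shift {X : Ω → RSpace k} (hX : Measurable X) {μ : P2 k}
    (hμ : P.map X = μ.toMeasure) (σ : ℝ) {f : Idx k × ℝ → ℝ≥0∞} (hf : Measurable f) :
    ∫⁻ q, f (shift (X q.1) q.2) ∂(P.prod (noiseMeasure k σ))
      = ∫⁻ i, ∫⁻ y, f (i, y) ∂(slice σ μ i.2) ∂(idxMeasure k) := by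
  rw [lintegral_prod_noiseMeasure σ (f := fun q => f (shift (X q.1) q.2))
    (hf.comp (measurable_shift hX))]
  refine lintegral_congr fun i => ?_
  rw [lintegral_slice hX hμ σ i.2 (f := fun y => f (i, y)) (hf.comp measurable_prodMk_left)]
  rfl

/-- The targets have the slice laws of the ν n whatever X is. This constancy of their energy later
turns almost everywhere convergence into L² convergence. -/
lemma lintegral_rearr_shift {X : Ω → RSpace k} (hX : Measurable X) {μ : P2 k}
    (hμ : P.map X = μ.toMeasure) {σ : ℝ} (hσ : 0 < σ) (ν : ℕ → P2 k) {f : ℝ → ℝ≥0∞}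
    (hf : Measurable f) :
    ∫⁻ q, f (rearr σ ν μ (shift (X q.1) q.2)) ∂(P.prod (noiseMeasure k σ))
      = ∫⁻ i, ∫⁻ s, f s ∂(slice σ (ν i.1) i.2) ∂(idxMeasure k) := by
  rw [lintegral_shift hX hμ σ (f := fun p => f (rearr σ ν μ p))
    (hf.comp (continuous_rearr hσ ν μ).measurable)]
  refine lintegral_congr fun i => ?_
  exact lintegral_comp_transport (hasRegularCdf_slice hσ μ i.2)
    (hasRegularCdf_slice hσ (ν i.1) i.2) hf

lemma lintegral_sq_slice {σ : ℝ} (μ : P2 k) (θ : USphere k) :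
    ∫⁻ y, ENNReal.ofReal (y ^ 2) ∂(slice σ μ θ) = ENNReal.ofReal (∫ y, y ^ 2 ∂(slice σ μ θ)) :=
  (ofReal_integral_eq_lintegral_ofReal (integrable_sq_slice σ μ θ)
    (ae_of_all _ fun _ => sq_nonneg _)).symm

lemma continuous_integral_sq_slice (σ : ℝ) (μ : P2 k) :
    Continuous fun θ : USphere k => ∫ y, y ^ 2 ∂(slice σ μ θ) := by
  simp_rw [integral_sq_slice]
  refine Continuous.add ?_ continuous_const
  refine continuous_of_dominated (bound := fun x => ‖x‖ ^ 2)
    (fun θ => Continuous.aestronglyMeasurable (by fun_prop)) (fun θ => ae_of_all _ fun x => ?_)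
    μ.integrable_sq (ae_of_all _ fun x => by fun_prop)
  rw [Real.norm_eq_abs, abs_of_nonneg (sq_nonneg _)]
  exact sq_inner_le _ _

lemma lintegral_integral_sq_slice {σ : ℝ} (hσ : 0 < σ) (μ : P2 k) :
    ∫⁻ θ, ENNReal.ofReal (∫ y, y ^ 2 ∂(slice σ μ θ)) ∂(sphereMeasure k)
      = ENNReal.ofReal (‖embedLp hσ μ‖ ^ 2) := by
  rw [← ofReal_integral_eq_lintegral_ofReal, embedLp, norm_toLp_sq,
    integral_eq_lintegral_of_nonneg_ae (ae_of_all _ fun _ => sq_nonneg _)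
      ((continuous_embed hσ μ).pow 2).aestronglyMeasurable, lintegral_sq_embed hσ,
    ENNReal.toReal_ofReal (integral_nonneg fun _ => integral_nonneg fun _ => sq_nonneg _)]
  · exact (continuous_integral_sq_slice σ μ).integrable_of_hasCompactSupport
      (HasCompactSupport.of_compactSpace _)
  · exact ae_of_all _ fun _ => integral_nonneg fun _ => sq_nonneg _

/-- The total energy of the targets `ν n`. -/
lemma lintegral_sq_target_le {σ : ℝ} (hσ : 0 < σ) {ν : ℕ → P2 k} {ρ : ℝ}
    (hν : ∀ n, ‖embedLp hσ (ν n)‖ ≤ ρ) :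
    ∫⁻ i : Idx k, ∫⁻ s, ENNReal.ofReal (s ^ 2) ∂(slice σ (ν i.1) i.2) ∂(idxMeasure k)
      ≤ ENNReal.ofReal (2 * ρ ^ 2) := by
  have hc : Continuous fun i : Idx k => ∫ y, y ^ 2 ∂(slice σ (ν i.1) i.2) :=
    continuous_prod_of_discrete_left.2 fun n => continuous_integral_sq_slice σ (ν n)
  simp_rw [lintegral_sq_slice]
  rw [idxMeasure, lintegral_prod _ hc.measurable.ennreal_ofReal.aemeasurable]
  simp_rw [lintegral_integral_sq_slice hσ]
  calc ∫⁻ n, ENNReal.ofReal (‖embedLp hσ (ν n)‖ ^ 2) ∂dyadicMeasure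
      ≤ ∫⁻ _, ENNReal.ofReal (ρ ^ 2) ∂dyadicMeasure := by
        refine lintegral_mono fun n => ENNReal.ofReal_le_ofReal ?_
        have := hν n
        gcongr
    _ = ENNReal.ofReal (2 * ρ ^ 2) := by
        rw [lintegral_const, dyadicMeasure_univ, ENNReal.ofReal_mul zero_le_two, mul_comm]
        simp

lemma memLp_two_of_lintegral {S : Type*} [MeasurableSpace S] {m : Measure S} {f : S → ℝ}
    (hf : AEStronglyMeasurable f m) (h : ∫⁻ x, ENNReal.ofReal (f x ^ 2) ∂m ≠ ∞) : MemLp f 2 m := by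
  rw [memLp_two_iff_integrable_sq hf]
  refine ⟨hf.pow 2, ?_⟩
  rw [hasFiniteIntegral_iff_ofReal (ae_of_all _ fun _ => sq_nonneg _)]
  exact h.lt_top

lemma memLp_rearr_shift {X : Ω → RSpace k} (hX : Measurable X) {μ : P2 k}
    (hμ : P.map X = μ.toMeasure) {σ : ℝ} (hσ : 0 < σ) {ν : ℕ → P2 k} {ρ : ℝ}
    (hν : ∀ n, ‖embedLp hσ (ν n)‖ ≤ ρ) :
    MemLp (fun q : Ω × (Idx k × ℝ) => rearr σ ν μ (shift (X q.1) q.2)) 2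
      (P.prod (noiseMeasure k σ)) := by
  refine memLp_two_of_lintegral
    ((continuous_rearr hσ ν μ).measurable.comp (measurable_shift hX)).aestronglyMeasurable ?_
  rw [lintegral_rearr_shift hX hμ hσ ν (f := fun s => ENNReal.ofReal (s ^ 2)) (by fun_prop)]
  exact ne_top_of_le_ne_top ENNReal.ofReal_ne_top (lintegral_sq_target_le hσ hν)

lemma integral_sq_rearr_shift_le {X : Ω → RSpace k} (hX : Measurable X) {μ : P2 k}
    (hμ : P.map X = μ.toMeasure) {σ : ℝ} (hσ : 0 < σ) {ν : ℕ → P2 k} {ρ : ℝ}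
    (hν : ∀ n, ‖embedLp hσ (ν n)‖ ≤ ρ) :
    ∫ q : Ω × (Idx k × ℝ), rearr σ ν μ (shift (X q.1) q.2) ^ 2 ∂(P.prod (noiseMeasure k σ))
      ≤ 2 * ρ ^ 2 := by
  have hi := (memLp_rearr_shift hX hμ hσ hν).integrable_sq
  rw [← ENNReal.ofReal_le_ofReal_iff (by positivity), ofReal_integral_eq_lintegral_ofReal hi
    (ae_of_all _ fun _ => sq_nonneg _),
    lintegral_rearr_shift hX hμ hσ ν (f := fun s => ENNReal.ofReal (s ^ 2)) (by fun_prop)]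
  exact lintegral_sq_target_le hσ hν

lemma memLp_noise (σ : ℝ) : MemLp (fun q : Ω × (Idx k × ℝ) => q.2.2) 2
    (P.prod (noiseMeasure k σ)) :=
  ((memLp_gauss σ).comp_snd (idxMeasure k)).comp_snd P

lemma memLp_inner_dir {Ω : Type*} [MeasurableSpace Ω] {P : Measure Ω} [IsFiniteMeasure P]
    {X : Ω → RSpace k} (hX : MemLp X 2 P) (σ : ℝ) :
    MemLp (fun q : Ω × (Idx k × ℝ) => inner ℝ (X q.1) (q.2.1.2 : RSpace k)) 2
      (P.prod (noiseMeasure k σ)) := by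
  have h1 : MemLp (fun q : Ω × (Idx k × ℝ) => X q.1) 2 (P.prod (noiseMeasure k σ)) :=
    hX.comp_fst _
  have hd : Measurable fun q : Ω × (Idx k × ℝ) => (q.2.1.2 : RSpace k) :=
    measurable_subtype_coe.comp (by fun_prop)
  refine h1.of_le (h1.aestronglyMeasurable.inner hd.aestronglyMeasurable) (ae_of_all _ fun q => ?_)
  have h := abs_real_inner_le_norm (X q.1) (q.2.1.2 : RSpace k)
  rwa [norm_usphere, mul_one] at h

lemma memLp_shift {X : Ω → RSpace k} (hX : MemLp X 2 P) (σ : ℝ) :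
    MemLp (fun q : Ω × (Idx k × ℝ) => (shift (X q.1) q.2).2) 2 (P.prod (noiseMeasure k σ)) :=
  (memLp_inner_dir hX σ).add (memLp_noise σ)

lemma memLp_two_of_map_eq {Ω : Type*} [MeasurableSpace Ω] {P : Measure Ω} {X : Ω → RSpace k}
    (hX : Measurable X) {μ : P2 k} (hμ : P.map X = μ.toMeasure) : MemLp X 2 P := by
  rw [memLp_two_iff_integrable_sq_norm hX.aestronglyMeasurable]
  have h := μ.integrable_sq
  rw [← hμ] at h
  exact h.comp_measurable hX

end Index

/-! ### The spatial part of the perturbation -/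

section Potential

variable {k : ℕ} {σ : ℝ}

/-- The spatial part of the perturbation. -/
noncomputable def potential (σ : ℝ) (ν : ℕ → P2 k) (μ : P2 k) : ℝ :=
  ∑' n, 1 / 2 ^ n * SW2reg σ μ (ν n) ^ 2

lemma summable_potential (hσ : 0 < σ) {ν : ℕ → P2 k} {ρ : ℝ}
    (hν : ∀ n, ‖embedLp hσ (ν n)‖ ≤ ρ) (μ : P2 k) :
    Summable fun n => 1 / 2 ^ n * SW2reg σ μ (ν n) ^ 2 := by
  refine Summable.of_nonneg_of_le (fun n => by positivity) (fun n => ?_)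
    (hasSum_dyadic.summable.mul_right ((‖embedLp hσ μ‖ + ρ) ^ 2 / 2))
  rw [SW2reg_sq_eq_norm hσ]
  have h1 : ‖embedLp hσ μ - embedLp hσ (ν n)‖ ≤ ‖embedLp hσ μ‖ + ρ :=
    (norm_sub_le _ _).trans (by gcongr; exact hν n)
  gcongr

lemma continuous_embed_idx (hσ : 0 < σ) (ν : ℕ → P2 k) :
    Continuous fun q : Idx k × ℝ => embed σ (ν q.1.1) (q.1.2, q.2) := by
  have h : Continuous fun q : ℕ × (USphere k × ℝ) => embed σ (ν q.1) q.2 :=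
    continuous_prod_of_discrete_left.2 fun n => continuous_embed hσ (ν n)
  have hp : Continuous fun q : Idx k × ℝ => (q.1.1, (q.1.2, q.2)) := by fun_prop
  have := h.comp hp
  exact this

lemma measurable_wassersteinSq_idx (hσ : 0 < σ) (ν : ℕ → P2 k) (μ : P2 k) :
    Measurable fun i : Idx k => wassersteinSq (slice σ μ i.2) (slice σ (ν i.1) i.2) := by
  have hc : Continuous fun q : Idx k × ℝ =>
      (embed σ μ (q.1.2, q.2) - embed σ (ν q.1.1) (q.1.2, q.2)) ^ 2 / 2 :=
    (((continuous_embed_idx hσ fun _ => μ).sub (continuous_embed_idx hσ ν)).pow 2).div_const 2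
  have h : (fun i : Idx k => wassersteinSq (slice σ μ i.2) (slice σ (ν i.1) i.2))
      = fun i => ∫⁻ z, ENNReal.ofReal
        ((embed σ μ (i.2, z) - embed σ (ν i.1) (i.2, z)) ^ 2 / 2) ∂(gauss σ) :=
    funext fun i => wassersteinSq_slice hσ μ (ν i.1) i.2
  rw [h]
  exact hc.measurable.ennreal_ofReal.lintegral_prod_right'

/-- Tonelli's theorem in extended nonnegative reals; real-valued summability is needed only to pass
from the series to its extended version. -/
lemma ofReal_potential (hσ : 0 < σ) {ν : ℕ → P2 k} {ρ : ℝ}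
    (hν : ∀ n, ‖embedLp hσ (ν n)‖ ≤ ρ) (μ : P2 k) :
    ENNReal.ofReal (potential σ ν μ)
      = ∫⁻ i : Idx k, wassersteinSq (slice σ μ i.2) (slice σ (ν i.1) i.2) ∂(idxMeasure k) := by
  have hm := measurable_wassersteinSq_idx hσ ν μ
  rw [idxMeasure, lintegral_prod _ hm.aemeasurable]
  simp_rw [lintegral_wassersteinSq_slice hσ, ← SW2reg_sq hσ]
  rw [lintegral_dyadicMeasure, potential,
    ENNReal.ofReal_tsum_of_nonneg (fun n => by positivity) (summable_potential hσ hν μ)]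
  simp_rw [ENNReal.ofReal_mul (show (0 : ℝ) ≤ 1 / 2 ^ _ by positivity)]

lemma potential_nonneg (σ : ℝ) (ν : ℕ → P2 k) (μ : P2 k) : 0 ≤ potential σ ν μ :=
  tsum_nonneg fun n => by positivity

variable {Ω : Type*} [MeasurableSpace Ω] {P : Measure Ω} [IsProbabilityMeasure P]

lemma potential_eq_integral (hσ : 0 < σ) {ν : ℕ → P2 k} {ρ : ℝ}
    (hν : ∀ n, ‖embedLp hσ (ν n)‖ ≤ ρ) {X : Ω → RSpace k} (hX : Measurable X) {μ : P2 k}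
    (hμ : P.map X = μ.toMeasure) :
    potential σ ν μ = (∫ q, ((shift (X q.1) q.2).2 - rearr σ ν μ (shift (X q.1) q.2)) ^ 2
      ∂(P.prod (noiseMeasure k σ))) / 2 := by
  have hi : Integrable (fun q : Ω × (Idx k × ℝ) =>
      ((shift (X q.1) q.2).2 - rearr σ ν μ (shift (X q.1) q.2)) ^ 2 / 2)
      (P.prod (noiseMeasure k σ)) :=
    (((memLp_shift (memLp_two_of_map_eq hX hμ) σ).sub
      (memLp_rearr_shift hX hμ hσ hν)).integrable_sq).div_const 2
  have hr := continuous_rearr hσ ν μ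
  have hnn : 0 ≤ ∫ q, ((shift (X q.1) q.2).2 - rearr σ ν μ (shift (X q.1) q.2)) ^ 2 / 2
      ∂(P.prod (noiseMeasure k σ)) := integral_nonneg fun _ => by positivity
  rw [← integral_div, ← ENNReal.ofReal_eq_ofReal_iff (potential_nonneg _ _ _) hnn,
    ofReal_potential hσ hν, ofReal_integral_eq_lintegral_ofReal hi
      (ae_of_all _ fun _ => by positivity),
    lintegral_shift hX hμ σ (f := fun p => ENNReal.ofReal ((p.2 - rearr σ ν μ p) ^ 2 / 2))
      (by fun_prop)]
  refine lintegral_congr fun i => ?_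
  exact wassersteinSq_eq_lintegral_transport (hasRegularCdf_slice hσ μ i.2)
    (hasRegularCdf_slice hσ (ν i.1) i.2) (integrable_sq_slice _ _ _) (integrable_sq_slice _ _ _)

/-- Moving `Y` to the targets of `X` gives an upper bound. -/
lemma potential_le_integral (hσ : 0 < σ) {ν : ℕ → P2 k} {ρ : ℝ}
    (hν : ∀ n, ‖embedLp hσ (ν n)‖ ≤ ρ) {X Y : Ω → RSpace k} (hX : Measurable X)
    (hY : Measurable Y) {μ μ' : P2 k} (hμ : P.map X = μ.toMeasure) (hμ' : P.map Y = μ'.toMeasure) :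
    potential σ ν μ' ≤ (∫ q, ((shift (Y q.1) q.2).2 - rearr σ ν μ (shift (X q.1) q.2)) ^ 2
      ∂(P.prod (noiseMeasure k σ))) / 2 := by
  have hi : Integrable (fun q : Ω × (Idx k × ℝ) =>
      ((shift (Y q.1) q.2).2 - rearr σ ν μ (shift (X q.1) q.2)) ^ 2 / 2)
      (P.prod (noiseMeasure k σ)) :=
    (((memLp_shift (memLp_two_of_map_eq hY hμ') σ).sub
      (memLp_rearr_shift hX hμ hσ hν)).integrable_sq).div_const 2
  have hr := (continuous_rearr hσ ν μ).measurable
  have hsX := measurable_shift (Ω := Ω) hX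
  have hsY := measurable_shift (Ω := Ω) hY
  have hnn : 0 ≤ ∫ q, ((shift (Y q.1) q.2).2 - rearr σ ν μ (shift (X q.1) q.2)) ^ 2 / 2
      ∂(P.prod (noiseMeasure k σ)) := integral_nonneg fun _ => by positivity
  rw [← integral_div, ← ENNReal.ofReal_le_ofReal_iff hnn, ofReal_potential hσ hν,
    ofReal_integral_eq_lintegral_ofReal hi (ae_of_all _ fun _ => by positivity),
    lintegral_prod_noiseMeasure σ (f := fun q => ENNReal.ofReal
      (((shift (Y q.1) q.2).2 - rearr σ ν μ (shift (X q.1) q.2)) ^ 2 / 2)) (by fun_prop)]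
  refine lintegral_mono fun i => ?_
  have hmi : Measurable fun q : Ω × ℝ => (q.1, ((i, q.2) : Idx k × ℝ)) := by fun_prop
  have h1 : slice σ μ' i.2
      = (P.prod (gauss σ)).map fun q => (shift (Y q.1) (i, q.2)).2 := slice_eq_map hY hμ' σ i.2
  -- The targets built from X are paired with Y using the same ω and the same noise: an admissible,
  -- in general not optimal, coupling.
  have h2 : slice σ (ν i.1) i.2
      = (P.prod (gauss σ)).map fun q => rearr σ ν μ (shift (X q.1) (i, q.2)) := by
    have hT := (continuous_transport (hasRegularCdf_slice hσ μ i.2)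
      (hasRegularCdf_slice hσ (ν i.1) i.2)).measurable
    have hf : Measurable fun q : Ω × ℝ => inner ℝ (X q.1) (i.2 : RSpace k) + q.2 := by fun_prop
    conv_lhs => rw [← map_transport (hasRegularCdf_slice hσ μ i.2)
      (hasRegularCdf_slice hσ (ν i.1) i.2)]
    calc (slice σ μ i.2).map (transport (slice σ μ i.2) (slice σ (ν i.1) i.2))
        = ((P.prod (gauss σ)).map fun q => inner ℝ (X q.1) (i.2 : RSpace k) + q.2).map
            (transport (slice σ μ i.2) (slice σ (ν i.1) i.2)) := by rw [← slice_eq_map hX hμ σ i.2]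
      _ = _ := by rw [Measure.map_map hT hf]; rfl
  simp only
  rw [h1, h2]
  refine (wassersteinSq_map_le ((measurable_snd.comp hsY).comp hmi)
    ((hr.comp hsX).comp hmi)).trans_eq ?_
  simp [Real.norm_eq_abs, sq_abs]

end Potential

/-! ### Gaussian integrability and change of density -/

section GaussTail

/-- Since 3/8 < 1/2, a factor exp(−z²/(8σ²)) survives against Lebesgue measure. The value 3/8 is the
one produced by `exp_growth_le`. -/
lemma integrable_exp_sq_gauss {σ : ℝ} (hσ : 0 < σ) :
    Integrable (fun z : ℝ => Real.exp (3 / 8 * z ^ 2 / σ ^ 2)) (gauss σ) := by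
  have h1 : Integrable (fun z : ℝ => Real.exp (-(1 / (8 * σ ^ 2)) * z ^ 2)) :=
    integrable_exp_neg_mul_sq (by positivity)
  rw [gauss, gaussianReal_of_var_ne_zero _ (gauss_var_ne_zero hσ),
    integrable_withDensity_iff_integrable_smul' (measurable_gaussianPDF _ _)
      (ae_of_all _ fun _ => gaussianPDF_lt_top)]
  refine (h1.const_mul (√(2 * Real.pi * σ ^ 2))⁻¹).congr (ae_of_all _ fun z => ?_)
  have h2 : (gaussianPDF 0 (σ ^ 2).toNNReal z).toReal = gaussDensity σ z := toReal_gaussianPDF z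
  simp only
  rw [h2, gaussDensity_eq, smul_eq_mul, mul_assoc (√(2 * Real.pi * σ ^ 2))⁻¹ (Real.exp _),
    ← Real.exp_add]
  congr 2
  field_simp
  ring

/-- The density of a translate of the normal distribution. -/
noncomputable def tilt (σ a z : ℝ) : ℝ := Real.exp ((a * z - a ^ 2 / 2) / σ ^ 2)

lemma tilt_pos (σ a z : ℝ) : 0 < tilt σ a z := Real.exp_pos _

lemma gaussDensity_sub {σ : ℝ} (hσ : 0 < σ) (a z : ℝ) :
    gaussDensity σ (z - a) = gaussDensity σ z * tilt σ a z := by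
  rw [gaussDensity_eq, gaussDensity_eq, tilt, mul_assoc (√(2 * Real.pi * σ ^ 2))⁻¹ (Real.exp _),
    ← Real.exp_add]
  congr 2
  field_simp
  ring

/-- The Cameron–Martin formula on the line: dependence on the shift a leaves f, which need not be
differentiable, and enters the smooth weight `tilt`. -/
lemma integral_gauss_add {E : Type*} [NormedAddCommGroup E] [NormedSpace ℝ E] {σ : ℝ} (hσ : 0 < σ)
    (f : ℝ → E) (a : ℝ) :
    ∫ z, f (a + z) ∂(gauss σ) = ∫ z, tilt σ a z • f z ∂(gauss σ) := by
  rw [integral_gauss_eq hσ, integral_gauss_eq hσ]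
  rw [← integral_add_right_eq_self (fun z => gaussDensity σ z • tilt σ a z • f z) a]
  refine integral_congr_ae (ae_of_all _ fun z => ?_)
  simp only
  rw [smul_smul, ← gaussDensity_sub hσ, add_sub_cancel_right, add_comm]

end GaussTail

/-! ### Growth of the optimal maps -/

section Growth

variable {k : ℕ}

/-- Markov's inequality with threshold 2(M + 1), where the added 1 keeps the threshold positive. -/
lemma half_le_measureReal (μ : P2 k) {M : ℝ} (hM : μ.secondMoment ≤ M) :
    1 / 2 ≤ μ.toMeasure.real {x | ‖x‖ ^ 2 < 2 * (M + 1)} := by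
  have h0 := μ.secondMoment_nonneg
  have h1 := mul_meas_ge_le_integral_of_nonneg (μ := μ.toMeasure) (f := fun x => ‖x‖ ^ 2)
    (ae_of_all _ fun _ => by positivity) μ.integrable_sq (2 * (M + 1))
  have h2 : {x : RSpace k | ‖x‖ ^ 2 < 2 * (M + 1)} = {x | 2 * (M + 1) ≤ ‖x‖ ^ 2}ᶜ := by
    ext; simp
  rw [h2, probReal_compl_eq_one_sub (measurableSet_le (by fun_prop) (by fun_prop))]
  have h3 : ∫ x, ‖x‖ ^ 2 ∂μ.toMeasure ≤ M := hM
  by_contra! h4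
  nlinarith

/-- At least half of μ lies in a ball whose radius depends only on the moment bound M. Both tails of
a slice thus inherit half a Gaussian tail, uniformly in μ with that bound. -/
lemma half_mul_cdf_gauss_le (μ : P2 k) {M : ℝ} (hM : μ.secondMoment ≤ M) (σ : ℝ) {y : ℝ}
    {f : RSpace k → ℝ} (hf : Measurable f) (h : ∀ x, -(|y| + ‖x‖) ≤ f x) :
    1 / 2 * cdf (gauss σ) (-(|y| + √(2 * (M + 1)))) ≤ ∫ x, cdf (gauss σ) (f x) ∂μ.toMeasure := by
  set S := {x : RSpace k | ‖x‖ ^ 2 < 2 * (M + 1)}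
  set c := cdf (gauss σ) (-(|y| + √(2 * (M + 1))))
  have hS : MeasurableSet S := measurableSet_lt (by fun_prop) (by fun_prop)
  calc 1 / 2 * c ≤ μ.toMeasure.real S * c :=
        mul_le_mul_of_nonneg_right (half_le_measureReal μ hM) (cdf_nonneg _ _)
    _ = ∫ x, S.indicator (fun _ => c) x ∂μ.toMeasure := by
        rw [integral_indicator hS, setIntegral_const, smul_eq_mul]
    _ ≤ ∫ x, cdf (gauss σ) (f x) ∂μ.toMeasure := by
        refine integral_mono ((integrable_const c).indicator hS) (integrable_cdf_comp hf _)
          fun x => ?_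
        by_cases hx : x ∈ S
        · rw [indicator_of_mem hx]
          refine monotone_cdf _ ((h x).trans' ?_)
          have : ‖x‖ ≤ √(2 * (M + 1)) := Real.le_sqrt_of_sq_le (le_of_lt hx)
          linarith
        · rw [indicator_of_notMem hx]
          exact cdf_nonneg _ _

lemma half_mul_cdf_gauss_le_cdf_slice (μ : P2 k) {M : ℝ} (hM : μ.secondMoment ≤ M) (σ : ℝ)
    (θ : USphere k) (y : ℝ) :
    1 / 2 * cdf (gauss σ) (-(|y| + √(2 * (M + 1)))) ≤ cdf (slice σ μ θ) y := by
  rw [cdf_slice_id]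
  refine half_mul_cdf_gauss_le μ hM σ (by fun_prop) fun x => ?_
  have h := abs_real_inner_le_norm x (θ : RSpace k)
  rw [norm_usphere, mul_one] at h
  have := neg_abs_le y
  have := le_abs_self (inner ℝ x (θ : RSpace k))
  linarith

lemma half_mul_cdf_gauss_le_one_sub_cdf_slice (μ : P2 k) {M : ℝ} (hM : μ.secondMoment ≤ M) {σ : ℝ}
    (hσ : 0 < σ) (θ : USphere k) (y : ℝ) :
    1 / 2 * cdf (gauss σ) (-(|y| + √(2 * (M + 1)))) ≤ 1 - cdf (slice σ μ θ) y := by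
  have h1 : 1 - cdf (slice σ μ θ) y
      = ∫ x, cdf (gauss σ) (-(y - inner ℝ x (θ : RSpace k))) ∂μ.toMeasure := by
    simp_rw [← one_sub_cdf_gauss hσ]
    rw [integral_sub (integrable_const _) (integrable_cdf_comp (by fun_prop) _), cdf_slice_id]
    simp
  rw [h1]
  refine half_mul_cdf_gauss_le μ hM σ (by fun_prop) fun x => ?_
  have h := abs_real_inner_le_norm x (θ : RSpace k)
  rw [norm_usphere, mul_one] at h
  have := le_abs_self y
  have := neg_abs_le (inner ℝ x (θ : RSpace k))
  linarith

lemma integral_sq_slice_le (σ : ℝ) (μ : P2 k) (θ : USphere k) :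
    ∫ y, y ^ 2 ∂(slice σ μ θ) ≤ μ.secondMoment + σ ^ 2 := by
  rw [integral_sq_slice]
  gcongr
  exact integral_mono (memLp_inner μ θ).integrable_sq μ.integrable_sq fun x => sq_inner_le _ _

/-- The optimal maps grow at most like the square root of the inverse Gaussian tail. -/
lemma exists_abs_rearr_le {σ : ℝ} (hσ : 0 < σ) {ν : ℕ → P2 k} {B : ℝ}
    (hν : ∀ n, (ν n).secondMoment ≤ B) (M : ℝ) :
    ∃ c C : ℝ, 0 ≤ c ∧ 0 ≤ C ∧ ∀ μ : P2 k, μ.secondMoment ≤ M → ∀ p : Idx k × ℝ,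
      |rearr σ ν μ p| ≤ C * Real.exp ((|p.2| + c) ^ 2 / (4 * σ ^ 2)) := by
  set s := √(2 * Real.pi * σ ^ 2) with hs
  have hs0 : 0 < s := Real.sqrt_pos.2 (by positivity)
  have hB : 0 ≤ B := (ν 0).secondMoment_nonneg.trans (hν 0)
  refine ⟨√(2 * (M + 1)) + 1, √(2 * (B + σ ^ 2) * s), by positivity, by positivity,
    fun μ hM p => ?_⟩
  set b := |p.2| + √(2 * (M + 1)) with hb
  -- Markov's inequality bounds the squared map times half a Gaussian tail by the target's second
  -- moment. Inverting the tail gives exp((b + 1)²/(2σ²)), and the square root halves the exponent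
  -- to 1/(4σ²).
  have h1 := sq_transport_mul_le (hasRegularCdf_slice hσ μ p.1.2)
    (hasRegularCdf_slice hσ (ν p.1.1) p.1.2) (integrable_sq_slice _ _ _) p.2
    (half_mul_cdf_gauss_le_cdf_slice μ hM σ p.1.2 p.2)
    (half_mul_cdf_gauss_le_one_sub_cdf_slice μ hM hσ p.1.2 p.2)
  have h2 : gaussDensity σ (b + 1) ≤ cdf (gauss σ) (-b) := le_cdf_gauss hσ (by positivity)
  have h3 := (integral_sq_slice_le σ (ν p.1.1) p.1.2).trans
    (add_le_add_left (hν p.1.1) (σ ^ 2))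
  have h4 : rearr σ ν μ p ^ 2 * (1 / 2 * gaussDensity σ (b + 1)) ≤ B + σ ^ 2 := by
    refine (mul_le_mul_of_nonneg_left ?_ (sq_nonneg _)).trans (h1.trans h3)
    gcongr
  rw [← abs_of_nonneg (mul_nonneg (Real.sqrt_nonneg _) (Real.exp_pos _).le), ← sq_le_sq, mul_pow,
    Real.sq_sqrt (by positivity), ← Real.exp_nat_mul]
  rw [gaussDensity_eq, ← hs] at h4
  have h5 : Real.exp (-(b + 1) ^ 2 / (2 * σ ^ 2))
      * Real.exp ((2 : ℕ) * ((|p.2| + (√(2 * (M + 1)) + 1)) ^ 2 / (4 * σ ^ 2))) = 1 := by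
    rw [← Real.exp_add, Real.exp_eq_one_iff, hb]
    push_cast
    field_simp
    ring
  set e := Real.exp ((2 : ℕ) * ((|p.2| + (√(2 * (M + 1)) + 1)) ^ 2 / (4 * σ ^ 2)))
  have he : 0 < e := Real.exp_pos _
  calc rearr σ ν μ p ^ 2
      = rearr σ ν μ p ^ 2 * (1 / 2 * (s⁻¹ * Real.exp (-(b + 1) ^ 2 / (2 * σ ^ 2))))
          * (2 * s * e) := by
        have : s⁻¹ * s = 1 := inv_mul_cancel₀ hs0.ne'
        linear_combination (-rearr σ ν μ p ^ 2) * h5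
          - rearr σ ν μ p ^ 2 * Real.exp (-(b + 1) ^ 2 / (2 * σ ^ 2)) * e * this
    _ ≤ (B + σ ^ 2) * (2 * s * e) := by gcongr
    _ = _ := by ring

/-- The bound of `exists_abs_rearr_le` at shifted points, including exponential factors. -/
lemma exp_growth_le {σ : ℝ} (hσ : 0 < σ) {c b : ℝ} (z y : ℝ) (hy : |y| ≤ b + |z|)
    (hc : 0 ≤ c) (d : ℝ) :
    Real.exp ((|y| + c) ^ 2 / (4 * σ ^ 2)) * Real.exp (d * |z|)
      ≤ Real.exp (5 * (b + c) ^ 2 / (4 * σ ^ 2) + 4 * σ ^ 2 * d ^ 2)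
        * Real.exp (3 / 8 * z ^ 2 / σ ^ 2) := by
  rw [← Real.exp_add, ← Real.exp_add, Real.exp_le_exp]
  -- The weight 5/4 contributes 5/16 to the coefficient of z²/σ²; the linear term below contributes
  -- 1/16. Together they make 3/8.
  have h1 : (|y| + c) ^ 2 ≤ 5 / 4 * z ^ 2 + 5 * (b + c) ^ 2 := by
    have : (|y| + c) ^ 2 ≤ (|z| + (b + c)) ^ 2 := by
      exact pow_le_pow_left₀ (by positivity) (by linarith) 2
    nlinarith [sq_nonneg (|z| - 4 * (b + c)), sq_abs z]
  have h2 : d * |z| ≤ z ^ 2 / (16 * σ ^ 2) + 4 * σ ^ 2 * d ^ 2 := by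
    have h3 : z ^ 2 / (16 * σ ^ 2) + 4 * σ ^ 2 * d ^ 2 - d * |z|
        = (|z| / (4 * σ) - 2 * σ * d) ^ 2 := by
      rw [← sq_abs z]
      field_simp
      ring
    nlinarith [sq_nonneg (|z| / (4 * σ) - 2 * σ * d)]
  calc (|y| + c) ^ 2 / (4 * σ ^ 2) + d * |z|
      ≤ (5 / 4 * z ^ 2 + 5 * (b + c) ^ 2) / (4 * σ ^ 2)
        + (z ^ 2 / (16 * σ ^ 2) + 4 * σ ^ 2 * d ^ 2) := by gcongr
    _ = _ := by
        field_simp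
        ring

end Growth

/-! ### The gradient field and its spatial derivative -/

section GradientField

variable {k : ℕ} {σ : ℝ}

/-- Dominated convergence along a filter requires countable generation; here the filter is pulled
back from the real line. -/
instance (μ : P2 k) : μ.nhdsW2.IsCountablyGenerated := by unfold P2.nhdsW2; infer_instance

lemma integrable_exp_sq_noise (hσ : 0 < σ) :
    Integrable (fun p : Idx k × ℝ => Real.exp (3 / 8 * p.2 ^ 2 / σ ^ 2)) (noiseMeasure k σ) :=
  (integrable_exp_sq_gauss hσ).comp_snd (idxMeasure k)

lemma integrable_abs_noise (σ : ℝ) :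
    Integrable (fun p : Idx k × ℝ => |p.2|) (noiseMeasure k σ) :=
  (((memLp_gauss σ).integrable (by norm_num)).abs).comp_snd (idxMeasure k)

lemma abs_inner_usphere_le (x : RSpace k) (θ : USphere k) : |inner ℝ x (θ : RSpace k)| ≤ ‖x‖ := by
  have h := abs_real_inner_le_norm x (θ : RSpace k)
  rwa [norm_usphere, mul_one] at h

lemma abs_shift_le {x : RSpace k} {b : ℝ} (hx : ‖x‖ ≤ b) (p : Idx k × ℝ) :
    |(shift x p).2| ≤ b + |p.2| :=
  (abs_add_le _ _).trans (by gcongr; exact (abs_inner_usphere_le _ _).trans hx)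

/-- Uniformity over moment-bounded μ and bounded x supplies a dominating function for the joint
continuity of the gradient field. -/
lemma exists_abs_rearr_shift_le (hσ : 0 < σ) {ν : ℕ → P2 k} {B : ℝ}
    (hν : ∀ n, (ν n).secondMoment ≤ B) (M b : ℝ) :
    ∃ C : ℝ, ∀ μ : P2 k, μ.secondMoment ≤ M → ∀ x : RSpace k, ‖x‖ ≤ b → ∀ p : Idx k × ℝ,
      |rearr σ ν μ (shift x p)| * (1 + |p.2|) ≤ C * Real.exp (3 / 8 * p.2 ^ 2 / σ ^ 2) := by
  obtain ⟨c, C, hc, hC, h⟩ := exists_abs_rearr_le hσ hν M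
  refine ⟨C * Real.exp (5 * (b + c) ^ 2 / (4 * σ ^ 2) + 4 * σ ^ 2 * 1 ^ 2),
    fun μ hμ x hx p => ?_⟩
  have h1 := exp_growth_le hσ p.2 (shift x p).2 (abs_shift_le hx p) hc 1
  have h2 : 1 + |p.2| ≤ Real.exp (1 * |p.2|) := by
    rw [one_mul, add_comm]
    exact Real.add_one_le_exp _
  calc |rearr σ ν μ (shift x p)| * (1 + |p.2|)
      ≤ (C * Real.exp ((|(shift x p).2| + c) ^ 2 / (4 * σ ^ 2))) * Real.exp (1 * |p.2|) := by
        gcongr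
        exact h μ hμ _
    _ = C * (Real.exp ((|(shift x p).2| + c) ^ 2 / (4 * σ ^ 2)) * Real.exp (1 * |p.2|)) := by ring
    _ ≤ _ := by
        rw [mul_assoc]
        gcongr

lemma tilt_le {a b : ℝ} (h : |a| ≤ b) (z : ℝ) : tilt σ a z ≤ Real.exp (b / σ ^ 2 * |z|) := by
  rw [tilt, Real.exp_le_exp, div_mul_eq_mul_div]
  gcongr
  have h1 : a * z ≤ |a| * |z| := by rw [← abs_mul]; exact le_abs_self _
  have h2 : |a| * |z| ≤ b * |z| := by gcongr
  nlinarith [sq_nonneg a]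

lemma exists_tilt_mul_abs_rearr_le (hσ : 0 < σ) {ν : ℕ → P2 k} {B : ℝ}
    (hν : ∀ n, (ν n).secondMoment ≤ B) (μ : P2 k) (b : ℝ) :
    ∃ C : ℝ, ∀ x : RSpace k, ‖x‖ ≤ b → ∀ p : Idx k × ℝ,
      tilt σ (inner ℝ x (p.1.2 : RSpace k)) p.2 * (1 + |p.2 - inner ℝ x (p.1.2 : RSpace k)|)
        * |rearr σ ν μ p| ≤ C * Real.exp (3 / 8 * p.2 ^ 2 / σ ^ 2) := by
  obtain ⟨c, C, hc, hC, h⟩ := exists_abs_rearr_le hσ hν μ.secondMoment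
  -- The rate b/σ² comes from the tilt; the extra 1 absorbs the linear factor produced by
  -- differentiating it.
  set d := b / σ ^ 2 + 1
  refine ⟨C * Real.exp b * Real.exp (5 * (0 + c) ^ 2 / (4 * σ ^ 2) + 4 * σ ^ 2 * d ^ 2),
    fun x hx p => ?_⟩
  have h1 := exp_growth_le (b := 0) hσ p.2 p.2 (by simp) hc d
  have hi := (abs_inner_usphere_le x p.1.2).trans hx
  have h2 : 1 + |p.2 - inner ℝ x (p.1.2 : RSpace k)| ≤ Real.exp (b + |p.2|) := by
    have h3 := abs_sub p.2 (inner ℝ x (p.1.2 : RSpace k))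
    have h4 := Real.add_one_le_exp (b + |p.2|)
    linarith
  calc _ ≤ Real.exp (b / σ ^ 2 * |p.2|) * Real.exp (b + |p.2|)
        * (C * Real.exp ((|p.2| + c) ^ 2 / (4 * σ ^ 2))) := by
        gcongr
        · exact tilt_le hi _
        · exact h μ le_rfl p
    _ = C * Real.exp b * (Real.exp ((|p.2| + c) ^ 2 / (4 * σ ^ 2)) * Real.exp (d * |p.2|)) := by
        have : Real.exp (b / σ ^ 2 * |p.2|) * Real.exp (b + |p.2|)
            = Real.exp b * Real.exp (d * |p.2|) := by
          rw [← Real.exp_add, ← Real.exp_add]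
          congr 1
          ring
        rw [this]
        ring
    _ ≤ _ := by
        rw [mul_assoc (C * Real.exp b)]
        gcongr

/-- The derivative of the potential in the measure variable. -/
noncomputable def gradField (σ : ℝ) (ν : ℕ → P2 k) (μ : P2 k) (x : RSpace k) : RSpace k :=
  ∫ p, ((shift x p).2 - rearr σ ν μ (shift x p)) • (p.1.2 : RSpace k) ∂(noiseMeasure k σ)

lemma continuous_shift_right (x : RSpace k) : Continuous (shift x) := by
  unfold shift; fun_prop

lemma continuous_rearr_shift (hσ : 0 < σ) (ν : ℕ → P2 k) (μ : P2 k) (x : RSpace k) :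
    Continuous fun p => rearr σ ν μ (shift x p) := by
  have := (continuous_rearr hσ ν μ).comp (continuous_shift_right x)
  exact this

lemma continuous_idx_dir : Continuous fun p : Idx k × ℝ => (p.1.2 : RSpace k) := by fun_prop

lemma tendsto_rearr_shift (hσ : 0 < σ) (ν : ℕ → P2 k) (μ : P2 k) (x : RSpace k) (p : Idx k × ℝ) :
    Tendsto (fun q : P2 k × RSpace k => rearr σ ν q.1 (shift q.2 p)) (μ.nhdsW2 ×ˢ 𝓝 x)
      (𝓝 (rearr σ ν μ (shift x p))) := by
  have h1 : Continuous fun x : RSpace k => inner ℝ x (p.1.2 : RSpace k) + p.2 := by fun_prop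
  exact tendsto_transport (a := fun q : P2 k × RSpace k => slice σ q.1 p.1.2)
    (b := fun _ => slice σ (ν p.1.1) p.1.2)
    (hasRegularCdf_slice hσ μ p.1.2) (hasRegularCdf_slice hσ (ν p.1.1) p.1.2)
    (fun q => hasRegularCdf_slice hσ q.1 p.1.2) (fun q => hasRegularCdf_slice hσ (ν p.1.1) p.1.2)
    (fun c => (tendsto_cdf_slice_nhdsW2 hσ μ p.1.2 c).comp tendsto_fst)
    (fun c => tendsto_const_nhds)
    ((h1.tendsto x).comp tendsto_snd)

/-- The gradient field is jointly continuous. -/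
lemma tendsto_gradField (hσ : 0 < σ) {ν : ℕ → P2 k} {B : ℝ} (hν : ∀ n, (ν n).secondMoment ≤ B)
    (μ : P2 k) (x : RSpace k) :
    Tendsto (fun q : P2 k × RSpace k => gradField σ ν q.1 q.2) (μ.nhdsW2 ×ˢ 𝓝 x)
      (𝓝 (gradField σ ν μ x)) := by
  obtain ⟨C, hC⟩ := exists_abs_rearr_shift_le hσ hν (2 * μ.secondMoment + 4) (‖x‖ + 1)
  refine tendsto_integral_filter_of_dominated_convergence
    (fun p => (‖x‖ + 1 + |p.2|) + C * Real.exp (3 / 8 * p.2 ^ 2 / σ ^ 2))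
    (Eventually.of_forall fun q => ?_) ?_
    (((integrable_const _).add (integrable_abs_noise σ)).add
      ((integrable_exp_sq_noise hσ).const_mul C)) (ae_of_all _ fun p => ?_)
  · have h1 := continuous_rearr_shift hσ ν q.1 q.2
    have h2 := continuous_shift_right q.2
    have h3 := continuous_idx_dir (k := k)
    exact ((h2.snd.sub h1).smul h3).aestronglyMeasurable
  · have h1 : ∀ᶠ y in 𝓝 x, ‖y‖ ≤ ‖x‖ + 1 :=
      continuous_norm.continuousAt.eventually_le_const (by linarith)
    filter_upwards [(eventually_secondMoment_le μ).prod_mk h1] with q hq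
    refine ae_of_all _ fun p => ?_
    rw [norm_smul, norm_usphere, mul_one]
    refine (abs_sub _ _).trans (add_le_add (abs_shift_le hq.2 p) ?_)
    exact (hC q.1 hq.1 q.2 hq.2 p).trans' (le_mul_of_one_le_right (abs_nonneg _) (by simp))
  · have h1 : Continuous fun x : RSpace k => (shift x p).2 := by unfold shift; fun_prop
    exact (((h1.tendsto x).comp tendsto_snd).sub (tendsto_rearr_shift hσ ν μ x p)).smul_const _

lemma integrable_rearr_shift_mul (hσ : 0 < σ) {ν : ℕ → P2 k} {B : ℝ}
    (hν : ∀ n, (ν n).secondMoment ≤ B) (μ : P2 k) (x : RSpace k) :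
    Integrable (fun p => |rearr σ ν μ (shift x p)| * (1 + |p.2|)) (noiseMeasure k σ) := by
  obtain ⟨C, hC⟩ := exists_abs_rearr_shift_le hσ hν μ.secondMoment ‖x‖
  have h1 := continuous_rearr_shift hσ ν μ x
  refine ((integrable_exp_sq_noise hσ).const_mul C).mono'
    (Continuous.aestronglyMeasurable (by fun_prop)) (ae_of_all _ fun p => ?_)
  rw [Real.norm_of_nonneg (by positivity)]
  exact hC μ le_rfl x le_rfl p

lemma integrable_rearr_shift (hσ : 0 < σ) {ν : ℕ → P2 k} {B : ℝ}
    (hν : ∀ n, (ν n).secondMoment ≤ B) (μ : P2 k) (x : RSpace k) :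
    Integrable (fun p => rearr σ ν μ (shift x p)) (noiseMeasure k σ) :=
  (integrable_rearr_shift_mul hσ hν μ x).mono'
    (continuous_rearr_shift hσ ν μ x).aestronglyMeasurable
    (ae_of_all _ fun _ => le_mul_of_one_le_right (abs_nonneg _) (by simp))

lemma integrable_abs_mul_rearr_shift (hσ : 0 < σ) {ν : ℕ → P2 k} {B : ℝ}
    (hν : ∀ n, (ν n).secondMoment ≤ B) (μ : P2 k) (x : RSpace k) :
    Integrable (fun p => |p.2| * |rearr σ ν μ (shift x p)|) (noiseMeasure k σ) := by
  have h1 := continuous_rearr_shift hσ ν μ x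
  refine (integrable_rearr_shift_mul hσ hν μ x).mono'
    (Continuous.aestronglyMeasurable (by fun_prop)) (ae_of_all _ fun p => ?_)
  rw [Real.norm_of_nonneg (by positivity), mul_comm]
  gcongr
  linarith

lemma integrable_shift (σ : ℝ) (x : RSpace k) :
    Integrable (fun p => (shift x p).2) (noiseMeasure k σ) :=
  ((integrable_const ‖x‖).add (integrable_abs_noise σ)).mono'
    (continuous_shift_right x).snd.aestronglyMeasurable
    (ae_of_all _ fun p => abs_shift_le le_rfl p)

/-- Integrating out a shift by tilting the noise. -/
lemma integral_comp_shift {E : Type*} [NormedAddCommGroup E] [NormedSpace ℝ E] (hσ : 0 < σ)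
    (x : RSpace k) {f : Idx k × ℝ → E}
    (h1 : Integrable (fun p => f (shift x p)) (noiseMeasure k σ))
    (h2 : Integrable (fun p => tilt σ (inner ℝ x (p.1.2 : RSpace k)) p.2 • f p)
      (noiseMeasure k σ)) :
    ∫ p, f (shift x p) ∂(noiseMeasure k σ)
      = ∫ p, tilt σ (inner ℝ x (p.1.2 : RSpace k)) p.2 • f p ∂(noiseMeasure k σ) := by
  unfold noiseMeasure at *
  rw [integral_prod _ h1, integral_prod _ h2]
  refine integral_congr_ae (ae_of_all _ fun i => ?_)
  exact integral_gauss_add hσ (fun z => f (i, z)) (inner ℝ x (i.2 : RSpace k))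

lemma continuous_tilt_inner (σ : ℝ) (x : RSpace k) :
    Continuous fun p : Idx k × ℝ => tilt σ (inner ℝ x (p.1.2 : RSpace k)) p.2 := by
  unfold tilt; fun_prop

lemma integrable_tilt_mul (hσ : 0 < σ) {ν : ℕ → P2 k} {B : ℝ}
    (hν : ∀ n, (ν n).secondMoment ≤ B) (μ : P2 k) (x : RSpace k) :
    Integrable (fun p => tilt σ (inner ℝ x (p.1.2 : RSpace k)) p.2
      * (1 + |p.2 - inner ℝ x (p.1.2 : RSpace k)|) * |rearr σ ν μ p|) (noiseMeasure k σ) := by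
  obtain ⟨C, hC⟩ := exists_tilt_mul_abs_rearr_le hσ hν μ ‖x‖
  have h1 := continuous_rearr hσ ν μ
  have h2 := continuous_tilt_inner σ x
  refine ((integrable_exp_sq_noise hσ).const_mul C).mono'
    (Continuous.aestronglyMeasurable (by fun_prop)) (ae_of_all _ fun p => ?_)
  have := tilt_pos σ (inner ℝ x (p.1.2 : RSpace k)) p.2
  rw [Real.norm_of_nonneg (by positivity)]
  exact hC x le_rfl p

lemma integrable_tilt_mul_rearr (hσ : 0 < σ) {ν : ℕ → P2 k} {B : ℝ}
    (hν : ∀ n, (ν n).secondMoment ≤ B) (μ : P2 k) (x : RSpace k) :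
    Integrable (fun p => tilt σ (inner ℝ x (p.1.2 : RSpace k)) p.2 * rearr σ ν μ p)
      (noiseMeasure k σ) := by
  have h1 := continuous_rearr hσ ν μ
  have h2 := continuous_tilt_inner σ x
  refine (integrable_tilt_mul hσ hν μ x).mono'
    (Continuous.aestronglyMeasurable (by fun_prop)) (ae_of_all _ fun p => ?_)
  have := tilt_pos σ (inner ℝ x (p.1.2 : RSpace k)) p.2
  rw [norm_mul, Real.norm_of_nonneg this.le, Real.norm_eq_abs]
  gcongr
  exact le_mul_of_one_le_right this.le (by simp)

lemma integrable_smul_dir {f : Idx k × ℝ → ℝ} {m : Measure (Idx k × ℝ)} (hf : Integrable f m) :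
    Integrable (fun p => f p • (p.1.2 : RSpace k)) m := by
  refine hf.norm.mono' (hf.aestronglyMeasurable.smul continuous_idx_dir.aestronglyMeasurable)
    (ae_of_all _ fun p => ?_)
  rw [norm_smul, norm_usphere, mul_one]

/-- The integrand of the gradient field after tilting. -/
noncomputable def tiltedIntegrand (σ : ℝ) (ν : ℕ → P2 k) (μ : P2 k) (x : RSpace k)
    (p : Idx k × ℝ) : ℝ :=
  (shift x p).2 - tilt σ (inner ℝ x (p.1.2 : RSpace k)) p.2 * rearr σ ν μ p

lemma integrable_tiltedIntegrand (hσ : 0 < σ) {ν : ℕ → P2 k} {B : ℝ}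
    (hν : ∀ n, (ν n).secondMoment ≤ B) (μ : P2 k) (x : RSpace k) :
    Integrable (tiltedIntegrand σ ν μ x) (noiseMeasure k σ) :=
  (integrable_shift σ x).sub (integrable_tilt_mul_rearr hσ hν μ x)

lemma gradField_eq_tilted (hσ : 0 < σ) {ν : ℕ → P2 k} {B : ℝ}
    (hν : ∀ n, (ν n).secondMoment ≤ B) (μ : P2 k) (x : RSpace k) :
    gradField σ ν μ x
      = ∫ p, tiltedIntegrand σ ν μ x p • (p.1.2 : RSpace k) ∂(noiseMeasure k σ) := by
  have i1 := integrable_smul_dir (integrable_shift σ x)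
  have i2 := integrable_smul_dir (integrable_rearr_shift hσ hν μ x)
  have i3 := integrable_smul_dir (integrable_tilt_mul_rearr hσ hν μ x)
  have h1 := integral_comp_shift hσ x (f := fun p => rearr σ ν μ p • (p.1.2 : RSpace k)) i2
    (by simpa only [smul_smul] using i3)
  simp_rw [smul_smul] at h1
  have h2 : ∀ p : Idx k × ℝ, (shift x p).1 = p.1 := fun _ => rfl
  simp_rw [h2] at h1
  simp_rw [gradField, tiltedIntegrand, sub_smul]
  rw [integral_sub i1 i2, integral_sub i1 i3, h1]

lemma hasDerivAt_tilt (σ a z T : ℝ) :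
    HasDerivAt (fun a => a + z - tilt σ a z * T) (1 - tilt σ a z * ((z - a) / σ ^ 2) * T) a := by
  have h1 : HasDerivAt (fun a : ℝ => (a * z - a ^ 2 / 2) / σ ^ 2) ((z - a) / σ ^ 2) a := by
    have := (((hasDerivAt_id a).mul_const z).sub ((hasDerivAt_pow 2 a).div_const 2)).div_const
      (σ ^ 2)
    rw [show (z - a) / σ ^ 2 = (1 * z - ↑2 * a ^ (2 - 1) / 2) / σ ^ 2 by simp]
    exact this
  exact ((hasDerivAt_id a).add_const z).sub (h1.exp.mul_const T)

/-- The derivative of `tiltedIntegrand • θ`. -/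
noncomputable def tiltedDeriv (σ : ℝ) (ν : ℕ → P2 k) (μ : P2 k) (x : RSpace k)
    (p : Idx k × ℝ) : RSpace k →L[ℝ] RSpace k :=
  ((1 - tilt σ (inner ℝ x (p.1.2 : RSpace k)) p.2
    * ((p.2 - inner ℝ x (p.1.2 : RSpace k)) / σ ^ 2) * rearr σ ν μ p)
      • innerSL ℝ (p.1.2 : RSpace k)).smulRight (p.1.2 : RSpace k)

lemma hasFDerivAt_tiltedIntegrand (σ : ℝ) (ν : ℕ → P2 k) (μ : P2 k) (x : RSpace k)
    (p : Idx k × ℝ) :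
    HasFDerivAt (fun x => tiltedIntegrand σ ν μ x p • (p.1.2 : RSpace k))
      (tiltedDeriv σ ν μ x p) x := by
  have h1 : HasFDerivAt (fun x : RSpace k => inner ℝ x (p.1.2 : RSpace k))
      (innerSL ℝ (p.1.2 : RSpace k)) x := by
    have := (innerSL ℝ (p.1.2 : RSpace k)).hasFDerivAt (x := x)
    refine this.congr_of_eventuallyEq (Eventually.of_forall fun y => ?_)
    rw [innerSL_apply_apply, real_inner_comm]
  exact ((hasDerivAt_tilt σ (inner ℝ x (p.1.2 : RSpace k)) p.2 (rearr σ ν μ p)).comp_hasFDerivAt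
    x h1).smul_const (p.1.2 : RSpace k)

lemma norm_tiltedDeriv_le (hσ : 0 < σ) (ν : ℕ → P2 k) (μ : P2 k) (x : RSpace k)
    (p : Idx k × ℝ) :
    ‖tiltedDeriv σ ν μ x p‖ ≤ 1 + (σ ^ 2)⁻¹ * (tilt σ (inner ℝ x (p.1.2 : RSpace k)) p.2
      * (|p.2 - inner ℝ x (p.1.2 : RSpace k)| * |rearr σ ν μ p|)) := by
  rw [tiltedDeriv, ContinuousLinearMap.norm_smulRight_apply, norm_smul, innerSL_apply_norm,
    norm_usphere, mul_one, mul_one, Real.norm_eq_abs]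
  refine (abs_sub _ _).trans_eq ?_
  rw [abs_one, abs_mul, abs_mul, abs_div, abs_of_pos (tilt_pos _ _ _),
    abs_of_pos (by positivity : 0 < σ ^ 2)]
  ring

lemma continuous_tiltedDeriv (hσ : 0 < σ) (ν : ℕ → P2 k) (μ : P2 k) (x : RSpace k) :
    Continuous (tiltedDeriv σ ν μ x) := by
  have h1 := continuous_rearr hσ ν μ
  have h2 := continuous_tilt_inner σ x
  have h3 := continuous_idx_dir (k := k)
  have h4 : Continuous fun p : Idx k × ℝ => 1 - tilt σ (inner ℝ x (p.1.2 : RSpace k)) p.2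
    * ((p.2 - inner ℝ x (p.1.2 : RSpace k)) / σ ^ 2) * rearr σ ν μ p := by fun_prop
  have h5 : Continuous fun p : Idx k × ℝ => innerSL ℝ (p.1.2 : RSpace k) :=
    (innerSL ℝ).continuous.comp h3
  exact ((ContinuousLinearMap.smulRightL ℝ (RSpace k) (RSpace k)).continuous.comp
    (h4.smul h5)).clm_apply h3

/-- The gradient field is differentiable. -/
lemma hasFDerivAt_gradField (hσ : 0 < σ) {ν : ℕ → P2 k} {B : ℝ}
    (hν : ∀ n, (ν n).secondMoment ≤ B) (μ : P2 k) (x : RSpace k) :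
    HasFDerivAt (gradField σ ν μ) (∫ p, tiltedDeriv σ ν μ x p ∂(noiseMeasure k σ)) x := by
  rw [funext (gradField_eq_tilted hσ hν μ)]
  obtain ⟨C, hC⟩ := exists_tilt_mul_abs_rearr_le hσ hν μ (‖x‖ + 1)
  refine hasFDerivAt_integral_of_dominated_of_fderiv_le (s := Metric.ball x 1)
    (bound := fun p => 1 + (σ ^ 2)⁻¹ * (C * Real.exp (3 / 8 * p.2 ^ 2 / σ ^ 2)))
    (Metric.ball_mem_nhds x one_pos)
    (Eventually.of_forall fun y =>
      (integrable_smul_dir (integrable_tiltedIntegrand hσ hν μ y)).aestronglyMeasurable)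
    (integrable_smul_dir (integrable_tiltedIntegrand hσ hν μ x))
    (continuous_tiltedDeriv hσ ν μ x).aestronglyMeasurable (ae_of_all _ fun p y hy => ?_)
    ((integrable_const _).add (((integrable_exp_sq_noise hσ).const_mul C).const_mul _))
    (ae_of_all _ fun p y _ => hasFDerivAt_tiltedIntegrand σ ν μ y p)
  have hy' : ‖y‖ ≤ ‖x‖ + 1 := by
    rw [Metric.mem_ball, dist_eq_norm] at hy
    have := norm_sub_norm_le y x
    linarith
  refine (norm_tiltedDeriv_le hσ ν μ y p).trans (add_le_add_right
    (mul_le_mul_of_nonneg_left ?_ (by positivity)) _)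
  refine (hC y hy' p).trans' ?_
  have := tilt_pos σ (inner ℝ y (p.1.2 : RSpace k)) p.2
  rw [← mul_assoc]
  gcongr
  linarith

lemma differentiable_gradField (hσ : 0 < σ) {ν : ℕ → P2 k} {B : ℝ}
    (hν : ∀ n, (ν n).secondMoment ≤ B) (μ : P2 k) : Differentiable ℝ (gradField σ ν μ) :=
  fun x => (hasFDerivAt_gradField hσ hν μ x).differentiableAt

/-- After differentiation the change of density is undone: z − x·θ at the shifted point is the noise
itself, so the bound involves the map but not its derivative. The constant 2 is the total mass of
the noise measure. -/
lemma norm_fderiv_gradField_le (hk : 1 ≤ k) (hσ : 0 < σ) {ν : ℕ → P2 k} {B : ℝ}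
    (hν : ∀ n, (ν n).secondMoment ≤ B) (μ : P2 k) (x : RSpace k) :
    ‖fderiv ℝ (gradField σ ν μ) x‖ ≤ 2 + (σ ^ 2)⁻¹ *
      ∫ p, |p.2| * |rearr σ ν μ (shift x p)| ∂(noiseMeasure k σ) := by
  rw [(hasFDerivAt_gradField hσ hν μ x).fderiv]
  have i1 := integrable_abs_mul_rearr_shift hσ hν μ x
  have h0 : ∀ p : Idx k × ℝ, |(shift x p).2 - inner ℝ x ((shift x p).1.2 : RSpace k)| = |p.2| :=
    fun p => by simp [shift]
  have i2 : Integrable (fun p => tilt σ (inner ℝ x (p.1.2 : RSpace k)) p.2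
      * (|p.2 - inner ℝ x (p.1.2 : RSpace k)| * |rearr σ ν μ p|)) (noiseMeasure k σ) := by
    have h1 := continuous_rearr hσ ν μ
    have h2 := continuous_tilt_inner σ x
    refine (integrable_tilt_mul hσ hν μ x).mono'
      (Continuous.aestronglyMeasurable (by fun_prop)) (ae_of_all _ fun p => ?_)
    have := tilt_pos σ (inner ℝ x (p.1.2 : RSpace k)) p.2
    rw [Real.norm_of_nonneg (by positivity), ← mul_assoc]
    gcongr
    linarith
  have h3 := integral_comp_shift hσ x
    (f := fun p => |p.2 - inner ℝ x (p.1.2 : RSpace k)| * |rearr σ ν μ p|)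
    (by simpa only [h0] using i1) i2
  simp only [h0, smul_eq_mul] at h3
  rw [h3]
  refine (norm_integral_le_of_norm_le ((integrable_const 1).add (i2.const_mul _))
    (ae_of_all _ (norm_tiltedDeriv_le hσ ν μ x))).trans_eq ?_
  rw [integral_add' (integrable_const 1) (i2.const_mul _), integral_const_mul, integral_const,
    noiseMeasure_real_univ hk]
  simp

end GradientField

/-! ### Integral bounds for the gradient field -/

section GradientBounds

variable {k : ℕ} {σ : ℝ} {Ω : Type*} [MeasurableSpace Ω] {P : Measure Ω} [IsProbabilityMeasure P]

lemma sq_integral_le_two_mul {S : Type*} [MeasurableSpace S] {m : Measure S} [IsFiniteMeasure m]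
    (hm : m.real univ = 2) {g : S → ℝ} (hg : Integrable g m)
    (hg2 : Integrable (fun x => g x ^ 2) m) : (∫ x, g x ∂m) ^ 2 ≤ 2 * ∫ x, g x ^ 2 ∂m := by
  set c := ∫ x, g x ∂m
  -- With total mass 2 the mean of g is c/2; the integrand is (g − c/2)².
  have h1 : 0 ≤ ∫ x, (g x ^ 2 - c * g x + c ^ 2 / 4) ∂m := integral_nonneg fun x => by
    have : g x ^ 2 - c * g x + c ^ 2 / 4 = (g x - c / 2) ^ 2 := by ring
    simp only [Pi.zero_apply, this]
    positivity
  have i1 : Integrable (fun x => g x ^ 2 - c * g x) m := hg2.sub (hg.const_mul c)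
  rw [integral_add i1 (integrable_const _), integral_sub hg2 (hg.const_mul c), integral_const_mul,
    integral_const, hm, smul_eq_mul] at h1
  linarith [h1, sq c]

/-- The displacement of the optimal maps. -/
noncomputable def displacement (σ : ℝ) (ν : ℕ → P2 k) (μ : P2 k) (x : RSpace k)
    (p : Idx k × ℝ) : ℝ :=
  (shift x p).2 - rearr σ ν μ (shift x p)

lemma integrable_displacement (hσ : 0 < σ) {ν : ℕ → P2 k} {B : ℝ}
    (hν : ∀ n, (ν n).secondMoment ≤ B) (μ : P2 k) (x : RSpace k) :
    Integrable (displacement σ ν μ x) (noiseMeasure k σ) :=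
  (integrable_shift σ x).sub (integrable_rearr_shift hσ hν μ x)

lemma memLp_displacement (hσ : 0 < σ) {ν : ℕ → P2 k} {ρ : ℝ} (hρ : ∀ n, ‖embedLp hσ (ν n)‖ ≤ ρ)
    {X : Ω → RSpace k} (hX : Measurable X) {μ : P2 k} (hμ : P.map X = μ.toMeasure) :
    MemLp (fun q : Ω × (Idx k × ℝ) => displacement σ ν μ (X q.1) q.2) 2
      (P.prod (noiseMeasure k σ)) :=
  (memLp_shift (memLp_two_of_map_eq hX hμ) σ).sub (memLp_rearr_shift hX hμ hσ hρ)

lemma norm_gradField_le (σ : ℝ) (ν : ℕ → P2 k) (μ : P2 k) (x : RSpace k) :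
    ‖gradField σ ν μ x‖ ≤ ∫ p, |displacement σ ν μ x p| ∂(noiseMeasure k σ) := by
  refine (norm_integral_le_integral_norm _).trans_eq (integral_congr_ae (ae_of_all _ fun p => ?_))
  simp only [displacement]
  rw [norm_smul, norm_usphere, mul_one, Real.norm_eq_abs]

lemma ae_norm_gradField_sq_le (hk : 1 ≤ k) (hσ : 0 < σ) {ν : ℕ → P2 k} {ρ B : ℝ}
    (hρ : ∀ n, ‖embedLp hσ (ν n)‖ ≤ ρ) (hν : ∀ n, (ν n).secondMoment ≤ B)
    {X : Ω → RSpace k} (hX : Measurable X) {μ : P2 k} (hμ : P.map X = μ.toMeasure) :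
    ∀ᵐ ω ∂P, ‖gradField σ ν μ (X ω)‖ ^ 2
      ≤ 2 * ∫ p, displacement σ ν μ (X ω) p ^ 2 ∂(noiseMeasure k σ) := by
  filter_upwards [(memLp_displacement hσ hρ hX hμ).integrable_sq.prod_right_ae] with ω hω
  have h1 := sq_integral_le_two_mul (noiseMeasure_real_univ hk σ)
    (integrable_displacement hσ hν μ (X ω)).abs (by simpa only [sq_abs] using hω)
  simp only [sq_abs] at h1
  refine h1.trans' ?_
  gcongr
  exact norm_gradField_le σ ν μ (X ω)

lemma continuous_gradField (hσ : 0 < σ) {ν : ℕ → P2 k} {B : ℝ}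
    (hν : ∀ n, (ν n).secondMoment ≤ B) (μ : P2 k) : Continuous (gradField σ ν μ) :=
  (differentiable_gradField hσ hν μ).continuous

lemma integrable_norm_gradField_sq (hk : 1 ≤ k) (hσ : 0 < σ) {ν : ℕ → P2 k} {ρ B : ℝ}
    (hρ : ∀ n, ‖embedLp hσ (ν n)‖ ≤ ρ) (hν : ∀ n, (ν n).secondMoment ≤ B)
    {X : Ω → RSpace k} (hX : Measurable X) {μ : P2 k} (hμ : P.map X = μ.toMeasure) :
    Integrable (fun ω => ‖gradField σ ν μ (X ω)‖ ^ 2) P := by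
  have hm : Measurable fun ω => ‖gradField σ ν μ (X ω)‖ ^ 2 :=
    (((continuous_gradField hσ hν μ).measurable.comp hX).norm).pow_const 2
  refine ((memLp_displacement hσ hρ hX hμ).integrable_sq.integral_prod_left.const_mul 2).mono'
    hm.aestronglyMeasurable ?_
  filter_upwards [ae_norm_gradField_sq_le hk hσ hρ hν hX hμ] with ω hω
  rwa [Real.norm_of_nonneg (by positivity)]

lemma integral_norm_gradField_sq_le (hk : 1 ≤ k) (hσ : 0 < σ) {ν : ℕ → P2 k} {ρ B : ℝ}
    (hρ : ∀ n, ‖embedLp hσ (ν n)‖ ≤ ρ) (hν : ∀ n, (ν n).secondMoment ≤ B)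
    {X : Ω → RSpace k} (hX : Measurable X) {μ : P2 k} (hμ : P.map X = μ.toMeasure) :
    ∫ ω, ‖gradField σ ν μ (X ω)‖ ^ 2 ∂P
      ≤ 2 * ∫ q, displacement σ ν μ (X q.1) q.2 ^ 2 ∂(P.prod (noiseMeasure k σ)) := by
  have hi := (memLp_displacement hσ hρ hX hμ).integrable_sq
  rw [integral_prod _ hi, ← integral_const_mul]
  exact integral_mono_ae (integrable_norm_gradField_sq hk hσ hρ hν hX hμ)
    (hi.integral_prod_left.const_mul 2) (ae_norm_gradField_sq_le hk hσ hρ hν hX hμ)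

lemma integral_sq_shift_le (hk : 1 ≤ k) (σ : ℝ) (μ : P2 k) :
    ∫ q, (shift q.1 q.2).2 ^ 2 ∂(μ.toMeasure.prod (noiseMeasure k σ))
      ≤ 4 * μ.secondMoment + 4 * σ ^ 2 := by
  have hL : MemLp (fun x : RSpace k => x) 2 μ.toMeasure :=
    memLp_two_of_map_eq measurable_id Measure.map_id
  have i1 : Integrable (fun q : RSpace k × (Idx k × ℝ) => 2 * ‖q.1‖ ^ 2)
      (μ.toMeasure.prod (noiseMeasure k σ)) :=
    (μ.integrable_sq.comp_fst (noiseMeasure k σ)).const_mul 2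
  have i2 : Integrable (fun q : RSpace k × (Idx k × ℝ) => 2 * q.2.2 ^ 2)
      (μ.toMeasure.prod (noiseMeasure k σ)) := (memLp_noise σ).integrable_sq.const_mul 2
  have e1 := integral_fun_fst (μ := μ.toMeasure) (ν := noiseMeasure k σ)
    (fun x : RSpace k => ‖x‖ ^ 2)
  have e2 := integral_fun_snd (μ := μ.toMeasure) (ν := noiseMeasure k σ)
    (fun p : Idx k × ℝ => p.2 ^ 2)
  have e3 := integral_fun_snd (μ := idxMeasure k) (ν := gauss σ) (fun z : ℝ => z ^ 2)
  rw [noiseMeasure_real_univ hk] at e1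
  rw [probReal_univ, one_smul, noiseMeasure, e3, integral_sq_gauss, measureReal_def,
    idxMeasure_univ hk, ← noiseMeasure] at e2
  calc _ ≤ ∫ q : RSpace k × (Idx k × ℝ), (2 * ‖q.1‖ ^ 2 + 2 * q.2.2 ^ 2)
        ∂(μ.toMeasure.prod (noiseMeasure k σ)) := by
        refine integral_mono (memLp_shift hL σ).integrable_sq (i1.add i2) fun q => ?_
        have h1 := sq_inner_le q.1 q.2.1.2
        simp only [shift]
        nlinarith [sq_nonneg (inner ℝ q.1 (q.2.1.2 : RSpace k) - q.2.2)]
    _ = _ := by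
        rw [integral_add i1 i2, integral_const_mul, integral_const_mul, e1, e2, P2.secondMoment]
        simp only [smul_eq_mul, ENNReal.toReal_ofNat]
        ring

lemma integral_norm_gradField_sq_le_secondMoment (hk : 1 ≤ k) (hσ : 0 < σ) {ν : ℕ → P2 k} {ρ B : ℝ}
    (hρ : ∀ n, ‖embedLp hσ (ν n)‖ ≤ ρ) (hν : ∀ n, (ν n).secondMoment ≤ B) (μ : P2 k) :
    ∫ x, ‖gradField σ ν μ x‖ ^ 2 ∂μ.toMeasure
      ≤ 16 * μ.secondMoment + 16 * σ ^ 2 + 8 * ρ ^ 2 := by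
  have hid : Measurable (fun x : RSpace k => x) := measurable_id
  have hmap : μ.toMeasure.map (fun x : RSpace k => x) = μ.toMeasure := Measure.map_id
  have h1 := integral_norm_gradField_sq_le hk hσ hρ hν hid hmap
  have h2 := integral_sq_rearr_shift_le hid hmap hσ hρ
  have h3 := integral_sq_shift_le hk σ μ
  have i1 := (memLp_shift (memLp_two_of_map_eq hid hmap) σ).integrable_sq.const_mul 2
  have i2 := (memLp_rearr_shift hid hmap hσ hρ).integrable_sq.const_mul 2
  have h4 : ∫ q, displacement σ ν μ q.1 q.2 ^ 2 ∂(μ.toMeasure.prod (noiseMeasure k σ))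
      ≤ ∫ q : RSpace k × (Idx k × ℝ), (2 * (shift q.1 q.2).2 ^ 2
        + 2 * rearr σ ν μ (shift q.1 q.2) ^ 2) ∂(μ.toMeasure.prod (noiseMeasure k σ)) := by
    refine integral_mono (memLp_displacement hσ hρ hid hmap).integrable_sq (i1.add i2) fun q => ?_
    simp only [displacement]
    nlinarith [sq_nonneg ((shift q.1 q.2).2 + rearr σ ν μ (shift q.1 q.2))]
  rw [integral_add i1 i2, integral_const_mul, integral_const_mul] at h4
  linarith

/-- The noise energy equals 2σ² and the target energy is at most 2ρ². The weights ρ/(2σ) and σ/(2ρ)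
in the arithmetic–geometric inequality balance the two. -/
lemma integral_abs_mul_rearr_le (hk : 1 ≤ k) (hσ : 0 < σ) {ν : ℕ → P2 k} {ρ : ℝ} (hρ0 : 0 < ρ)
    (hρ : ∀ n, ‖embedLp hσ (ν n)‖ ≤ ρ) (μ : P2 k) :
    Integrable (fun q : RSpace k × (Idx k × ℝ) => |q.2.2| * |rearr σ ν μ (shift q.1 q.2)|)
      (μ.toMeasure.prod (noiseMeasure k σ)) ∧
    ∫ q : RSpace k × (Idx k × ℝ), |q.2.2| * |rearr σ ν μ (shift q.1 q.2)|
      ∂(μ.toMeasure.prod (noiseMeasure k σ)) ≤ 2 * ρ * σ := by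
  have hid : Measurable (fun x : RSpace k => x) := measurable_id
  have hmap : μ.toMeasure.map (fun x : RSpace k => x) = μ.toMeasure := Measure.map_id
  have h2 := integral_sq_rearr_shift_le hid hmap hσ hρ
  have hT := memLp_rearr_shift hid hmap hσ hρ
  have hz := memLp_noise (k := k) (P := μ.toMeasure) σ
  have i1 := hT.integrable_sq.const_mul (σ / (2 * ρ))
  have i2 := hz.integrable_sq.const_mul (ρ / (2 * σ))
  have hi : Integrable (fun q : RSpace k × (Idx k × ℝ) => |q.2.2| * |rearr σ ν μ (shift q.1 q.2)|)
      (μ.toMeasure.prod (noiseMeasure k σ)) := by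
    have := (hz.integrable_mul hT).abs
    simp only [Pi.mul_apply, abs_mul] at this
    exact this
  refine ⟨hi, ?_⟩
  have e2 := integral_fun_snd (μ := μ.toMeasure) (ν := noiseMeasure k σ)
    (fun p : Idx k × ℝ => p.2 ^ 2)
  have e3 := integral_fun_snd (μ := idxMeasure k) (ν := gauss σ) (fun z : ℝ => z ^ 2)
  rw [probReal_univ, one_smul, noiseMeasure, e3, integral_sq_gauss, measureReal_def,
    idxMeasure_univ hk, ← noiseMeasure] at e2
  calc _ ≤ ∫ q : RSpace k × (Idx k × ℝ), (σ / (2 * ρ) * rearr σ ν μ (shift q.1 q.2) ^ 2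
        + ρ / (2 * σ) * q.2.2 ^ 2) ∂(μ.toMeasure.prod (noiseMeasure k σ)) := by
        refine integral_mono hi (i1.add i2) fun q => ?_
        simp only
        rw [← sq_abs (rearr σ ν μ (shift q.1 q.2)), ← sq_abs q.2.2]
        set a := |q.2.2|
        set b := |rearr σ ν μ (shift q.1 q.2)|
        have h3 : σ / (2 * ρ) * b ^ 2 + ρ / (2 * σ) * a ^ 2 - a * b
            = (σ * b - ρ * a) ^ 2 / (2 * ρ * σ) := by
          field_simp
          ring
        have h4 : 0 ≤ (σ * b - ρ * a) ^ 2 / (2 * ρ * σ) := by positivity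
        linarith
    _ = σ / (2 * ρ) * ∫ q : RSpace k × (Idx k × ℝ), rearr σ ν μ (shift q.1 q.2) ^ 2
          ∂(μ.toMeasure.prod (noiseMeasure k σ)) + ρ / (2 * σ) * (2 * σ ^ 2) := by
        rw [integral_add i1 i2, integral_const_mul, integral_const_mul, e2]
        simp
    _ ≤ σ / (2 * ρ) * (2 * ρ ^ 2) + ρ / (2 * σ) * (2 * σ ^ 2) := by gcongr
    _ = 2 * ρ * σ := by field_simp; ring

lemma integrable_norm_fderiv_gradField (hk : 1 ≤ k) (hσ : 0 < σ) {ν : ℕ → P2 k} {ρ B : ℝ}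
    (hρ0 : 0 < ρ) (hρ : ∀ n, ‖embedLp hσ (ν n)‖ ≤ ρ) (hν : ∀ n, (ν n).secondMoment ≤ B)
    (μ : P2 k) : Integrable (fun x => ‖fderiv ℝ (gradField σ ν μ) x‖) μ.toMeasure := by
  refine ((integrable_const (2 : ℝ)).add ((integral_abs_mul_rearr_le hk hσ hρ0 hρ
    μ).1.integral_prod_left.const_mul (σ ^ 2)⁻¹)).mono'
    (measurable_fderiv ℝ _).norm.aestronglyMeasurable (ae_of_all _ fun x => ?_)
  rw [norm_norm]
  exact norm_fderiv_gradField_le hk hσ hν μ x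

lemma integral_norm_fderiv_gradField_le (hk : 1 ≤ k) (hσ : 0 < σ) {ν : ℕ → P2 k} {ρ B : ℝ}
    (hρ0 : 0 < ρ) (hρ : ∀ n, ‖embedLp hσ (ν n)‖ ≤ ρ) (hν : ∀ n, (ν n).secondMoment ≤ B)
    (μ : P2 k) : ∫ x, ‖fderiv ℝ (gradField σ ν μ) x‖ ∂μ.toMeasure ≤ 2 + 2 * ρ / σ := by
  obtain ⟨h1, h2⟩ := integral_abs_mul_rearr_le hk hσ hρ0 hρ μ
  have h3 := h1.integral_prod_left.const_mul (σ ^ 2)⁻¹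
  refine (integral_mono (integrable_norm_fderiv_gradField hk hσ hρ0 hρ hν μ)
    ((integrable_const (2 : ℝ)).add h3) (norm_fderiv_gradField_le hk hσ hν μ)).trans ?_
  rw [integral_add' (integrable_const _) h3, integral_const_mul, ← integral_prod _ h1]
  calc _ ≤ 2 + (σ ^ 2)⁻¹ * (2 * ρ * σ) := by
        rw [integral_const, probReal_univ, one_smul]
        gcongr
    _ = _ := by field_simp

/-- Pairing with the gradient field. -/
lemma integral_inner_gradField (hσ : 0 < σ) {ν : ℕ → P2 k} {ρ B : ℝ}
    (hρ : ∀ n, ‖embedLp hσ (ν n)‖ ≤ ρ) (hν : ∀ n, (ν n).secondMoment ≤ B)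
    {X : Ω → RSpace k} (hX : Measurable X) {μ : P2 k} (hμ : P.map X = μ.toMeasure)
    {H : Ω → RSpace k} (hH : MemLp H 2 P) :
    ∫ ω, inner ℝ (gradField σ ν μ (X ω)) (H ω) ∂P
      = ∫ q : Ω × (Idx k × ℝ), displacement σ ν μ (X q.1) q.2
        * inner ℝ (H q.1) (q.2.1.2 : RSpace k) ∂(P.prod (noiseMeasure k σ)) := by
  have hi := (memLp_displacement hσ hρ hX hμ).integrable_mul (memLp_inner_dir hH σ)
  rw [integral_prod _ (by exact hi)]
  refine integral_congr_ae (ae_of_all _ fun ω => ?_)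
  simp only
  have h1 := integral_inner (𝕜 := ℝ)
    (integrable_smul_dir (integrable_displacement hσ hν μ (X ω))) (H ω)
  rw [real_inner_comm]
  refine h1.symm.trans (integral_congr_ae (ae_of_all _ fun p => ?_))
  simp only
  rw [inner_smul_right]

end GradientBounds

/-! ### Fréchet differentiability of the lifting -/

section Lifting

variable {k : ℕ} {σ : ℝ} {Ω : Type*} [MeasurableSpace Ω] {P : Measure Ω} [IsProbabilityMeasure P]

/-- The distribution functions of the slices converge along almost surely convergent random
variables. -/
lemma tendsto_cdf_slice_of_ae (hσ : 0 < σ) {Y : ℕ → Ω → RSpace k} {X : Ω → RSpace k}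
    (hY : ∀ n, Measurable (Y n)) (hX : Measurable X) {μY : ℕ → P2 k} {μ : P2 k}
    (hμY : ∀ n, P.map (Y n) = (μY n).toMeasure) (hμ : P.map X = μ.toMeasure)
    (h : ∀ᵐ ω ∂P, Tendsto (fun n => Y n ω) atTop (𝓝 (X ω))) (θ : USphere k) (c : ℝ) :
    Tendsto (fun n => cdf (slice σ (μY n) θ) c) atTop (𝓝 (cdf (slice σ μ θ) c)) := by
  simp_rw [fun n => cdf_slice (hY n) (hμY n) σ θ c, cdf_slice hX hμ σ θ c]
  refine tendsto_integral_of_dominated_convergence (fun _ => 1)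
    (fun n => (integrable_cdf_comp (by have := hY n; fun_prop) _).aestronglyMeasurable)
    (integrable_const _) (fun n => ae_of_all _ fun _ => norm_cdf_le_one _ _) ?_
  filter_upwards [h] with ω hω
  have hc : Continuous fun x : RSpace k => cdf (gauss σ) (c - inner ℝ x (θ : RSpace k)) := by
    have := (hasRegularCdf_gauss hσ).cont
    fun_prop
  exact (hc.tendsto _).comp hω

lemma tendsto_rearr_shift_of_ae (hσ : 0 < σ) (ν : ℕ → P2 k) {Y : ℕ → Ω → RSpace k}
    {X : Ω → RSpace k} (hY : ∀ n, Measurable (Y n)) (hX : Measurable X) {μY : ℕ → P2 k} {μ : P2 k}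
    (hμY : ∀ n, P.map (Y n) = (μY n).toMeasure) (hμ : P.map X = μ.toMeasure)
    (h : ∀ᵐ ω ∂P, Tendsto (fun n => Y n ω) atTop (𝓝 (X ω))) :
    ∀ᵐ q : Ω × (Idx k × ℝ) ∂(P.prod (noiseMeasure k σ)),
      Tendsto (fun n => rearr σ ν (μY n) (shift (Y n q.1) q.2)) atTop
        (𝓝 (rearr σ ν μ (shift (X q.1) q.2))) := by
  filter_upwards [Measure.quasiMeasurePreserving_fst.ae h] with q hq
  have hc : Continuous fun x : RSpace k => inner ℝ x (q.2.1.2 : RSpace k) + q.2.2 := by fun_prop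
  exact tendsto_transport (a := fun n => slice σ (μY n) q.2.1.2)
    (b := fun _ => slice σ (ν q.2.1.1) q.2.1.2)
    (hasRegularCdf_slice hσ μ q.2.1.2) (hasRegularCdf_slice hσ (ν q.2.1.1) q.2.1.2)
    (fun n => hasRegularCdf_slice hσ (μY n) q.2.1.2)
    (fun _ => hasRegularCdf_slice hσ (ν q.2.1.1) q.2.1.2)
    (fun c => tendsto_cdf_slice_of_ae hσ hY hX hμY hμ h q.2.1.2 c)
    (fun c => tendsto_const_nhds) ((hc.tendsto _).comp hq)

/-- Almost everywhere convergent functions with equal energy converge in `L²`. -/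
lemma tendsto_lintegral_sq_sub_of_ae {S : Type*} [MeasurableSpace S] {m : Measure S}
    {f : ℕ → S → ℝ} {g : S → ℝ} (hf : ∀ n, Measurable (f n)) (hg : Measurable g)
    (h : ∀ᵐ x ∂m, Tendsto (fun n => f n x) atTop (𝓝 (g x))) {E : ℝ≥0∞} (hE : E ≠ ∞)
    (hfE : ∀ n, ∫⁻ x, ENNReal.ofReal (f n x ^ 2) ∂m = E)
    (hgE : ∫⁻ x, ENNReal.ofReal (g x ^ 2) ∂m = E) :
    Tendsto (fun n => ∫⁻ x, ENNReal.ofReal ((f n x - g x) ^ 2) ∂m) atTop (𝓝 0) := by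
  have hsum : ∀ e : S → ℝ, Measurable e → ∫⁻ x, ENNReal.ofReal (e x ^ 2) ∂m = E →
      ∫⁻ x, 2 * (ENNReal.ofReal (e x ^ 2) + ENNReal.ofReal (g x ^ 2)) ∂m = 2 * (E + E) :=
    fun e he heE => by
      rw [lintegral_const_mul _ (by fun_prop), lintegral_add_left (by fun_prop), heE, hgE]
  -- The domination (f − g)² ≤ 2(f² + g²) varies with n, but its integral is the constant 4E.
  refine tendsto_lintegral_zero_of_le_of_tendsto
    (a := fun n x => 2 * (ENNReal.ofReal (f n x ^ 2) + ENNReal.ofReal (g x ^ 2)))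
    (a₀ := fun x => 2 * (ENNReal.ofReal (g x ^ 2) + ENNReal.ofReal (g x ^ 2)))
    (fun n => by have := hf n; fun_prop) (fun n => by have := hf n; fun_prop)
    (fun n => ae_of_all _ fun x => ?_) ?_ ?_ ?_ ?_
  · rw [← ENNReal.ofReal_add (by positivity) (by positivity), ← ENNReal.ofReal_ofNat,
      ← ENNReal.ofReal_mul zero_le_two]
    refine ENNReal.ofReal_le_ofReal ?_
    nlinarith [sq_nonneg (f n x + g x)]
  · filter_upwards [h] with x hx
    have h1 := (ENNReal.continuous_ofReal.tendsto _).comp ((hx.sub_const (g x)).pow 2)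
    simpa [Function.comp_def] using h1
  · filter_upwards [h] with x hx
    exact ENNReal.Tendsto.const_mul
      (((ENNReal.continuous_ofReal.tendsto _).comp (hx.pow 2)).add_const _) (Or.inr (by simp))
  · rw [hsum _ hg hgE]
    exact tendsto_const_nhds.congr fun n => (hsum _ (hf n) (hfE n)).symm
  · rw [hsum _ hg hgE]
    exact ENNReal.mul_ne_top (by simp) (ENNReal.add_ne_top.2 ⟨hE, hE⟩)

/-- The optimal maps depend continuously in `L²` on the random variable. -/
lemma tendsto_lintegral_rearr_of_ae (hσ : 0 < σ) {ν : ℕ → P2 k} {ρ : ℝ}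
    (hρ : ∀ n, ‖embedLp hσ (ν n)‖ ≤ ρ) {Y : ℕ → Ω → RSpace k}
    {X : Ω → RSpace k} (hY : ∀ n, Measurable (Y n)) (hX : Measurable X) {μY : ℕ → P2 k} {μ : P2 k}
    (hμY : ∀ n, P.map (Y n) = (μY n).toMeasure) (hμ : P.map X = μ.toMeasure)
    (h : ∀ᵐ ω ∂P, Tendsto (fun n => Y n ω) atTop (𝓝 (X ω))) :
    Tendsto (fun n => ∫⁻ q : Ω × (Idx k × ℝ), ENNReal.ofReal
      ((rearr σ ν (μY n) (shift (Y n q.1) q.2) - rearr σ ν μ (shift (X q.1) q.2)) ^ 2)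
        ∂(P.prod (noiseMeasure k σ))) atTop (𝓝 0) := by
  have hf : Measurable fun s : ℝ => ENNReal.ofReal (s ^ 2) := by fun_prop
  exact tendsto_lintegral_sq_sub_of_ae
    (fun n => (continuous_rearr hσ ν (μY n)).measurable.comp (measurable_shift (hY n)))
    ((continuous_rearr hσ ν μ).measurable.comp (measurable_shift hX))
    (tendsto_rearr_shift_of_ae hσ ν hY hX hμY hμ h)
    (ne_top_of_le_ne_top ENNReal.ofReal_ne_top (lintegral_sq_target_le hσ hρ))
    (fun n => lintegral_rearr_shift (hY n) (hμY n) hσ ν hf) (lintegral_rearr_shift hX hμ hσ ν hf)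

/-- The optimal maps as elements of `L²`. -/
noncomputable def rearrLp (hσ : 0 < σ) {ν : ℕ → P2 k} {ρ : ℝ}
    (hρ : ∀ n, ‖embedLp hσ (ν n)‖ ≤ ρ) (X : Lp (RSpace k) 2 P) :
    Lp ℝ 2 (P.prod (noiseMeasure k σ)) :=
  (memLp_rearr_shift (μ := law P X) (Lp.stronglyMeasurable X).measurable rfl hσ hρ).toLp _

/-- The shifted noise as an element of `L²`. -/
noncomputable def shiftLp (σ : ℝ) (X : Lp (RSpace k) 2 P) : Lp ℝ 2 (P.prod (noiseMeasure k σ)) :=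
  (memLp_shift (Lp.memLp X) σ).toLp _

/-- L² convergence gives almost everywhere convergence only along subsequences; this suffices
because the limit is the same for all of them. -/
lemma tendsto_rearrLp (hσ : 0 < σ) {ν : ℕ → P2 k} {ρ : ℝ}
    (hρ : ∀ n, ‖embedLp hσ (ν n)‖ ≤ ρ) (X : Lp (RSpace k) 2 P) :
    Tendsto (fun Y => ‖rearrLp hσ hρ Y - rearrLp hσ hρ X‖) (𝓝 X) (𝓝 0) := by
  refine tendsto_of_subseq_tendsto fun Y hY => ?_
  obtain ⟨ms, -, hms⟩ := (tendstoInMeasure_of_tendsto_Lp hY).exists_seq_tendsto_ae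
  refine ⟨ms, ?_⟩
  have h1 := tendsto_lintegral_rearr_of_ae hσ hρ (Y := fun n => Y (ms n)) (X := X)
    (μY := fun n => law P (Y (ms n))) (μ := law P X)
    (fun n => (Lp.stronglyMeasurable _).measurable) (Lp.stronglyMeasurable _).measurable
    (fun _ => rfl) rfl hms
  have h2 : ∀ n, ‖rearrLp hσ hρ (Y (ms n)) - rearrLp hσ hρ X‖ ^ 2 = (∫⁻ q : Ω × (Idx k × ℝ),
      ENNReal.ofReal ((rearr σ ν (law P (Y (ms n))) (shift (Y (ms n) q.1) q.2)
        - rearr σ ν (law P X) (shift (X q.1) q.2)) ^ 2) ∂(P.prod (noiseMeasure k σ))).toReal :=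
    fun n => by
      rw [rearrLp, rearrLp, ← MemLp.toLp_sub, norm_toLp_sq, integral_eq_lintegral_of_nonneg_ae
        (ae_of_all _ fun _ => sq_nonneg _)
        (((memLp_rearr_shift (μ := law P (Y (ms n))) (Lp.stronglyMeasurable _).measurable rfl hσ
          hρ).sub (memLp_rearr_shift (μ := law P X) (Lp.stronglyMeasurable _).measurable rfl hσ
          hρ)).integrable_sq.aestronglyMeasurable)]
      rfl
  have h3 := (ENNReal.tendsto_toReal ENNReal.zero_ne_top).comp h1
  have h4 : Tendsto (fun n => √ (‖rearrLp hσ hρ (Y (ms n)) - rearrLp hσ hρ X‖ ^ 2)) atTop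
      (𝓝 0) := by
    rw [← Real.sqrt_zero]
    refine (Real.continuous_sqrt.tendsto _).comp ?_
    simp_rw [h2]
    exact h3
  simpa only [Real.sqrt_sq (norm_nonneg _)] using h4

lemma potential_law_eq (hσ : 0 < σ) {ν : ℕ → P2 k} {ρ : ℝ}
    (hρ : ∀ n, ‖embedLp hσ (ν n)‖ ≤ ρ) (X : Lp (RSpace k) 2 P) :
    potential σ ν (law P X) = ‖shiftLp σ X - rearrLp hσ hρ X‖ ^ 2 / 2 := by
  rw [potential_eq_integral hσ hρ (Lp.stronglyMeasurable X).measurable rfl, shiftLp, rearrLp,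
    ← MemLp.toLp_sub, norm_toLp_sq]
  rfl

lemma potential_law_le (hσ : 0 < σ) {ν : ℕ → P2 k} {ρ : ℝ}
    (hρ : ∀ n, ‖embedLp hσ (ν n)‖ ≤ ρ) (X Y : Lp (RSpace k) 2 P) :
    potential σ ν (law P Y) ≤ ‖shiftLp σ Y - rearrLp hσ hρ X‖ ^ 2 / 2 := by
  refine (potential_le_integral (μ := law P X) hσ hρ (Lp.stronglyMeasurable X).measurable
    (Lp.stronglyMeasurable Y).measurable rfl rfl).trans_eq ?_
  rw [shiftLp, rearrLp, ← MemLp.toLp_sub, norm_toLp_sq]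
  rfl

/-- An envelope argument: b is no worse than b' for a, and b' no worse than b for a'. Keeping the
target b gives the upper bound, keeping b' the lower one. The first-order term never sees the motion
of the target. -/
lemma abs_sub_sub_inner_le {E : Type*} [NormedAddCommGroup E] [InnerProductSpace ℝ E]
    {a b a' b' : E} (h : ‖a' - b'‖ ^ 2 ≤ ‖a' - b‖ ^ 2) (h' : ‖a - b‖ ^ 2 ≤ ‖a - b'‖ ^ 2) :
    |‖a' - b'‖ ^ 2 / 2 - ‖a - b‖ ^ 2 / 2 - inner ℝ (a - b) (a' - a)|
      ≤ ‖a' - a‖ ^ 2 / 2 + ‖a' - a‖ * ‖b' - b‖ := by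
  have e1 : ‖a' - b‖ ^ 2 = ‖a' - a‖ ^ 2 + 2 * inner ℝ (a - b) (a' - a) + ‖a - b‖ ^ 2 := by
    rw [show a' - b = (a' - a) + (a - b) by abel, norm_add_sq_real, real_inner_comm]
  have e2 : ‖a' - b'‖ ^ 2
      = ‖a' - a‖ ^ 2 + 2 * (inner ℝ (a - b) (a' - a) - inner ℝ (b' - b) (a' - a))
        + ‖a - b'‖ ^ 2 := by
    rw [← inner_sub_left, show a - b - (b' - b) = a - b' by abel,
      show a' - b' = (a' - a) + (a - b') by abel, norm_add_sq_real, real_inner_comm]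
  have h3 := abs_real_inner_le_norm (b' - b) (a' - a)
  rw [abs_le] at h3
  rw [abs_le]
  constructor <;> nlinarith [sq_nonneg ‖a' - a‖, norm_nonneg (a' - a), norm_nonneg (b' - b)]

lemma norm_Lp_two_sq {Ω : Type*} [MeasurableSpace Ω] {P : Measure Ω} (X : Lp (RSpace k) 2 P) :
    ‖X‖ ^ 2 = ∫ ω, ‖X ω‖ ^ 2 ∂P := by
  rw [← real_inner_self_eq_norm_sq, L2.inner_def]
  simp

lemma shiftLp_sub_eq (σ : ℝ) (X Y : Lp (RSpace k) 2 P) :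
    shiftLp σ Y - shiftLp σ X =ᵐ[P.prod (noiseMeasure k σ)]
      fun q => inner ℝ (Y q.1 - X q.1) (q.2.1.2 : RSpace k) := by
  rw [shiftLp, shiftLp, ← MemLp.toLp_sub]
  refine (MemLp.coeFn_toLp _).trans (ae_of_all _ fun q => ?_)
  simp [shift, inner_sub_left]

lemma shiftLp_sub_rearrLp_eq (hσ : 0 < σ) {ν : ℕ → P2 k} {ρ : ℝ}
    (hρ : ∀ n, ‖embedLp hσ (ν n)‖ ≤ ρ) (X : Lp (RSpace k) 2 P) :
    shiftLp σ X - rearrLp hσ hρ X =ᵐ[P.prod (noiseMeasure k σ)]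
      fun q => displacement σ ν (law P X) (X q.1) q.2 := by
  rw [shiftLp, rearrLp, ← MemLp.toLp_sub]
  exact MemLp.coeFn_toLp _

lemma norm_shiftLp_sub_sq_le (hk : 1 ≤ k) (σ : ℝ) (X Y : Lp (RSpace k) 2 P) :
    ‖shiftLp σ Y - shiftLp σ X‖ ^ 2 ≤ 2 * ‖Y - X‖ ^ 2 := by
  have hL : MemLp (fun ω => Y ω - X ω) 2 P := (Lp.memLp Y).sub (Lp.memLp X)
  have e1 : ‖shiftLp σ Y - shiftLp σ X‖ ^ 2 = ∫ q : Ω × (Idx k × ℝ),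
      inner ℝ (Y q.1 - X q.1) (q.2.1.2 : RSpace k) ^ 2 ∂(P.prod (noiseMeasure k σ)) := by
    rw [← real_inner_self_eq_norm_sq, L2.inner_def]
    refine integral_congr_ae ?_
    filter_upwards [shiftLp_sub_eq σ X Y] with q hq
    rw [hq]
    simp [sq]
  have e2 : ‖Y - X‖ ^ 2 = ∫ ω, ‖Y ω - X ω‖ ^ 2 ∂P := by
    rw [norm_Lp_two_sq]
    refine integral_congr_ae ?_
    filter_upwards [Lp.coeFn_sub Y X] with ω hω
    rw [hω, Pi.sub_apply]
  have e3 := integral_fun_fst (μ := P) (ν := noiseMeasure k σ) fun ω => ‖Y ω - X ω‖ ^ 2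
  rw [noiseMeasure_real_univ hk, smul_eq_mul] at e3
  rw [e1, e2, ← e3]
  exact integral_mono (memLp_inner_dir hL σ).integrable_sq
    (hL.integrable_norm_pow (by norm_num) |>.comp_fst _) fun q => sq_inner_le _ _

/-- The gradient of the lifted potential. -/
noncomputable def gradLp (hk : 1 ≤ k) (hσ : 0 < σ) {ν : ℕ → P2 k} {ρ B : ℝ}
    (hρ : ∀ n, ‖embedLp hσ (ν n)‖ ≤ ρ) (hν : ∀ n, (ν n).secondMoment ≤ B)
    (X : Lp (RSpace k) 2 P) : Lp (RSpace k) 2 P :=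
  MemLp.toLp (fun ω => gradField σ ν (law P X) (X ω))
    ((memLp_two_iff_integrable_sq_norm ((continuous_gradField hσ hν
      (law P X)).comp_aestronglyMeasurable (Lp.aestronglyMeasurable X))).2
      (integrable_norm_gradField_sq hk hσ hρ hν (Lp.stronglyMeasurable X).measurable rfl))

/-- By Fubini's theorem, integrating the displacement times θ over index and noise before or after
pairing with Y − X gives the same number. -/
lemma inner_gradLp (hk : 1 ≤ k) (hσ : 0 < σ) {ν : ℕ → P2 k} {ρ B : ℝ}
    (hρ : ∀ n, ‖embedLp hσ (ν n)‖ ≤ ρ) (hν : ∀ n, (ν n).secondMoment ≤ B)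
    (X Y : Lp (RSpace k) 2 P) :
    inner ℝ (gradLp hk hσ hρ hν X) (Y - X)
      = inner ℝ (shiftLp σ X - rearrLp hσ hρ X) (shiftLp σ Y - shiftLp σ X) := by
  have hL : MemLp (fun ω => Y ω - X ω) 2 P := (Lp.memLp Y).sub (Lp.memLp X)
  have h1 := integral_inner_gradField (μ := law P X) hσ hρ hν (Lp.stronglyMeasurable X).measurable
    rfl hL
  rw [L2.inner_def, L2.inner_def]
  refine Eq.trans (integral_congr_ae ?_) (h1.trans (integral_congr_ae ?_))
  · filter_upwards [Lp.coeFn_sub Y X, MemLp.coeFn_toLp ((memLp_two_iff_integrable_sq_norm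
      ((continuous_gradField hσ hν (law P X)).comp_aestronglyMeasurable
      (Lp.aestronglyMeasurable X))).2 (integrable_norm_gradField_sq hk hσ hρ hν
      (Lp.stronglyMeasurable X).measurable rfl))] with ω h1 h2
    rw [h1, gradLp, h2]
    rfl
  · filter_upwards [shiftLp_sub_eq σ X Y, shiftLp_sub_rearrLp_eq hσ hρ X] with q h1 h2
    rw [h2, h1, real_inner_eq_re_inner, RCLike.inner_apply]
    exact mul_comm _ _

lemma abs_potential_sub_le (hk : 1 ≤ k) (hσ : 0 < σ) {ν : ℕ → P2 k} {ρ B : ℝ}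
    (hρ : ∀ n, ‖embedLp hσ (ν n)‖ ≤ ρ) (hν : ∀ n, (ν n).secondMoment ≤ B)
    (X Y : Lp (RSpace k) 2 P) :
    |potential σ ν (law P Y) - potential σ ν (law P X) - inner ℝ (gradLp hk hσ hρ hν X) (Y - X)|
      ≤ (‖Y - X‖ + 2 * ‖rearrLp hσ hρ Y - rearrLp hσ hρ X‖) * ‖Y - X‖ := by
  have h1 := potential_law_le hσ hρ X Y
  have h2 := potential_law_le hσ hρ Y X
  rw [potential_law_eq hσ hρ] at h1 h2
  have h3 := abs_sub_sub_inner_le (a := shiftLp σ X) (b := rearrLp hσ hρ X) (a' := shiftLp σ Y)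
    (b' := rearrLp hσ hρ Y) (by linarith) (by linarith)
  rw [potential_law_eq hσ hρ, potential_law_eq hσ hρ, inner_gradLp]
  refine h3.trans ?_
  have h4 := norm_shiftLp_sub_sq_le hk σ X Y
  have h5 : ‖shiftLp σ Y - shiftLp σ X‖ ≤ 2 * ‖Y - X‖ := by
    refine abs_le_of_sq_le_sq' ?_ (by positivity) |>.2
    nlinarith [sq_nonneg ‖Y - X‖]
  nlinarith [mul_le_mul_of_nonneg_right h5 (norm_nonneg (rearrLp hσ hρ Y - rearrLp hσ hρ X))]

/-- The lifted potential is Fréchet differentiable. -/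
theorem hasGradientAt_potential (hk : 1 ≤ k) (hσ : 0 < σ) {ν : ℕ → P2 k} {ρ B : ℝ}
    (hρ : ∀ n, ‖embedLp hσ (ν n)‖ ≤ ρ) (hν : ∀ n, (ν n).secondMoment ≤ B)
    (X : Lp (RSpace k) 2 P) :
    HasGradientAt (fun Y => potential σ ν (law P Y)) (gradLp hk hσ hρ hν X) X := by
  rw [hasGradientAt_iff_isLittleO, Asymptotics.isLittleO_iff]
  intro c hc
  have h1 : Tendsto (fun Y => ‖Y - X‖ + 2 * ‖rearrLp hσ hρ Y - rearrLp hσ hρ X‖) (𝓝 X)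
      (𝓝 0) := by
    have h2 : Tendsto (fun Y => ‖Y - X‖) (𝓝 X) (𝓝 0) :=
      tendsto_iff_norm_sub_tendsto_zero.1 tendsto_id
    simpa using h2.add ((tendsto_rearrLp hσ hρ X).const_mul 2)
  filter_upwards [h1.eventually_le_const hc] with Y hY
  exact (abs_potential_sub_le hk hσ hρ hν X Y).trans (by gcongr)

/-- The gradient field is the `L`-derivative of the potential. -/
theorem isLDerivative_potential (hk : 1 ≤ k) (hσ : 0 < σ) {ν : ℕ → P2 k} {ρ B : ℝ}
    (hρ : ∀ n, ‖embedLp hσ (ν n)‖ ≤ ρ) (hν : ∀ n, (ν n).secondMoment ≤ B) :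
    IsLDerivative.{u} (potential σ ν) (gradField σ ν) :=
  ⟨fun μ x => tendsto_gradField hσ hν μ x, fun _ _ _ _ _ X =>
    ⟨gradLp hk hσ hρ hν X, MemLp.coeFn_toLp _, hasGradientAt_potential hk hσ hρ hν X⟩⟩

end Lifting

/-! ### The gauge and the maximizer on the strip -/

section Gauge

variable {k : ℕ} {σ : ℝ}

lemma IsLDerivative.const_add {f : P2 k → ℝ} {D : P2 k → RSpace k → RSpace k}
    (h : IsLDerivative.{u} f D) (c : ℝ) : IsLDerivative.{u} (fun μ => c + f μ) D := by
  refine ⟨h.1, fun Ω _ P _ hA X => ?_⟩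
  obtain ⟨Z, h1, h2⟩ := h.2 Ω P hA X
  exact ⟨Z, h1, hasGradientAt_iff_hasFDerivAt.2 ((hasGradientAt_iff_hasFDerivAt.1 h2).const_add c)⟩

lemma rho_eq (hσ : 0 < σ) (p q : ℝ × P2 k) :
    rho σ p q = (q.1 - p.1) ^ 2 + ‖embedLp hσ p.2 - embedLp hσ q.2‖ ^ 2 / 2 := by
  rw [rho, sq_abs, SW2reg_sq_eq_norm hσ]

lemma rho_nonneg (σ : ℝ) (p q : ℝ × P2 k) : 0 ≤ rho σ p q := by
  unfold rho; positivity

lemma rho_self (hσ : 0 < σ) (p : ℝ × P2 k) : rho σ p p = 0 := by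
  simp [rho_eq hσ]

lemma rho_comm (hσ : 0 < σ) (p q : ℝ × P2 k) : rho σ p q = rho σ q p := by
  rw [rho_eq hσ, rho_eq hσ, norm_sub_rev]
  ring

/-- `rho` is a sum of squared distances, so the triangle inequality survives with constant 2.
Separation and summability need no more. -/
lemma rho_le_two_mul (hσ : 0 < σ) (p q r : ℝ × P2 k) :
    rho σ p r ≤ 2 * (rho σ p q + rho σ r q) := by
  simp_rw [rho_eq hσ]
  have h1 := norm_sub_le_norm_sub_add_norm_sub (embedLp hσ p.2) (embedLp hσ q.2) (embedLp hσ r.2)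
  rw [norm_sub_rev (embedLp hσ q.2)] at h1
  have h2 := norm_nonneg (embedLp hσ p.2 - embedLp hσ r.2)
  set a := ‖embedLp hσ p.2 - embedLp hσ q.2‖
  set b := ‖embedLp hσ r.2 - embedLp hσ q.2‖
  have h3 : ‖embedLp hσ p.2 - embedLp hσ r.2‖ ^ 2 ≤ (a + b) ^ 2 := by gcongr
  nlinarith [sq_nonneg (a - b), sq_nonneg (q.1 - p.1 + (q.1 - r.1))]

lemma eq_of_rho_eq_zero (hσ : 0 < σ) {p q : ℝ × P2 k} (h : rho σ p q = 0) : p = q := by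
  rw [rho_eq hσ] at h
  have h1 : (q.1 - p.1) ^ 2 = 0 := by
    nlinarith [sq_nonneg (q.1 - p.1), sq_nonneg ‖embedLp hσ p.2 - embedLp hσ q.2‖]
  have h2 : ‖embedLp hσ p.2 - embedLp hσ q.2‖ ^ 2 = 0 := by nlinarith
  rw [sq_eq_zero_iff] at h1 h2
  exact Prod.ext (by linarith) (eq_of_embedLp_eq hσ (sub_eq_zero.1 (norm_eq_zero.1 h2)))

lemma eq_of_tendsto_rho (hσ : 0 < σ) {x : ℕ → ℝ × P2 k} {y z : ℝ × P2 k}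
    (hy : Tendsto (fun n => rho σ y (x n)) atTop (𝓝 0))
    (hz : Tendsto (fun n => rho σ z (x n)) atTop (𝓝 0)) : y = z := by
  have h1 : Tendsto (fun n => 2 * (rho σ y (x n) + rho σ z (x n))) atTop (𝓝 0) := by
    simpa using (hy.add hz).const_mul 2
  exact eq_of_rho_eq_zero hσ (le_antisymm
    (ge_of_tendsto' h1 fun n => rho_le_two_mul hσ y (x n) z) (rho_nonneg _ _ _))

lemma summable_rho (hσ : 0 < σ) {x : ℕ → ℝ × P2 k} {y : ℝ × P2 k} {c : ℝ}
    (h : ∀ n, rho σ y (x n) ≤ c) (z : ℝ × P2 k) :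
    Summable fun n => 1 / 2 ^ n * rho σ z (x n) := by
  refine Summable.of_nonneg_of_le (fun n => mul_nonneg (by positivity) (rho_nonneg _ _ _))
    (fun n => ?_) (hasSum_dyadic.summable.mul_right (2 * (rho σ z y + c)))
  have h1 := rho_le_two_mul hσ z y (x n)
  rw [rho_comm hσ (x n) y] at h1
  have h2 := h n
  gcongr
  linarith

/-- Time converges by compactness of the interval. The measures converge both in the embedding,
which gives convergence of the gauges, and in W₂, which is where `G` is semicontinuous. -/
lemma exists_rho_cluster (hk : 1 ≤ k) (hσ : 0 < σ) {T : ℝ} {G : ℝ × P2 k → ℝ}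
    (hG : UpperSemicontinuousOnStrip T G) {x : ℕ → ℝ × P2 k} (hx : ∀ n, x n ∈ strip k T)
    {ε : ℕ → ℝ} (hε : Tendsto ε atTop (𝓝 0)) (h : ∀ n m, n ≤ m → rho σ (x m) (x n) ≤ ε n) :
    ∃ x₀ ∈ strip k T, ∃ ψ : ℕ → ℕ, StrictMono ψ ∧
      (∀ y, Tendsto (fun j => rho σ (x (ψ j)) y) atTop (𝓝 (rho σ x₀ y))) ∧
      ∀ c, G x₀ < c → ∀ᶠ j in atTop, G (x (ψ j)) < c := by
  obtain ⟨μ, ψ, hψ, h1, h2⟩ := exists_tendsto_of_cauchy (ν := fun n => (x n).2) hk hσ hε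
    fun n m hnm => (h n m hnm).trans' (by rw [rho]; exact le_add_of_nonneg_left (by positivity))
  obtain ⟨t, ht, φ, hφ, h3⟩ := (isCompact_Icc (a := (0 : ℝ)) (b := T)).tendsto_subseq
    (x := fun n => (x (ψ n)).1) fun n => (hx (ψ n)).1
  have h4 := h1.comp hφ.tendsto_atTop
  have h5 := h2.comp (hψ.comp hφ).tendsto_atTop
  refine ⟨(t, μ), ⟨ht, mem_univ _⟩, ψ ∘ φ, hψ.comp hφ, fun y => ?_, fun c hc => ?_⟩
  · simp_rw [rho_eq hσ]
    exact ((h3.const_sub y.1).pow 2).add (((h5.sub_const _).norm.pow 2).div_const 2)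
  · have h6 : Tendsto (fun j => x (ψ (φ j))) atTop (𝓝[Icc 0 T] t ×ˢ μ.nhdsW2) :=
      (tendsto_nhdsWithin_iff.2 ⟨h3, Eventually.of_forall fun j => (hx _).1⟩).prodMk h4
    exact h6.eventually (hG (t, μ) ⟨ht, mem_univ _⟩ c hc)

/-- The perturbed maximization on the strip. -/
theorem exists_strip_maximizer (hk : 1 ≤ k) {lam T δ : ℝ} (hlam : 0 < lam) (hδ : 0 < δ)
    {G : ℝ × P2 k → ℝ} (hG : UpperSemicontinuousOnStrip T G) (hbdd : BddAbove (G '' strip k T))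
    {p₀ : ℝ × P2 k} (hp₀ : p₀ ∈ strip k T) (hmax : sSup (G '' strip k T) - lam ≤ G p₀) :
    ∃ q ∈ strip k T, ∃ p : ℕ → ℝ × P2 k, p 0 = p₀ ∧ (∀ n, p n ∈ strip k T) ∧
      (∀ n, rho (1 / δ) q (p n) ≤ lam / (2 ^ n * δ ^ 2)) ∧
      G p₀ ≤ G q - δ ^ 2 * phi δ p q ∧
      ∀ q' ∈ strip k T, q' ≠ q → G q' - δ ^ 2 * phi δ p q' < G q - δ ^ 2 * phi δ p q := by
  have hσ : 0 < 1 / δ := by positivity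
  have hε0 : Tendsto (fun n : ℕ => lam / (2 ^ n * δ ^ 2)) atTop (𝓝 0) := by
    have h1 := (tendsto_pow_atTop_nhds_zero_of_lt_one (r := (1 / 2 : ℝ)) (by norm_num)
      (by norm_num)).const_mul (lam / δ ^ 2)
    rw [mul_zero] at h1
    refine h1.congr fun n => ?_
    rw [one_div, inv_pow]
    field_simp
  obtain ⟨q, p, h0, h1, h2, h3⟩ := exists_perturbed_maximizer (X := strip k T) (fun x => G x.1)
    (fun x y => rho (1 / δ) x.1 y.1) hδ hlam (fun x => rho_self hσ _)
    (fun x y => rho_nonneg _ _ _) (by rwa [image_eq_range] at hbdd)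
    (fun x hx => by
      obtain ⟨x₀, hx₀, ψ, hψ, h1, h2⟩ := exists_rho_cluster hk hσ hG (fun n => (x n).2) hε0 hx
      exact ⟨⟨x₀, hx₀⟩, ψ, hψ, fun y => h1 y.1, h2⟩)
    (fun x y z hy hz => Subtype.ext (eq_of_tendsto_rho hσ hy hz))
    (fun x y z h => summable_rho hσ (y := y.1) (c := lam / δ ^ 2) (fun n => (h n).trans (by
      gcongr
      exact le_mul_of_one_le_left (by positivity) (one_le_pow₀ one_le_two))) z.1)
    ⟨p₀, hp₀⟩ (fun x => (sub_le_sub_right (le_csSup hbdd (mem_image_of_mem G x.2)) lam).trans hmax)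
  exact ⟨q.1, q.2, fun n => (p n).1, congrArg Subtype.val h0, fun n => (p n).2, h1, h2,
    fun q' hq' hne => h3 ⟨q', hq'⟩ fun h => hne (congrArg Subtype.val h)⟩

end Gauge

/-! ### Dependence on time -/

section TimePart

/-- A dyadic average of squared distances is a quadratic polynomial. -/
lemma exists_hasSum_sq_sub {T : ℝ} {t : ℕ → ℝ} (ht : ∀ n, t n ∈ Icc 0 T) :
    ∃ a b : ℝ, 0 ≤ a ∧ a ≤ 2 * T ∧ ∀ s,
      HasSum (fun n => 1 / 2 ^ n * (t n - s) ^ 2) (2 * s ^ 2 - 2 * a * s + b) := by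
  have hs1 : Summable fun n => 1 / 2 ^ n * t n :=
    Summable.of_nonneg_of_le (fun n => mul_nonneg (by positivity) (ht n).1)
      (fun n => mul_le_mul_of_nonneg_left (ht n).2 (by positivity))
      (hasSum_dyadic.summable.mul_right T)
  have hs2 : Summable fun n => 1 / 2 ^ n * t n ^ 2 :=
    Summable.of_nonneg_of_le (fun n => by positivity)
      (fun n => mul_le_mul_of_nonneg_left (pow_le_pow_left₀ (ht n).1 (ht n).2 2) (by positivity))
      (hasSum_dyadic.summable.mul_right (T ^ 2))
  refine ⟨∑' n, 1 / 2 ^ n * t n, ∑' n, 1 / 2 ^ n * t n ^ 2,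
    tsum_nonneg fun n => mul_nonneg (by positivity) (ht n).1, ?_, fun s => ?_⟩
  · rw [← (hasSum_dyadic.mul_right T).tsum_eq]
    exact hs1.tsum_le_tsum (fun n => mul_le_mul_of_nonneg_left (ht n).2 (by positivity))
      (hasSum_dyadic.summable.mul_right T)
  · have h1 := ((hasSum_dyadic.mul_right (s ^ 2)).sub (hs1.hasSum.mul_left (2 * s))).add hs2.hasSum
    have h2 : ∀ n, 1 / 2 ^ n * (t n - s) ^ 2
        = 1 / 2 ^ n * s ^ 2 - 2 * s * (1 / 2 ^ n * t n) + 1 / 2 ^ n * t n ^ 2 := fun n => by ring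
    simp_rw [h2, mul_right_comm]
    exact h1

variable {k : ℕ}

lemma exists_phi_eq {T δ c : ℝ} (hδ : 0 < δ) {p : ℕ → ℝ × P2 k} (hp : ∀ n, p n ∈ strip k T)
    (hc : ∀ n, ‖embedLp (one_div_pos.2 hδ) (p n).2‖ ≤ c) :
    ∃ a b : ℝ, 0 ≤ a ∧ a ≤ 2 * T ∧ ∀ s μ, phi δ p (s, μ)
      = 2 * s ^ 2 - 2 * a * s + b + potential (1 / δ) (fun n => (p n).2) μ := by
  obtain ⟨a, b, ha0, ha, h⟩ := exists_hasSum_sq_sub (t := fun n => (p n).1) fun n => (hp n).1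
  refine ⟨a, b, ha0, ha, fun s μ => ?_⟩
  rw [phi, potential, ← (h s).tsum_eq,
    ← (h s).summable.tsum_add (summable_potential (one_div_pos.2 hδ) hc μ)]
  refine tsum_congr fun n => ?_
  rw [rho, sq_abs]
  ring

lemma hasDerivWithinAt_phi {T δ c : ℝ} (hδ : 0 < δ) {p : ℕ → ℝ × P2 k}
    (hp : ∀ n, p n ∈ strip k T) (hc : ∀ n, ‖embedLp (one_div_pos.2 hδ) (p n).2‖ ≤ c) {t : ℝ}
    (ht : t ∈ Icc 0 T) (μ : P2 k) :
    ∃ d : ℝ, HasDerivWithinAt (fun s => phi δ p (s, μ)) d (Icc 0 T) t ∧ |d| ≤ 4 * T := by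
  obtain ⟨a, b, ha0, ha, h⟩ := exists_phi_eq hδ hp hc
  simp_rw [fun s => h s μ]
  -- Both 4t and 2a lie in [0, 4T], so their difference has absolute value at most 4T.
  refine ⟨2 * (2 * t) - 2 * a, ?_, abs_le.2 ⟨by linarith [ht.1], by linarith [ht.2]⟩⟩
  have h1 := ((((hasDerivAt_pow 2 t).const_mul 2).sub
    ((hasDerivAt_id t).const_mul (2 * a))).add_const b).add_const (potential (1 / δ) (fun n => (p n).2) μ)
  have h2 : 2 * ((2 : ℕ) * t ^ (2 - 1)) - 2 * a * 1 = 2 * (2 * t) - 2 * a := by simp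
  rw [h2] at h1
  exact h1.hasDerivWithinAt

end TimePart

/-! ### Size of the perturbation points and final constants -/

/-- The size of the points `p n` in terms of the maximizer. -/
noncomputable def radius {k : ℕ} (lam σ : ℝ) (μ : P2 k) : ℝ :=
  √(μ.secondMoment + σ ^ 2) + √(2 * lam) * σ

section Radius

variable {k : ℕ} {lam σ : ℝ}

lemma radius_pos (hσ : 0 < σ) (μ : P2 k) : 0 < radius lam σ μ := by
  have := μ.secondMoment_nonneg
  unfold radius
  positivity

lemma norm_embedLp_le_radius (hk : 1 ≤ k) (hσ : 0 < σ) {p q : ℝ × P2 k}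
    (h : rho σ q p ≤ lam * σ ^ 2) : ‖embedLp hσ p.2‖ ≤ radius lam σ q.2 := by
  have h1 : ‖embedLp hσ q.2‖ ≤ √(q.2.secondMoment + σ ^ 2) :=
    Real.le_sqrt_of_sq_le (norm_embedLp_sq_le hk hσ q.2)
  -- Half the squared distance is at most λσ², which produces the term √(2λ)·σ in `radius`.
  have h2 : ‖embedLp hσ q.2 - embedLp hσ p.2‖ ≤ √(2 * lam * σ ^ 2) := by
    rw [rho_eq hσ] at h
    exact Real.le_sqrt_of_sq_le (by nlinarith [sq_nonneg (p.1 - q.1)])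
  rw [Real.sqrt_mul' _ (sq_nonneg σ), Real.sqrt_sq hσ.le] at h2
  rw [norm_sub_rev] at h2
  have h3 := norm_sub_norm_le (embedLp hσ p.2) (embedLp hσ q.2)
  rw [radius]
  linarith

lemma radius_sq_le (hlam : 0 ≤ lam) (μ : P2 k) :
    radius lam σ μ ^ 2 ≤ 2 * (μ.secondMoment + σ ^ 2) + 4 * lam * σ ^ 2 := by
  have h0 := μ.secondMoment_nonneg
  have h1 : √(μ.secondMoment + σ ^ 2) ^ 2 = μ.secondMoment + σ ^ 2 := Real.sq_sqrt (by positivity)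
  have h2 : (√(2 * lam) * σ) ^ 2 = 2 * lam * σ ^ 2 := by
    rw [mul_pow, Real.sq_sqrt (by positivity)]
  rw [radius]
  nlinarith [sq_nonneg (√(μ.secondMoment + σ ^ 2) - √(2 * lam) * σ)]

lemma radius_le (hlam : 0 ≤ lam) (hσ : 0 < σ) (μ : P2 k) :
    radius lam σ μ ≤ √μ.secondMoment + (2 + lam) * σ := by
  have h1 : √(μ.secondMoment + σ ^ 2) ≤ √μ.secondMoment + σ := by
    rw [Real.sqrt_le_left (by positivity)]
    nlinarith [Real.sq_sqrt μ.secondMoment_nonneg, Real.sqrt_nonneg μ.secondMoment]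
  have h2 : √(2 * lam) ≤ 1 + lam := by
    rw [Real.sqrt_le_left (by positivity)]
    nlinarith [sq_nonneg lam]
  rw [radius]
  nlinarith [mul_le_mul_of_nonneg_right h2 hσ.le]

end Radius

theorem proposition1 (k : ℕ) (hk : 1 ≤ k) (lam : ℝ) (hlam : 0 < lam) :
    -- the constant depends only on the dimension and on `lam`
    ∃ C : ℝ, ∀ (T δ : ℝ), 0 < T → 0 < δ →
      ∀ G : ℝ × P2 k → ℝ, UpperSemicontinuousOnStrip T G → BddAbove (G '' strip k T) →
      ∀ p₀ ∈ strip k T, sSup (G '' strip k T) - lam ≤ G p₀ →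
      ∃ q ∈ strip k T, ∃ p : ℕ → ℝ × P2 k, p 0 = p₀ ∧ (∀ n, p n ∈ strip k T) ∧
        -- the points `p n` are close to the maximizer `q`
        (∀ n, rho (1 / δ) q (p n) ≤ lam / (2 ^ n * δ ^ 2)) ∧
        -- the series that defines `phi` converges, and the perturbed value at `q` is at least `G p₀`
        (∀ q' ∈ strip k T, Summable fun n => 1 / 2 ^ n * rho (1 / δ) q' (p n)) ∧
        G p₀ ≤ G q - δ ^ 2 * phi δ p q ∧
        -- `q` is the strict maximizer of the perturbed function
        (∀ q' ∈ strip k T, q' ≠ q → G q' - δ ^ 2 * phi δ p q' < G q - δ ^ 2 * phi δ p q) ∧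
        -- differentiability in time, with the bound on the derivative
        (∀ t ∈ Set.Icc 0 T, ∀ μ : P2 k, ∃ d : ℝ,
          HasDerivWithinAt (fun s => phi δ p (s, μ)) d (Set.Icc 0 T) t ∧ |d| ≤ 4 * T) ∧
        -- differentiability in measure, with the bounds on `D_μ φ` and `D²_{xμ} φ`
        (∀ t ∈ Set.Icc 0 T, ∃ D : P2 k → RSpace k → RSpace k,
          IsLDerivative.{u} (fun μ => phi δ p (t, μ)) D ∧
          ∀ μ : P2 k,
            (MeasureTheory.Integrable (fun x => ‖D μ x‖ ^ 2) μ.toMeasure ∧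
              ∫ x, ‖D μ x‖ ^ 2 ∂μ.toMeasure
                ≤ C * (μ.secondMoment + q.2.secondMoment + 1 / δ ^ 2)) ∧
            Differentiable ℝ (D μ) ∧
            MeasureTheory.Integrable (fun x => ‖fderiv ℝ (D μ) x‖) μ.toMeasure ∧
              ∫ x, ‖fderiv ℝ (D μ) x‖ ∂μ.toMeasure
                ≤ C * (1 + δ * √ q.2.secondMoment)) := by
  -- The gradient bound 16m + 16σ² + 8ρ², with ρ² ≤ 2(m_q + σ²) + 4λσ², has coefficient exactly 32 +
  -- 32λ at σ² = 1/δ². The second-order bound 2 + 2δρ is at most 6 + 2λ + 2δ√m_q, which is smaller.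
  refine ⟨32 + 32 * lam, fun T δ _ hδ G hG hbdd p₀ hp₀ hmax => ?_⟩
  have hσ : 0 < 1 / δ := one_div_pos.2 hδ
  obtain ⟨q, hq, p, h0, hp, hclose, hval, hstrict⟩ :=
    exists_strip_maximizer hk hlam hδ hG hbdd hp₀ hmax
  have hclose' : ∀ n, rho (1 / δ) q (p n) ≤ lam * (1 / δ) ^ 2 := fun n => by
    refine (hclose n).trans ?_
    rw [one_div, inv_pow, ← div_eq_mul_inv]
    gcongr
    exact le_mul_of_one_le_left (by positivity) (one_le_pow₀ one_le_two)
  have hρ : ∀ n, ‖embedLp hσ (p n).2‖ ≤ radius lam (1 / δ) q.2 :=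
    fun n => norm_embedLp_le_radius hk hσ (hclose' n)
  obtain ⟨K, hK0, hK⟩ := exists_secondMoment_le_norm_embedLp hk
  -- This moment bound serves only domination and integrability, so the constant K does not enter
  -- the final estimates.
  have hB : ∀ n, (p n).2.secondMoment ≤ K * radius lam (1 / δ) q.2 ^ 2 := fun n =>
    (hK hσ _).trans (by gcongr; exact hρ n)
  refine ⟨q, hq, p, h0, hp, hclose, fun q' _ => summable_rho hσ hclose' q', hval, hstrict,
    fun t ht μ => hasDerivWithinAt_phi hδ hp hρ ht μ, fun t _ =>
    ⟨gradField (1 / δ) fun n => (p n).2, ?_, fun μ => ⟨⟨?_, ?_⟩, ?_, ?_, ?_⟩⟩⟩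
  -- For fixed t the time part is a constant added to the potential and leaves the derivative
  -- unchanged.
  · obtain ⟨a, b, -, -, h⟩ := exists_phi_eq hδ hp hρ
    simp_rw [fun μ => h t μ]
    exact (isLDerivative_potential hk hσ hρ hB).const_add _
  · exact integrable_norm_gradField_sq hk hσ hρ hB (X := fun x => x) measurable_id Measure.map_id
  · refine (integral_norm_gradField_sq_le_secondMoment hk hσ hρ hB μ).trans ?_
    have h1 := radius_sq_le (σ := 1 / δ) hlam.le q.2
    have h2 := q.2.secondMoment_nonneg
    have h3 := μ.secondMoment_nonneg
    rw [← one_div_pow]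
    nlinarith [mul_nonneg hlam.le h2, mul_nonneg hlam.le h3]
  · exact differentiable_gradField hσ hB μ
  · exact integrable_norm_fderiv_gradField hk hσ (radius_pos hσ q.2) hρ hB μ
  · refine (integral_norm_fderiv_gradField_le hk hσ (radius_pos hσ q.2) hρ hB μ).trans ?_
    have h1 := mul_le_mul_of_nonneg_left (radius_le hlam.le hσ q.2) hδ.le
    have h2 : δ * (√q.2.secondMoment + (2 + lam) * (1 / δ))
        = δ * √q.2.secondMoment + (2 + lam) := by
      field_simp
    have h3 : 0 ≤ δ * √q.2.secondMoment := by positivity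
    rw [mul_div_assoc, div_div_eq_mul_div, div_one, mul_comm (radius lam (1 / δ) q.2)]
    nlinarith [mul_nonneg hlam.le h3]
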